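/- Largest $st$-Bond is fixed-parameter tractable when parameterized by treewidth. An instance $x$ of Largest $st$-Bond consists of a finite simple undirected graph $G=(V,E)$, vertices $s,t\in V$, and a positive integer $k$. The question is whether there is a set $S\subset V$ with $s\in S$ and $t\notin S$ such that the induced subgraphs $G[S]$ and $G[V\setminus S]$ are both connected and $|\partial(S)|\ge k$, where $\partial(S)$ is the set of edges of $G$ with one endpoint in $S$ and the other in $V\setminus S$. The claim is that there are an algorithm, a computable function $f:\mathbb{N}\to\mathbb{N}$ and a constant $c\in\mathbb{N}$ such that, on every instance $x=(G,s,t,k)$, encoded as a bit string of length $|x|$ ($G$ by its adjacency matrix, $k$ in binary), the algorithm correctly answers the question after at most $f(\mathrm{tw}(G))\cdot |x|^{c}$ steps. Here $\mathrm{tw}(G)$ is the treewidth of $G$; neither its value nor a tree decomposition of $G$ is part of the input. -/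

import Mathlib

namespace StBond

/-! ### Algorithms: while-programs over cons cells, with a step count -/

/-- Data values: `nil` and cons cells (binary trees). -/
inductive Val : Type
  | nil : Val
  | cons : Val → Val → Val

/-- First component of a cons cell (`nil` on `nil`). -/
def Val.hd : Val → Val
  | .nil => .nil
  | .cons a _ => a

/-- Second component of a cons cell (`nil` on `nil`). -/
def Val.tl : Val → Val
  | .nil => .nil
  | .cons _ b => b

/-- A bit as a value: `0` is `nil`, `1` is a fixed cell. -/
def Val.ofBit : Bool → Val
  | false => .nil
  | true => .cons .nil .nil

/-- A bit string as a linked list. -/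
def Val.ofBits : List Bool → Val
  | [] => .nil
  | b :: l => .cons (Val.ofBit b) (Val.ofBits l)

/-- Programs. Variables are numbered; a given program mentions finitely many of them. -/
inductive Prog : Type
  | setNil (x : ℕ) : Prog
  | copy (x y : ℕ) : Prog
  | cons (x y z : ℕ) : Prog
  | hd (x y : ℕ) : Prog
  | tl (x y : ℕ) : Prog
  | seq (p q : Prog) : Prog
  | ite (x : ℕ) (p q : Prog) : Prog
  | loop (x : ℕ) (p : Prog) : Prog

/-- The contents of all variables. -/
abbrev Store : Type := ℕ → Val

/-- `Exec p σ T τ`: the program `p`, started in the store `σ`, halts in the store `τ` after exactly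
`T` elementary steps. Every assignment and every test of a variable against `nil` is one step.
A step copies a pointer, follows a pointer, or allocates a single new cell, and there is no
arithmetic, so that `T` steps on an input of `N` bits take a Turing machine time polynomial in
`T + N`, and conversely a Turing machine step takes a bounded number of these steps. -/
inductive Exec : Prog → Store → ℕ → Store → Prop
  | setNil (x : ℕ) (σ : Store) : Exec (.setNil x) σ 1 (Function.update σ x .nil)
  | copy (x y : ℕ) (σ : Store) : Exec (.copy x y) σ 1 (Function.update σ x (σ y))
  | cons (x y z : ℕ) (σ : Store) :
      Exec (.cons x y z) σ 1 (Function.update σ x (.cons (σ y) (σ z)))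
  | hd (x y : ℕ) (σ : Store) : Exec (.hd x y) σ 1 (Function.update σ x (σ y).hd)
  | tl (x y : ℕ) (σ : Store) : Exec (.tl x y) σ 1 (Function.update σ x (σ y).tl)
  | seq {p q : Prog} {σ τ ρ : Store} {T U : ℕ} :
      Exec p σ T τ → Exec q τ U ρ → Exec (.seq p q) σ (T + U) ρ
  | iteTrue {x : ℕ} {p q : Prog} {σ τ : Store} {T : ℕ} :
      σ x ≠ .nil → Exec p σ T τ → Exec (.ite x p q) σ (T + 1) τ
  | iteFalse {x : ℕ} {p q : Prog} {σ τ : Store} {T : ℕ} :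
      σ x = .nil → Exec q σ T τ → Exec (.ite x p q) σ (T + 1) τ
  | loopStep {x : ℕ} {p : Prog} {σ τ ρ : Store} {T U : ℕ} :
      σ x ≠ .nil → Exec p σ T τ → Exec (.loop x p) τ U ρ → Exec (.loop x p) σ (T + U + 1) ρ
  | loopDone {x : ℕ} {p : Prog} {σ : Store} :
      σ x = .nil → Exec (.loop x p) σ 1 σ

/-- Programs are deterministic: final store and number of steps are determined by the start. -/
theorem Exec.deterministic {p : Prog} {σ τ : Store} {T : ℕ} (h : Exec p σ T τ) :
    ∀ {T' : ℕ} {τ' : Store}, Exec p σ T' τ' → T = T' ∧ τ = τ' := by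
  induction h with
  | setNil | copy | cons | hd | tl => intro T' τ' h'; cases h'; exact ⟨rfl, rfl⟩
  | seq _ _ ih₁ ih₂ =>
    intro T' τ' h'
    cases h' with
    | seq a b =>
      obtain ⟨rfl, rfl⟩ := ih₁ a
      obtain ⟨rfl, rfl⟩ := ih₂ b
      exact ⟨rfl, rfl⟩
  | iteTrue hx _ ih =>
    intro T' τ' h'
    cases h' with
    | iteTrue _ a => obtain ⟨rfl, rfl⟩ := ih a; exact ⟨rfl, rfl⟩
    | iteFalse hy _ => exact absurd hy hx
  | iteFalse hx _ ih =>
    intro T' τ' h'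
    cases h' with
    | iteTrue hy _ => exact absurd hx hy
    | iteFalse _ a => obtain ⟨rfl, rfl⟩ := ih a; exact ⟨rfl, rfl⟩
  | loopStep hx _ _ ih₁ ih₂ =>
    intro T' τ' h'
    cases h' with
    | loopStep _ a b =>
      obtain ⟨rfl, rfl⟩ := ih₁ a
      obtain ⟨rfl, rfl⟩ := ih₂ b
      exact ⟨rfl, rfl⟩
    | loopDone hy => exact absurd hy hx
  | loopDone hx =>
    intro T' τ' h'
    cases h' with
    | loopStep hy _ _ => exact absurd hx hy
    | loopDone _ => exact ⟨rfl, rfl⟩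

/-- The initial store: the input bit string in variable `0`, all other variables `nil`. -/
def initStore (w : List Bool) : Store := fun x => if x = 0 then Val.ofBits w else .nil

/-- `DecidesWithin p w T b`: on input `w`, the program `p` halts after at most `T` steps, and
accepts (variable `0` is not `nil` at the end) if and only if `b` holds. -/
def DecidesWithin (p : Prog) (w : List Bool) (T : ℕ) (b : Prop) : Prop :=
  ∃ (U : ℕ) (τ : Store), U ≤ T ∧ Exec p (initStore w) U τ ∧ (τ 0 ≠ .nil ↔ b)

/-- Fixed-parameter tractability of the decision problem `yes` on instances of type `α`, encoded as
bit strings by `enc`, with respect to the parameter `κ`: one program decides every instance `x`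
within `f (κ x) * |enc x| ^ c` steps, for a computable function `f` and a constant `c`. -/
def FixedParameterTractable {α : Type} (enc : α → List Bool) (yes : α → Prop) (κ : α → ℕ) : Prop :=
  ∃ (p : Prog) (f : ℕ → ℕ) (c : ℕ), Computable f ∧
    ∀ x : α, DecidesWithin p (enc x) (f (κ x) * (enc x).length ^ c) (yes x)

/-! ### Treewidth -/

/-- A tree decomposition of `G` whose tree has node set `ι`. -/
structure TreeDecomposition {V : Type} (G : SimpleGraph V) (ι : Type) where
  tree : SimpleGraph ι
  isTree : tree.IsTree
  bag : ι → Finset V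
  exists_mem_bag : ∀ v : V, ∃ i, v ∈ bag i
  exists_edge_bag : ∀ u v : V, G.Adj u v → ∃ i, u ∈ bag i ∧ v ∈ bag i
  connected_bags : ∀ v : V, (tree.induce {i | v ∈ bag i}).Connected

/-- The least `w` such that `G` has a tree decomposition over a finite tree in which every bag has
at most `w + 1` vertices. -/
noncomputable def treewidth {V : Type} (G : SimpleGraph V) : ℕ :=
  sInf {w : ℕ | ∃ (ι : Type) (_ : Finite ι) (D : TreeDecomposition G ι),
    ∀ i, (D.bag i).card ≤ w + 1}

/-! ### The problem -/

/-- The cut-set `∂(S)`: the edges with one endpoint in `S` and the other one outside `S`. -/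
def cutSet {V : Type} (G : SimpleGraph V) (S : Set V) : Set (Sym2 V) :=
  {e | e ∈ G.edgeSet ∧ ∃ u v : V, u ∈ S ∧ v ∉ S ∧ e = s(u, v)}

/-- An instance of Largest `st`-Bond: a finite simple graph, two vertices, a positive integer. -/
structure Instance where
  n : ℕ
  graph : SimpleGraph (Fin n)
  source : Fin n
  target : Fin n
  k : ℕ
  k_pos : 0 < k

/-- The question: is there `S` with `s ∈ S` and `t ∉ S` such that `G[S]` and `G[V ∖ S]` are
connected and `|∂(S)| ≥ k`? -/
def Instance.IsYes (I : Instance) : Prop :=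
  ∃ S : Set (Fin I.n), I.source ∈ S ∧ I.target ∉ S ∧
    (I.graph.induce S).Connected ∧ (I.graph.induce Sᶜ).Connected ∧
    I.k ≤ (cutSet I.graph S).ncard

/-- The number `m` in unary, with an end mark. -/
def unary (m : ℕ) : List Bool := List.replicate m true ++ [false]

open Classical in
/-- An instance as a bit string: the number of vertices, the adjacency matrix row by row, the two
vertices, and finally the binary digits of `k`, least significant digit first. -/
noncomputable def Instance.encode (I : Instance) : List Bool :=
  unary I.n ++
    (List.finRange I.n).flatMap
      (fun i => (List.finRange I.n).map (fun j => decide (I.graph.Adj i j))) ++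
    unary I.source ++ unary I.target ++ Nat.bits I.k

end StBond

/-! The algorithm tries the parameters `k = 0, 1, 2, ...`. For each it looks for an elimination
order whose width is linear in `k`; if it finds one, it solves the problem by dynamic programming
along that order, otherwise it passes to `k + 1`. The search cannot fail when `k` is the treewidth,
so the treewidth need not be known, and an order found for a smaller `k` carries the same
guarantees.

Running time. The exponential dependence on `k` is moved into a number `pad`, kept in unary as part
of the data. Lists of subsets stop growing once they would exceed `pad`, so every routine is
polynomial in the size of the input, `k` and `pad` together. The class `PolyF` of polynomial-time
functions is closed under composition, case distinction and folds with controlled growth, so that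
`fun_prop` can verify most of the routines from their definitions. The outer loop is counted
separately in `exists_while_prog`: it makes at most as many rounds as the treewidth, on states whose
size is linear in the input, `k` and `pad`.

Order. A list `P` is grown from `[s, t]` so that every component outside `P` has at most `4k + 6`
neighbours in `P`. A component `C` with boundary `W` below the bound admits one more vertex. If the
bound is attained, a set `S` of at most `k + 1` vertices is sought that separates two subsets of `W`
of size at least `k + 2`, and `S ∩ C` is added. What remains of `C` cannot see both large subsets
outside `S`, so no boundary grows (`card_touch_le`). Separators are found by unit flows
(`sep_sound`, `sep_complete`) and exist by walking through a tree decomposition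
(`TreeDecomposition.exists_separation`). Elimination then meets at most `5k + 7` neighbours at a
time (`place_spec`).

Dynamic programming. A bond is a two-colouring in which `s` and `t` differ and every vertex reaches
`s` or `t` through its own colour. Each edge is a constraint on its two ends, listing colours,
connections and cut edges. Constraints are joined by taking unions of relations (`feas_joinF`); a
vertex is eliminated by demanding that it is connected to another vertex and by connecting its
neighbours directly (`feas_forgetF`). Arbitrary relations serve in place of partitions, because only
reachability matters. Scopes have at most `5k + 8` vertices, so `2 ^ ((5k + 8) * (5k + 8))`
relations suffice (`solve_spec`). -/

open Relation (ReflTransGen)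

namespace StBond

/-! ### Polynomial-time functions on encoded data -/

/-- Number of nodes of a value. -/
def Val.size : Val → ℕ
  | .nil => 1
  | .cons a b => a.size + b.size + 1

theorem Val.size_pos (v : Val) : 0 < v.size := by
  cases v <;> simp [Val.size]

/-- Data types with an encoding by values. -/
class Enc (α : Type) where
  enc : α → Val

open Enc (enc)

/-- Size of the encoding. -/
def sz {α : Type} [Enc α] (a : α) : ℕ := (enc a).size

/-- Unary encoding of numbers. -/
def encNat : ℕ → Val
  | 0 => .nil
  | n + 1 => .cons .nil (encNat n)

/-- Encoding of lists as linked lists. -/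
def encList {α : Type} [Enc α] : List α → Val
  | [] => .nil
  | a :: l => .cons (enc a) (encList l)

instance : Enc Bool := ⟨Val.ofBit⟩
instance : Enc Unit := ⟨fun _ => .nil⟩
instance : Enc ℕ := ⟨encNat⟩
instance {α β : Type} [Enc α] [Enc β] : Enc (α × β) := ⟨fun p => .cons (enc p.1) (enc p.2)⟩
instance {α : Type} [Enc α] : Enc (List α) := ⟨encList⟩

variable {α β γ δ : Type} [Enc α] [Enc β] [Enc γ] [Enc δ]

theorem enc_mk (a : α) (b : β) : enc (a, b) = .cons (enc a) (enc b) := rfl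
theorem enc_cons (a : α) (l : List α) : enc (a :: l) = .cons (enc a) (enc l) := rfl

/-- A unary number and a list of units are the same value, so converting between them needs no
program, and iteration over a number becomes a fold over a list. -/
theorem enc_replicate (n : ℕ) : enc (List.replicate n ()) = enc n := by
  induction n with
  | zero => rfl
  | succ n ih => rw [List.replicate_succ, enc_cons, ih]; rfl

theorem enc_ofBits (w : List Bool) : enc w = Val.ofBits w := by
  induction w with
  | nil => rfl
  | cons b w ih => rw [enc_cons, ih]; rfl

theorem sz_pos (a : α) : 0 < sz a := Val.size_pos _

@[simp] theorem sz_mk (a : α) (b : β) : sz (a, b) = sz a + sz b + 1 := rfl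

theorem sz_prod (p : α × β) : sz p = sz p.1 + sz p.2 + 1 := rfl

@[simp] theorem sz_nil : sz ([] : List α) = 1 := rfl
@[simp] theorem sz_cons (a : α) (l : List α) : sz (a :: l) = sz a + sz l + 1 := rfl

@[simp] theorem sz_nat (n : ℕ) : sz n = 2 * n + 1 := by
  induction n with
  | zero => rfl
  | succ n ih =>
    have h : sz (n + 1) = 1 + sz n + 1 := rfl
    rw [h, ih]; ring

theorem sz_bool_le (b : Bool) : sz b ≤ 3 := by cases b <;> decide

theorem sz_append (l₁ l₂ : List α) : sz (l₁ ++ l₂) + 1 = sz l₁ + sz l₂ := by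
  induction l₁ with
  | nil => simp; omega
  | cons a l ih => simp only [List.cons_append, sz_cons]; omega

theorem sz_reverse (l : List α) : sz l.reverse = sz l := by
  induction l with
  | nil => rfl
  | cons a l ih =>
    have := sz_append l.reverse [a]
    rw [List.reverse_cons, sz_cons]; simp only [sz_cons, sz_nil] at this; omega

theorem length_lt_sz (l : List α) : l.length < sz l := by
  induction l with
  | nil => simp
  | cons a l ih => simp only [List.length_cons, sz_cons]; omega

theorem sz_le_of_mem {a : α} {l : List α} (h : a ∈ l) : sz a < sz l := by
  induction l with
  | nil => simp at h
  | cons b l ih =>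
    simp only [sz_cons]
    rcases List.mem_cons.1 h with rfl | h
    · omega
    · have := ih h; omega

theorem sz_le_length_mul {l : List α} {b : ℕ} (h : ∀ a ∈ l, sz a ≤ b) :
    sz l ≤ l.length * (b + 1) + 1 := by
  induction l with
  | nil => simp
  | cons a l ih =>
    have h1 := ih (fun x hx => h x (List.mem_cons_of_mem _ hx))
    have h2 := h a List.mem_cons_self
    simp only [sz_cons, List.length_cons, Nat.succ_mul]; omega

theorem sz_le_of_sublist {l₁ l₂ : List α} (h : l₁.Sublist l₂) : sz l₁ ≤ sz l₂ := by
  induction h with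
  | slnil => exact le_rfl
  | cons a _ ih => simp only [sz_cons]; omega
  | cons_cons a _ ih => simp only [sz_cons]; omega

/-! ### Polynomial bounds -/

/-- `h` is bounded by a polynomial in the size of its argument. -/
def PB (h : α → ℕ) : Prop := ∃ c, ∀ a, h a ≤ (sz a + 1) ^ c

namespace PB

theorem mono {g h : α → ℕ} (hh : PB h) (hgh : ∀ a, g a ≤ h a) : PB g := by
  obtain ⟨c, hc⟩ := hh
  exact ⟨c, fun a => (hgh a).trans (hc a)⟩

theorem const (k : ℕ) : PB (fun _ : α => k) := by
  refine ⟨k, fun a => ?_⟩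
  have := sz_pos a
  exact (Nat.lt_two_pow_self).le.trans (Nat.pow_le_pow_left (by omega) k)

theorem size : PB (fun a : α => sz a) := ⟨1, fun a => by simp⟩

theorem add {g h : α → ℕ} (hg : PB g) (hh : PB h) : PB (fun a => g a + h a) := by
  obtain ⟨c, hc⟩ := hg
  obtain ⟨d, hd⟩ := hh
  refine ⟨max c d + 1, fun a => ?_⟩
  have h0 := sz_pos a
  have h1 := (hc a).trans (Nat.pow_le_pow_right (by omega) (le_max_left c d))
  have h2 := (hd a).trans (Nat.pow_le_pow_right (by omega) (le_max_right c d))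
  rw [pow_succ]
  nlinarith [Nat.zero_le ((sz a + 1) ^ max c d)]

theorem mul {g h : α → ℕ} (hg : PB g) (hh : PB h) : PB (fun a => g a * h a) := by
  obtain ⟨c, hc⟩ := hg
  obtain ⟨d, hd⟩ := hh
  refine ⟨c + d, fun a => ?_⟩
  rw [pow_add]
  exact Nat.mul_le_mul (hc a) (hd a)

theorem pow {h : α → ℕ} (hh : PB h) (c : ℕ) : PB (fun a => h a ^ c) := by
  induction c with
  | zero => exact (const 1).mono fun _ => by simp
  | succ c ih => exact (ih.mul hh).mono fun _ => (pow_succ _ _).le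

theorem comp {f : α → β} {q : β → ℕ} (hq : PB q) (hf : PB (fun a => sz (f a))) :
    PB (fun a => q (f a)) := by
  obtain ⟨c, hc⟩ := hq
  obtain ⟨d, hd⟩ := hf
  refine ⟨(d + 1) * c, fun a => (hc _).trans ?_⟩
  rw [pow_mul]
  apply Nat.pow_le_pow_left
  have h0 := sz_pos a
  have h1 := hd a
  have h2 : 1 ≤ (sz a + 1) ^ d := Nat.one_le_pow _ _ (by omega)
  rw [pow_succ]
  nlinarith

end PB

/-! ### Programs with upper bounds on the number of steps -/

/-- The program `p` halts in the store `τ` after at most `T` steps. -/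
def Reaches (p : Prog) (σ : Store) (T : ℕ) (τ : Store) : Prop := ∃ U, U ≤ T ∧ Exec p σ U τ

namespace Reaches

theorem mono {p : Prog} {σ τ : Store} {T T' : ℕ} (h : Reaches p σ T τ) (hT : T ≤ T') :
    Reaches p σ T' τ := by
  obtain ⟨U, hU, hE⟩ := h
  exact ⟨U, hU.trans hT, hE⟩

theorem setNil (x : ℕ) (σ : Store) : Reaches (.setNil x) σ 1 (Function.update σ x .nil) :=
  ⟨1, le_rfl, .setNil x σ⟩

theorem copy (x y : ℕ) (σ : Store) : Reaches (.copy x y) σ 1 (Function.update σ x (σ y)) :=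
  ⟨1, le_rfl, .copy x y σ⟩

theorem cons (x y z : ℕ) (σ : Store) :
    Reaches (.cons x y z) σ 1 (Function.update σ x (.cons (σ y) (σ z))) :=
  ⟨1, le_rfl, .cons x y z σ⟩

theorem hd (x y : ℕ) (σ : Store) : Reaches (.hd x y) σ 1 (Function.update σ x (σ y).hd) :=
  ⟨1, le_rfl, .hd x y σ⟩

theorem tl (x y : ℕ) (σ : Store) : Reaches (.tl x y) σ 1 (Function.update σ x (σ y).tl) :=
  ⟨1, le_rfl, .tl x y σ⟩

theorem seq {p q : Prog} {σ τ ρ : Store} {T U : ℕ} (hp : Reaches p σ T τ) (hq : Reaches q τ U ρ) :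
    Reaches (.seq p q) σ (T + U) ρ := by
  obtain ⟨T', hT, hp⟩ := hp
  obtain ⟨U', hU, hq⟩ := hq
  exact ⟨T' + U', by omega, .seq hp hq⟩

theorem iteTrue {x : ℕ} {p q : Prog} {σ τ : Store} {T : ℕ} (hx : σ x ≠ .nil)
    (hp : Reaches p σ T τ) : Reaches (.ite x p q) σ (T + 1) τ := by
  obtain ⟨T', hT, hp⟩ := hp
  exact ⟨T' + 1, by omega, .iteTrue hx hp⟩

theorem iteFalse {x : ℕ} {p q : Prog} {σ τ : Store} {T : ℕ} (hx : σ x = .nil)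
    (hp : Reaches q σ T τ) : Reaches (.ite x p q) σ (T + 1) τ := by
  obtain ⟨T', hT, hp⟩ := hp
  exact ⟨T' + 1, by omega, .iteFalse hx hp⟩

theorem loopStep {x : ℕ} {p : Prog} {σ τ ρ : Store} {T U : ℕ} (hx : σ x ≠ .nil)
    (hp : Reaches p σ T τ) (hq : Reaches (.loop x p) τ U ρ) :
    Reaches (.loop x p) σ (T + U + 1) ρ := by
  obtain ⟨T', hT, hp⟩ := hp
  obtain ⟨U', hU, hq⟩ := hq
  exact ⟨T' + U' + 1, by omega, .loopStep hx hp hq⟩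

theorem loopDone {x : ℕ} {p : Prog} {σ : Store} (hx : σ x = .nil) :
    Reaches (.loop x p) σ 1 σ := ⟨1, le_rfl, .loopDone hx⟩

end Reaches

/-- The program `p` replaces the content `enc a` of variable `0` by `enc (f a)`, in at most `T a`
steps, and changes no variable from `m` on. -/
def Computes (p : Prog) (m : ℕ) (f : α → β) (T : α → ℕ) : Prop :=
  ∀ a σ, σ 0 = enc a → ∃ τ, Reaches p σ (T a) τ ∧ τ 0 = enc (f a) ∧ ∀ x, m ≤ x → τ x = σ x

/-- Polynomial-time computable functions with values of polynomial size. -/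
@[fun_prop]
def PolyF (f : α → β) : Prop :=
  PB (fun a => sz (f a)) ∧ ∃ p m T, 0 < m ∧ PB T ∧ Computes p m f T

namespace PolyF

/-- Programs see only encodings, so functions with equal encoded values share a program. This gives
list constructors, successors and lengths from pairs and lists already treated. -/
theorem of_enc_eq {f : α → β} (g : α → γ) (hf : PolyF f) (h : ∀ a, enc (g a) = enc (f a)) :
    PolyF g := by
  obtain ⟨hs, p, m, T, hm, hT, hp⟩ := hf
  refine ⟨hs.mono fun a => by simp only [sz, h]; exact le_rfl, p, m, T, hm, hT, ?_⟩
  intro a σ hσ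
  rw [h]; exact hp a σ hσ

@[fun_prop]
theorem id : PolyF (fun a : α => a) := by
  refine ⟨PB.size, .copy 0 0, 1, fun _ => 1, one_pos, PB.const 1, ?_⟩
  intro a σ hσ
  refine ⟨_, Reaches.copy _ _ _, by simpa using hσ, ?_⟩
  intro x hx
  simp

theorem comp' {g : β → γ} {f : α → β} (hg : PolyF g) (hf : PolyF f) :
    PolyF (fun a => g (f a)) := by
  obtain ⟨hs, p, m, T, hm, hT, hp⟩ := hf
  obtain ⟨hs', p', m', T', hm', hT', hp'⟩ := hg
  refine ⟨PB.comp (q := fun b => sz (g b)) hs' hs, .seq p p', max m m', fun a => T a + T' (f a),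
    by omega, hT.add (hT'.comp hs), ?_⟩
  intro a σ hσ
  obtain ⟨τ, h1, h2, h3⟩ := hp a σ hσ
  obtain ⟨ρ, h4, h5, h6⟩ := hp' _ τ h2
  refine ⟨ρ, h1.seq h4, h5, fun x hx => ?_⟩
  rw [h6 x (by omega), h3 x (by omega)]

@[fun_prop]
theorem comp {g : β → γ} {f : α → β} (hg : PolyF g) (hf : PolyF f) :
    PolyF (fun a => g (f a)) := hg.comp' hf

theorem exists_const_prog (v : Val) : ∃ (p : Prog) (m T : ℕ), 0 < m ∧ ∀ σ : Store, ∃ τ,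
    Reaches p σ T τ ∧ τ 0 = v ∧ ∀ x, m ≤ x → τ x = σ x := by
  induction v with
  | nil =>
    refine ⟨.setNil 0, 1, 1, one_pos, fun σ => ⟨_, Reaches.setNil _ _, by simp, ?_⟩⟩
    intro x hx
    exact Function.update_of_ne (by omega) _ _
  | cons a b iha ihb =>
    obtain ⟨p, m, T, hm, hp⟩ := iha
    obtain ⟨q, k, U, hk, hq⟩ := ihb
    refine ⟨.seq p (.seq (.copy k 0) (.seq q (.cons 0 k 0))), max m (k + 1), T + (1 + (U + 1)), by omega, ?_⟩
    intro σ
    obtain ⟨τ, h1, h2, h3⟩ := hp σ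
    obtain ⟨ρ, h4, h5, h6⟩ := hq (Function.update τ k (τ 0))
    refine ⟨_, h1.seq ((Reaches.copy _ _ _).seq (h4.seq (Reaches.cons _ _ _ _))), ?_, ?_⟩
    · simp [h6, h5, h2]
    · intro x hx
      rw [Function.update_of_ne (by omega), h6 x (by omega), Function.update_of_ne (by omega),
        h3 x (by omega)]

@[fun_prop]
theorem const (b : β) : PolyF (fun _ : α => b) := by
  obtain ⟨p, m, T, hm, hp⟩ := exists_const_prog (enc b)
  exact ⟨PB.const _, p, m, fun _ => T, hm, PB.const _, fun a σ _ => hp σ⟩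

@[fun_prop]
theorem fst {f : α → β × γ} (hf : PolyF f) : PolyF (fun a => (f a).1) := by
  refine comp' (g := Prod.fst) ⟨PB.size.mono fun a => ?_, .hd 0 0, 1, fun _ => 1, one_pos,
    PB.const 1, ?_⟩ hf
  · simp only [sz_prod]; omega
  · intro a σ hσ
    refine ⟨_, Reaches.hd _ _ _, by simp only [hσ, Function.update_self]; rfl, ?_⟩
    intro x hx
    exact Function.update_of_ne (by omega) _ _

@[fun_prop]
theorem snd {f : α → β × γ} (hf : PolyF f) : PolyF (fun a => (f a).2) := by
  refine comp' (g := Prod.snd) ⟨PB.size.mono fun a => ?_, .tl 0 0, 1, fun _ => 1, one_pos,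
    PB.const 1, ?_⟩ hf
  · simp only [sz_prod]; omega
  · intro a σ hσ
    refine ⟨_, Reaches.tl _ _ _, by simp only [hσ, Function.update_self]; rfl, ?_⟩
    intro x hx
    exact Function.update_of_ne (by omega) _ _

-- Both programs overwrite variable `0` and the variables below their bounds. The argument and the
-- first result are therefore parked in `M` and `M + 1`, which neither program touches; the later
-- constructions use the same device.
@[fun_prop]
theorem mk {f : α → β} {g : α → γ} (hf : PolyF f) (hg : PolyF g) :
    PolyF (fun a => (f a, g a)) := by
  obtain ⟨hs, p, m, T, hm, hT, hp⟩ := hf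
  obtain ⟨hs', p', m', T', hm', hT', hp'⟩ := hg
  set M := max m m' with hM
  refine ⟨((hs.add hs').add (PB.const 1)).mono fun a => le_rfl,
    .seq (.copy M 0) (.seq p (.seq (.copy (M + 1) 0) (.seq (.copy 0 M)
      (.seq p' (.cons 0 (M + 1) 0))))), M + 2,
    fun a => 1 + (T a + (1 + (1 + (T' a + 1)))), by omega,
    (PB.const 1).add (hT.add ((PB.const 1).add ((PB.const 1).add (hT'.add (PB.const 1))))), ?_⟩
  intro a σ hσ
  obtain ⟨τ, h1, h2, h3⟩ := hp a (Function.update σ M (σ 0))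
    (by rw [Function.update_of_ne (by omega), hσ])
  set τ' := Function.update τ (M + 1) (τ 0) with hτ'
  have hM' : τ' M = enc a := by
    rw [hτ', Function.update_of_ne (by omega), h3 M (by omega), Function.update_self, hσ]
  obtain ⟨ρ, h4, h5, h6⟩ := hp' a (Function.update τ' 0 (τ' M)) (by simp [hM'])
  refine ⟨_, (Reaches.copy _ _ _).seq (h1.seq ((Reaches.copy _ _ _).seq ((Reaches.copy _ _ _).seq
    (h4.seq (Reaches.cons _ _ _ _))))), ?_, ?_⟩
  · simp only [Function.update_self, h5, enc_mk]
    rw [h6 (M + 1) (by omega), Function.update_of_ne (by omega), hτ', Function.update_self, h2]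
  · intro x hx
    rw [Function.update_of_ne (by omega), h6 x (by omega), Function.update_of_ne (by omega), hτ',
      Function.update_of_ne (by omega), h3 x (by omega), Function.update_of_ne (by omega)]

@[fun_prop]
theorem list_cons {f : α → β} {g : α → List β} (hf : PolyF f) (hg : PolyF g) :
    PolyF (fun a => f a :: g a) :=
  of_enc_eq _ (hf.mk hg) fun _ => rfl

@[fun_prop]
theorem cond {c : α → Bool} {f g : α → β} (hc : PolyF c) (hf : PolyF f) (hg : PolyF g) :
    PolyF (fun a => cond (c a) (f a) (g a)) := by
  obtain ⟨hs, p, m, T, hm, hT, hp⟩ := hf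
  obtain ⟨hs', p', m', T', hm', hT', hp'⟩ := hg
  obtain ⟨-, p₀, m₀, T₀, hm₀, hT₀, hp₀⟩ := hc
  set M := max m₀ (max m m') with hM
  refine ⟨(hs.add hs').mono fun a => by dsimp only; cases c a <;> simp,
    .seq (.copy M 0) (.seq p₀ (.seq (.copy (M + 1) 0) (.seq (.copy 0 M) (.ite (M + 1) p p')))),
    M + 2, fun a => 1 + (T₀ a + (1 + (1 + (T a + T' a + 1)))), by omega,
    (PB.const 1).add (hT₀.add ((PB.const 1).add ((PB.const 1).add
      ((hT.add hT').add (PB.const 1))))), ?_⟩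
  intro a σ hσ
  obtain ⟨τ, h1, h2, h3⟩ := hp₀ a (Function.update σ M (σ 0))
    (by rw [Function.update_of_ne (by omega), hσ])
  set τ' := Function.update τ (M + 1) (τ 0) with hτ'
  have hM' : τ' M = enc a := by
    rw [hτ', Function.update_of_ne (by omega), h3 M (by omega), Function.update_self, hσ]
  have hfr : ∀ x, M + 2 ≤ x → Function.update τ' 0 (τ' M) x = σ x := by
    intro x hx
    rw [Function.update_of_ne (by omega), hτ', Function.update_of_ne (by omega), h3 x (by omega),
      Function.update_of_ne (by omega)]
  have hb : Function.update τ' 0 (τ' M) (M + 1) = enc (c a) := by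
    rw [Function.update_of_ne (by omega), hτ', Function.update_self, h2]
  cases hca : c a with
  | true =>
    obtain ⟨ρ, h4, h5, h6⟩ := hp a (Function.update τ' 0 (τ' M)) (by simp [hM'])
    refine ⟨ρ, (Reaches.copy _ _ _).seq (h1.seq ((Reaches.copy _ _ _).seq ((Reaches.copy _ _ _).seq
      ((h4.iteTrue ?_).mono ?_)))), by simp only [hca]; exact h5, fun x hx => ?_⟩
    · rw [hb, hca]; intro h; exact Val.noConfusion h
    · omega
    · rw [h6 x (by omega), hfr x hx]
  | false =>
    obtain ⟨ρ, h4, h5, h6⟩ := hp' a (Function.update τ' 0 (τ' M)) (by simp [hM'])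
    refine ⟨ρ, (Reaches.copy _ _ _).seq (h1.seq ((Reaches.copy _ _ _).seq ((Reaches.copy _ _ _).seq
      ((h4.iteFalse ?_).mono ?_)))), by simp only [hca]; exact h5, fun x hx => ?_⟩
    · rw [hb, hca]; rfl
    · omega
    · rw [h6 x (by omega), hfr x hx]

/-- Folding over a list, provided that the intermediate results are small. -/
theorem foldl_of_prefix {s : α → γ → β → γ} {i : α → γ} {l : α → List β}
    (hs : PolyF (fun p : α × γ × β => s p.1 p.2.1 p.2.2)) (hi : PolyF i) (hl : PolyF l)
    (q : α → ℕ) (hq : PB q)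
    (hb : ∀ a l', l' <+: l a → sz (l'.foldl (s a) (i a)) ≤ q a) :
    PolyF (fun a => (l a).foldl (s a) (i a)) := by
  obtain ⟨-, p, m, T, hm, ⟨c, hc⟩, hp⟩ := hs
  obtain ⟨-, p₁, m₁, T₁, hm₁, hT₁, hp₁⟩ := hi
  obtain ⟨hls, p₂, m₂, T₂, hm₂, hT₂, hp₂⟩ := hl
  set M := max m (max m₁ m₂) with hM
  -- Variable `M` holds the argument, `M + 1` the rest of the list and `M + 2` the accumulator; the
  -- first three instructions assemble the triple for `p` in variable `0`.
  let body : Prog := .seq (.hd 0 (M + 1)) (.seq (.cons 0 (M + 2) 0) (.seq (.cons 0 M 0)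
    (.seq p (.seq (.copy (M + 2) 0) (.tl (M + 1) (M + 1))))))
  -- In each round `p` runs on a triple of `a`, an accumulator of size at most `q a` and an element
  -- of `l a`; the `6` covers the five other instructions.
  let B : α → ℕ := fun a => (sz a + (q a + sz (l a) + 1) + 1 + 1) ^ c + 6
  have hB : PB B := ((((PB.size.add ((hq.add hls).add (PB.const 1))).add (PB.const 1)).add
    (PB.const 1)).pow c).add (PB.const 6)
  -- The loop invariant: `l₁` has been folded and `l₂` is left. Since `l₁` is a prefix of `l a`, the
  -- accumulator is bounded by hypothesis.
  have key : ∀ a (l₁ l₂ : List β), l₁ ++ l₂ = l a → ∀ σ : Store, σ M = enc a →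
      σ (M + 1) = enc l₂ → σ (M + 2) = enc (l₁.foldl (s a) (i a)) →
      ∃ τ, Reaches (.loop (M + 1) body) σ (l₂.length * (B a + 1) + 1) τ ∧
        τ (M + 2) = enc ((l a).foldl (s a) (i a)) ∧ ∀ x, M + 3 ≤ x → τ x = σ x := by
    intro a l₁ l₂
    induction l₂ generalizing l₁ with
    | nil =>
      intro hl σ _ h1 h2
      rw [List.append_nil] at hl
      refine ⟨σ, (Reaches.loopDone h1).mono (by omega), by rw [h2, hl], fun _ _ => rfl⟩
    | cons b l₂ ih =>
      intro hl σ h0 h1 h2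
      let σ₁ := Function.update σ 0 (σ (M + 1)).hd
      let σ₂ := Function.update σ₁ 0 (.cons (σ₁ (M + 2)) (σ₁ 0))
      let σ₃ := Function.update σ₂ 0 (.cons (σ₂ M) (σ₂ 0))
      have h3 : σ₃ 0 = enc (a, l₁.foldl (s a) (i a), b) := by
        simp only [σ₃, σ₂, σ₁, Function.update_self]
        rw [Function.update_of_ne (by omega), Function.update_of_ne (by omega),
          Function.update_of_ne (by omega), h0, h1, h2]
        rfl
      obtain ⟨τ, h4, h5, h6⟩ := hp _ σ₃ h3
      have hfr : ∀ x, M ≤ x → σ₃ x = σ x := by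
        intro x hx
        simp only [σ₃, σ₂, σ₁]
        rw [Function.update_of_ne (by omega), Function.update_of_ne (by omega),
          Function.update_of_ne (by omega)]
      let τ₁ := Function.update τ (M + 2) (τ 0)
      let τ₂ := Function.update τ₁ (M + 1) (τ₁ (M + 1)).tl
      have hbody : Reaches body σ (B a) τ₂ := by
        refine Reaches.mono ((Reaches.hd _ _ _).seq ((Reaches.cons _ _ _ _).seq
          ((Reaches.cons _ _ _ _).seq (h4.seq ((Reaches.copy _ _ _).seq (Reaches.tl _ _ _)))))) ?_
        have h7 := hc (a, l₁.foldl (s a) (i a), b)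
        have h8 : (sz (a, l₁.foldl (s a) (i a), b) + 1) ^ c
            ≤ (sz a + (q a + sz (l a) + 1) + 1 + 1) ^ c := by
          apply Nat.pow_le_pow_left
          have h9 := hb a l₁ ⟨_, hl⟩
          have h10 : sz b < sz (l a) := sz_le_of_mem (by rw [← hl]; simp)
          simp only [sz_mk]; omega
        simp only [B]; omega
      obtain ⟨ρ, h7, h8, h9⟩ := ih (l₁ ++ [b]) (by rw [← hl]; simp) τ₂
        (by
          simp only [τ₂, τ₁]
          rw [Function.update_of_ne (by omega), Function.update_of_ne (by omega), h6 M (by omega),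
            hfr M le_rfl, h0])
        (by
          simp only [τ₂, τ₁]
          rw [Function.update_self, Function.update_of_ne (by omega), h6 _ (by omega),
            hfr _ (by omega), h1]
          rfl)
        (by
          simp only [τ₂, τ₁]
          rw [Function.update_of_ne (by omega), Function.update_self, h5]
          simp)
      refine ⟨ρ, (Reaches.loopStep ?_ hbody h7).mono ?_, h8, fun x hx => ?_⟩
      · rw [h1]; intro h; exact Val.noConfusion h
      · simp only [List.length_cons, Nat.succ_mul]; omega
      · rw [h9 x hx]
        simp only [τ₂, τ₁]
        rw [Function.update_of_ne (by omega), Function.update_of_ne (by omega), h6 x (by omega),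
          hfr x (by omega)]
  refine ⟨hq.mono fun a => hb a (l a) (List.prefix_refl _),
    .seq (.copy M 0) (.seq p₂ (.seq (.copy (M + 1) 0) (.seq (.copy 0 M) (.seq p₁
      (.seq (.copy (M + 2) 0) (.seq (.loop (M + 1) body) (.copy 0 (M + 2)))))))), M + 3,
    fun a => 1 + (T₂ a + (1 + (1 + (T₁ a + (1 + ((sz (l a) * (B a + 1) + 1) + 1)))))), by omega,
    (PB.const 1).add (hT₂.add ((PB.const 1).add ((PB.const 1).add (hT₁.add ((PB.const 1).add
      (((hls.mul (hB.add (PB.const 1))).add (PB.const 1)).add (PB.const 1))))))), ?_⟩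
  intro a σ hσ
  obtain ⟨τ, h1, h2, h3⟩ := hp₂ a (Function.update σ M (σ 0))
    (by rw [Function.update_of_ne (by omega), hσ])
  set τ' := Function.update τ (M + 1) (τ 0) with hτ'
  have hM' : τ' M = enc a := by
    rw [hτ', Function.update_of_ne (by omega), h3 M (by omega), Function.update_self, hσ]
  obtain ⟨ρ, h4, h5, h6⟩ := hp₁ a (Function.update τ' 0 (τ' M)) (by simp [hM'])
  set ρ' := Function.update ρ (M + 2) (ρ 0) with hρ'
  obtain ⟨θ, h7, h8, h9⟩ := key a [] (l a) rfl ρ'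
    (by
      rw [hρ', Function.update_of_ne (by omega), h6 M (by omega), Function.update_of_ne (by omega),
        hM'])
    (by
      rw [hρ', Function.update_of_ne (by omega), h6 _ (by omega), Function.update_of_ne (by omega),
        hτ', Function.update_self, h2])
    (by rw [hρ', Function.update_self, h5]; rfl)
  have hlen : (l a).length * (B a + 1) + 1 ≤ sz (l a) * (B a + 1) + 1 := by
    have := length_lt_sz (l a)
    gcongr
  refine ⟨_, (Reaches.copy _ _ _).seq (h1.seq ((Reaches.copy _ _ _).seq ((Reaches.copy _ _ _).seq
    (h4.seq ((Reaches.copy _ _ _).seq ((h7.mono hlen).seq (Reaches.copy _ _ _))))))), ?_, ?_⟩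
  · rw [Function.update_self, h8]
  · intro x hx
    rw [Function.update_of_ne (by omega), h9 x hx, hρ', Function.update_of_ne (by omega),
      h6 x (by omega), Function.update_of_ne (by omega), hτ', Function.update_of_ne (by omega),
      h3 x (by omega), Function.update_of_ne (by omega)]

/-- Folding over a list, provided that every step adds a small amount to the state. -/
theorem foldl_of_growth {s : α → γ → β → γ} {i : α → γ} {l : α → List β}
    (hs : PolyF (fun p : α × γ × β => s p.1 p.2.1 p.2.2)) (hi : PolyF i) (hl : PolyF l)
    (q : α → ℕ) (hq : PB q)
    (hb : ∀ a, ∀ b ∈ l a, ∀ c, sz (s a c b) ≤ sz c + q a) :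
    PolyF (fun a => (l a).foldl (s a) (i a)) := by
  refine foldl_of_prefix hs hi hl (fun a => sz (i a) + sz (l a) * q a)
    (hi.1.add (hl.1.mul hq)) ?_
  intro a l' hl'
  have key : ∀ (l'' : List β) c, (∀ b ∈ l'', b ∈ l a) →
      sz (l''.foldl (s a) c) ≤ sz c + l''.length * q a := by
    intro l''
    induction l'' with
    | nil => intro c _; simp
    | cons b l'' ih =>
      intro c h
      have h1 := ih (s a c b) fun x hx => h x (List.mem_cons_of_mem _ hx)
      have h2 := hb a b (h b List.mem_cons_self) c
      simp only [List.foldl_cons, List.length_cons, Nat.succ_mul]; omega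
  have h1 := key l' (i a) fun b hb => hl'.subset hb
  have h2 : l'.length ≤ sz (l a) := hl'.length_le.trans (length_lt_sz _).le
  have h3 := Nat.mul_le_mul_right (q a) h2
  omega

theorem pb_comp {f : α → β} (hf : PolyF f) {q : β → ℕ} (hq : PB q) : PB (fun a => q (f a)) :=
  PB.comp hq hf.1

/-! ### Booleans -/

@[fun_prop]
theorem and {f g : α → Bool} (hf : PolyF f) (hg : PolyF g) : PolyF (fun a => f a && g a) := by
  have h : (fun a => f a && g a) = fun a => bif f a then g a else false := by
    funext a; cases f a <;> rfl
  rw [h]; fun_prop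

@[fun_prop]
theorem or {f g : α → Bool} (hf : PolyF f) (hg : PolyF g) : PolyF (fun a => f a || g a) := by
  have h : (fun a => f a || g a) = fun a => bif f a then true else g a := by
    funext a; cases f a <;> rfl
  rw [h]; fun_prop

@[fun_prop]
theorem not {f : α → Bool} (hf : PolyF f) : PolyF (fun a => !f a) := by
  have h : (fun a => !f a) = fun a => bif f a then false else true := by
    funext a; cases f a <;> rfl
  rw [h]; fun_prop

/-! ### Lists -/

@[fun_prop]
theorem reverse {f : α → List β} (hf : PolyF f) : PolyF (fun a => (f a).reverse) := by
  have h : (fun a => (f a).reverse) = fun a => (f a).foldl (fun l b => b :: l) [] := by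
    funext a; rw [List.foldl_flip_cons_eq_append]; simp
  rw [h]
  refine foldl_of_growth (s := fun _ l b => b :: l) (by fun_prop) (by fun_prop) hf
    (fun a => sz (f a)) hf.1 ?_
  intro a b hb c
  have := sz_le_of_mem hb
  simp only [sz_cons]; omega

@[fun_prop]
theorem append {f g : α → List β} (hf : PolyF f) (hg : PolyF g) :
    PolyF (fun a => f a ++ g a) := by
  have h : (fun a => f a ++ g a) = fun a => (f a).reverse.foldl (fun l b => b :: l) (g a) := by
    funext a; rw [List.foldl_flip_cons_eq_append]; simp
  rw [h]
  refine foldl_of_growth (s := fun _ l b => b :: l) (by fun_prop) (by fun_prop) (by fun_prop)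
    (fun a => sz (f a)) hf.1 ?_
  intro a b hb c
  have := sz_le_of_mem (List.mem_reverse.1 hb)
  simp only [sz_cons]; omega

@[fun_prop]
theorem list_map {g : α → β → γ} {l : α → List β} (hg : PolyF (fun p : α × β => g p.1 p.2))
    (hl : PolyF l) : PolyF (fun a => (l a).map (g a)) := by
  have h : (fun a => (l a).map (g a))
      = fun a => ((l a).foldl (fun acc b => g a b :: acc) []).reverse := by
    funext a
    have : ∀ (l : List β) (acc : List γ),
        l.foldl (fun acc b => g a b :: acc) acc = (l.map (g a)).reverse ++ acc := by
      intro l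
      induction l with
      | nil => intro acc; simp
      | cons b l ih => intro acc; simp [ih]
    rw [this]; simp
  rw [h]
  obtain ⟨c, hc⟩ := hg.1
  refine reverse (foldl_of_growth (s := fun a acc b => g a b :: acc) (by fun_prop) (by fun_prop) hl
    (fun a => (sz a + sz (l a) + 1 + 1) ^ c + 1)
    ((((PB.size.add hl.1).add (PB.const 1)).add (PB.const 1)).pow c |>.add (PB.const 1)) ?_)
  intro a b hb acc
  have h1 := sz_le_of_mem hb
  have h2 := hc (a, b)
  have h3 : (sz (a, b) + 1) ^ c ≤ (sz a + sz (l a) + 1 + 1) ^ c :=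
    Nat.pow_le_pow_left (by simp only [sz_mk]; omega) c
  simp only [sz_cons] at *; omega

@[fun_prop]
theorem flatten {l : α → List (List β)} (hl : PolyF l) : PolyF (fun a => (l a).flatten) := by
  have h : (fun a => (l a).flatten) = fun a => (l a).foldl (fun acc b => acc ++ b) [] := by
    funext a
    have : ∀ (l : List (List β)) acc, l.foldl (fun acc b => acc ++ b) acc = acc ++ l.flatten := by
      intro l
      induction l with
      | nil => intro acc; simp
      | cons b l ih => intro acc; simp [ih]
    rw [this]; simp
  rw [h]
  refine foldl_of_growth (s := fun _ acc b => acc ++ b) (by fun_prop) (by fun_prop) hl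
    (fun a => sz (l a)) hl.1 ?_
  intro a b hb acc
  have h1 := sz_le_of_mem hb
  have h2 := sz_append acc b
  omega

@[fun_prop]
theorem flatMap {g : α → β → List γ} {l : α → List β} (hg : PolyF (fun p : α × β => g p.1 p.2))
    (hl : PolyF l) : PolyF (fun a => (l a).flatMap (g a)) := by
  have h : (fun a => (l a).flatMap (g a)) = fun a => ((l a).map (g a)).flatten := by
    funext a; rw [List.flatMap_def]
  rw [h]; fun_prop

@[fun_prop]
theorem filter {g : α → β → Bool} {l : α → List β} (hg : PolyF (fun p : α × β => g p.1 p.2))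
    (hl : PolyF l) : PolyF (fun a => (l a).filter (g a)) := by
  have h : (fun a => (l a).filter (g a))
      = fun a => (l a).flatMap (fun b => bif g a b then [b] else []) := by
    funext a
    induction l a with
    | nil => rfl
    | cons b l ih =>
      rw [List.flatMap_cons, ← ih, List.filter_cons]
      cases g a b <;> simp
  rw [h]; fun_prop

@[fun_prop]
theorem any {g : α → β → Bool} {l : α → List β} (hg : PolyF (fun p : α × β => g p.1 p.2))
    (hl : PolyF l) : PolyF (fun a => (l a).any (g a)) := by
  have h : (fun a => (l a).any (g a)) = fun a => (l a).foldl (fun acc b => acc || g a b) false := by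
    funext a
    have : ∀ (l : List β) acc, l.foldl (fun acc b => acc || g a b) acc = (acc || l.any (g a)) := by
      intro l
      induction l with
      | nil => intro acc; simp
      | cons b l ih => intro acc; simp [ih, Bool.or_assoc]
    rw [this]; simp
  rw [h]
  refine foldl_of_growth (s := fun a acc b => acc || g a b) (by fun_prop) (by fun_prop) hl
    (fun _ => 3) (PB.const 3) ?_
  intro a b _ acc
  have := sz_bool_le (acc || g a b)
  omega

@[fun_prop]
theorem all {g : α → β → Bool} {l : α → List β} (hg : PolyF (fun p : α × β => g p.1 p.2))
    (hl : PolyF l) : PolyF (fun a => (l a).all (g a)) := by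
  have h : (fun a => (l a).all (g a)) = fun a => !(l a).any (fun b => !g a b) := by
    funext a; rw [List.all_eq_not_any_not]
  rw [h]; fun_prop

@[fun_prop]
theorem isEmpty {l : α → List β} (hl : PolyF l) : PolyF (fun a => (l a).isEmpty) := by
  have h : (fun a => (l a).isEmpty) = fun a => !(l a).any (fun _ => true) := by
    funext a; cases l a <;> simp
  rw [h]; fun_prop

@[fun_prop]
theorem headD {l : α → List β} {d : α → β} (hl : PolyF l) (hd : PolyF d) :
    PolyF (fun a => (l a).headD (d a)) := by
  have h : (fun a => (l a).headD (d a)) = fun a => (l a).reverse.foldl (fun _ b => b) (d a) := by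
    funext a
    cases l a <;> simp
  rw [h]
  refine foldl_of_growth (s := fun _ _ b => b) (by fun_prop) hd (by fun_prop)
    (fun a => sz (l a)) hl.1 ?_
  intro a b hb _
  have := sz_le_of_mem (List.mem_reverse.1 hb)
  omega

@[fun_prop]
theorem tail {l : α → List β} (hl : PolyF l) : PolyF (fun a => (l a).tail) := by
  refine comp' (g := List.tail) ⟨PB.size.mono fun a => ?_, .tl 0 0, 1, fun _ => 1, one_pos,
    PB.const 1, ?_⟩ hl
  · exact sz_le_of_sublist (List.tail_sublist _)
  · intro a σ hσ
    refine ⟨_, Reaches.tl _ _ _, ?_, ?_⟩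
    · simp only [hσ, Function.update_self]; cases a <;> rfl
    · intro x hx
      exact Function.update_of_ne (by omega) _ _

/-! ### Numbers -/

@[fun_prop]
theorem replicate_unit {n : α → ℕ} (hn : PolyF n) : PolyF (fun a => List.replicate (n a) ()) :=
  of_enc_eq _ hn fun _ => enc_replicate _

@[fun_prop]
theorem length {l : α → List β} (hl : PolyF l) : PolyF (fun a => (l a).length) := by
  have h : PolyF (fun a => (l a).map (fun _ => ())) := by fun_prop
  refine of_enc_eq _ h fun a => ?_
  rw [List.map_const', enc_replicate]

/-- Iteration, provided that every step adds a small amount to the state. -/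
theorem iterate_of_growth {s : α → γ → γ} {i : α → γ} {n : α → ℕ}
    (hs : PolyF (fun p : α × γ => s p.1 p.2)) (hi : PolyF i) (hn : PolyF n)
    (q : α → ℕ) (hq : PB q) (hb : ∀ a c, sz (s a c) ≤ sz c + q a) :
    PolyF (fun a => (s a)^[n a] (i a)) := by
  have h : (fun a => (s a)^[n a] (i a))
      = fun a => (List.replicate (n a) ()).foldl (fun c _ => s a c) (i a) := by
    funext a
    generalize i a = c
    induction n a generalizing c with
    | zero => rfl
    | succ m ih => simp [List.replicate_succ, ih]
  rw [h]
  exact foldl_of_growth (s := fun a c _ => s a c) (by fun_prop) hi (by fun_prop) q hq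
    (fun a _ _ c => hb a c)

@[fun_prop]
theorem succ {n : α → ℕ} (hn : PolyF n) : PolyF (fun a => n a + 1) :=
  of_enc_eq _ ((const ()).mk hn) fun _ => rfl

@[fun_prop]
theorem nat_add {m n : α → ℕ} (hm : PolyF m) (hn : PolyF n) : PolyF (fun a => m a + n a) := by
  have h : (fun a => m a + n a) = fun a => (fun k => k + 1)^[n a] (m a) := by
    funext a
    induction n a with
    | zero => rfl
    | succ k ih => rw [Function.iterate_succ_apply', ← ih]; rfl
  rw [h]
  exact iterate_of_growth (s := fun _ k => k + 1) (by fun_prop) hm hn (fun _ => 2) (PB.const 2)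
    fun _ _ => by simp only [sz_nat]; omega

@[fun_prop]
theorem nat_pred {n : α → ℕ} (hn : PolyF n) : PolyF (fun a => n a - 1) := by
  have h : PolyF (fun a => (List.replicate (n a) ()).tail) := by fun_prop
  refine of_enc_eq _ h fun a => ?_
  rw [List.tail_replicate, enc_replicate]

@[fun_prop]
theorem nat_sub {m n : α → ℕ} (hm : PolyF m) (hn : PolyF n) : PolyF (fun a => m a - n a) := by
  have h : (fun a => m a - n a) = fun a => (fun k => k - 1)^[n a] (m a) := by
    funext a
    induction n a with
    | zero => rfl
    | succ k ih => rw [Function.iterate_succ_apply', ← ih]; rfl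
  rw [h]
  exact iterate_of_growth (s := fun _ k => k - 1) (by fun_prop) hm hn (fun _ => 2) (PB.const 2)
    fun _ _ => by simp only [sz_nat]; omega

@[fun_prop]
theorem nat_mul {m n : α → ℕ} (hm : PolyF m) (hn : PolyF n) : PolyF (fun a => m a * n a) := by
  have h : (fun a => m a * n a) = fun a => (fun k => k + m a)^[n a] 0 := by
    funext a
    induction n a with
    | zero => rfl
    | succ k ih => rw [Function.iterate_succ_apply', ← ih]; rfl
  rw [h]
  exact iterate_of_growth (s := fun a k => k + m a) (by fun_prop) (by fun_prop) hn
    (fun a => sz (m a)) hm.1 fun _ _ => by simp only [sz_nat]; omega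

@[fun_prop]
theorem nat_ble {m n : α → ℕ} (hm : PolyF m) (hn : PolyF n) :
    PolyF (fun a => Nat.ble (m a) (n a)) := by
  have h : (fun a => Nat.ble (m a) (n a))
      = fun a => (List.replicate (m a - n a) ()).isEmpty := by
    funext a
    rw [Bool.eq_iff_iff, Nat.ble_eq, List.isEmpty_iff, List.replicate_eq_nil_iff]
    omega
  rw [h]; fun_prop

@[fun_prop]
theorem nat_beq {m n : α → ℕ} (hm : PolyF m) (hn : PolyF n) :
    PolyF (fun a => Nat.beq (m a) (n a)) := by
  have h : (fun a => Nat.beq (m a) (n a))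
      = fun a => Nat.ble (m a) (n a) && Nat.ble (n a) (m a) := by
    funext a
    rw [Bool.eq_iff_iff, Nat.beq_eq, Bool.and_eq_true, Nat.ble_eq, Nat.ble_eq]
    omega
  rw [h]; fun_prop

@[fun_prop]
theorem nat_min {m n : α → ℕ} (hm : PolyF m) (hn : PolyF n) :
    PolyF (fun a => min (m a) (n a)) := by
  have h : (fun a => min (m a) (n a)) = fun a => bif Nat.ble (m a) (n a) then m a else n a := by
    funext a
    cases hb : Nat.ble (m a) (n a) with
    | true => have := Nat.le_of_ble_eq_true hb; simp [this]
    | false =>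
      have : ¬ m a ≤ n a := fun h => by rw [Nat.ble_eq_true_of_le h] at hb; exact absurd hb (by simp)
      simp; omega
  rw [h]; fun_prop

@[fun_prop]
theorem range {n : α → ℕ} (hn : PolyF n) : PolyF (fun a => List.range (n a)) := by
  have h : (fun a => List.range (n a))
      = fun a => ((fun l : List ℕ => l.length :: l)^[n a] []).reverse := by
    funext a
    have : ∀ k, (fun l : List ℕ => l.length :: l)^[k] [] = (List.range k).reverse := by
      intro k
      induction k with
      | zero => rfl
      | succ k ih => rw [Function.iterate_succ_apply', ih, List.range_succ]; simp
    rw [this, List.reverse_reverse]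
  rw [h]
  have key : (fun a => ((fun l : List ℕ => l.length :: l)^[n a] []))
      = fun a => (List.replicate (n a) ()).foldl (fun l _ => l.length :: l) ([] : List ℕ) := by
    funext a
    generalize ([] : List ℕ) = c
    induction n a generalizing c with
    | zero => rfl
    | succ m ih => simp [List.replicate_succ, ih]
  refine reverse ?_
  rw [key]
  -- The amount added in a step depends on the state, so `foldl_of_growth` does not apply; but the
  -- intermediate lists are known explicitly.
  refine foldl_of_prefix (s := fun _ l _ => l.length :: l) (by fun_prop) (by fun_prop)
    (by fun_prop) (fun a => (2 * n a + 2) * n a + 1) ?_ ?_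
  · have h1 : PB n := hn.1.mono fun a => by simp only [sz_nat]; omega
    exact ((((PB.const 2).mul h1).add (PB.const 2)).mul h1).add (PB.const 1)
  · intro a l' hl'
    have h1 : ∀ l' : List Unit, (l'.foldl (fun l _ => l.length :: l) ([] : List ℕ))
        = (List.range l'.length).reverse := by
      intro l'
      induction l' using List.reverseRecOn with
      | nil => rfl
      | append_singleton l b ih =>
        rw [List.foldl_append, ih]; simp [List.range_succ]
    rw [h1, sz_reverse]
    have h2 : l'.length ≤ n a := by simpa using hl'.length_le
    have h3 : sz (List.range l'.length) ≤ l'.length * (2 * n a + 1 + 1) + 1 := by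
      have := sz_le_length_mul (l := List.range l'.length) (b := 2 * n a + 1) fun x hx => by
        have := List.mem_range.1 hx
        simp only [sz_nat]; omega
      simpa using this
    nlinarith

@[fun_prop]
theorem drop {l : α → List β} {n : α → ℕ} (hl : PolyF l) (hn : PolyF n) :
    PolyF (fun a => (l a).drop (n a)) := by
  have h : (fun a => (l a).drop (n a)) = fun a => List.tail^[n a] (l a) := by
    funext a
    induction n a with
    | zero => rfl
    | succ m ih => rw [Function.iterate_succ_apply', ← ih]; simp
  rw [h]
  exact iterate_of_growth (s := fun _ l => l.tail) (by fun_prop) hl hn (fun _ => 0) (PB.const 0)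
    fun _ l => sz_le_of_sublist (List.tail_sublist _)

end PolyF

/-! ### Membership, and lists of sublists -/

/-- Membership of a number in a list. -/
def memN (x : ℕ) (l : List ℕ) : Bool := l.any fun y => Nat.beq x y

/-- Membership of a pair of numbers in a list. -/
def memP (x : ℕ × ℕ) (l : List (ℕ × ℕ)) : Bool :=
  l.any fun y => Nat.beq x.1 y.1 && Nat.beq x.2 y.2

/-- Equality of lists of pairs as sets. -/
def sameSet (l₁ l₂ : List (ℕ × ℕ)) : Bool :=
  (l₁.all fun x => memP x l₂) && l₂.all fun x => memP x l₁

@[simp] theorem memN_iff {x : ℕ} {l : List ℕ} : memN x l = true ↔ x ∈ l := by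
  simp [memN]

@[simp] theorem memP_iff {x : ℕ × ℕ} {l : List (ℕ × ℕ)} : memP x l = true ↔ x ∈ l := by
  obtain ⟨a, b⟩ := x
  simp [memP]

theorem sameSet_iff {l₁ l₂ : List (ℕ × ℕ)} :
    sameSet l₁ l₂ = true ↔ ∀ x, x ∈ l₁ ↔ x ∈ l₂ := by
  simp only [sameSet, Bool.and_eq_true, List.all_eq_true, memP_iff]
  exact ⟨fun h x => ⟨h.1 x, h.2 x⟩, fun h => ⟨fun x => (h x).1, fun x => (h x).2⟩⟩

@[fun_prop]
theorem PolyF.memN {f : α → ℕ} {l : α → List ℕ} (hf : PolyF f) (hl : PolyF l) :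
    PolyF (fun a => memN (f a) (l a)) := by
  unfold StBond.memN; fun_prop

@[fun_prop]
theorem PolyF.memP {f : α → ℕ × ℕ} {l : α → List (ℕ × ℕ)} (hf : PolyF f) (hl : PolyF l) :
    PolyF (fun a => memP (f a) (l a)) := by
  unfold StBond.memP; fun_prop

@[fun_prop]
theorem PolyF.sameSet {f g : α → List (ℕ × ℕ)} (hf : PolyF f) (hg : PolyF g) :
    PolyF (fun a => sameSet (f a) (g a)) := by
  unfold StBond.sameSet; fun_prop

/-- All sublists of `l` (reversed), unless there are more than `pad` of them. -/
def subl {β : Type} (pad : ℕ) (l : List β) : List (List β) :=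
  l.foldl (fun acc b => bif Nat.ble (acc.length + acc.length) pad
    then acc ++ acc.map (fun k => b :: k) else acc) [[]]

theorem subl_append_singleton {β : Type} (pad : ℕ) (l : List β) (b : β) :
    subl pad (l ++ [b]) = bif Nat.ble ((subl pad l).length + (subl pad l).length) pad
      then subl pad l ++ (subl pad l).map (fun k => b :: k) else subl pad l := by
  simp [subl]

theorem length_subl_le {β : Type} (pad : ℕ) (l : List β) : (subl pad l).length ≤ pad + 1 := by
  induction l using List.reverseRecOn with
  | nil => simp [subl]
  | append_singleton l b ih =>
    rw [subl_append_singleton]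
    cases h : Nat.ble ((subl pad l).length + (subl pad l).length) pad with
    | true => have := Nat.le_of_ble_eq_true h; simp; omega
    | false => simpa using ih

theorem sublist_of_mem_subl {β : Type} {pad : ℕ} {l k : List β} (h : k ∈ subl pad l) :
    k.reverse.Sublist l := by
  induction l using List.reverseRecOn generalizing k with
  | nil => simp [subl] at h; subst h; simp
  | append_singleton l b ih =>
    rw [subl_append_singleton] at h
    cases h' : Nat.ble ((subl pad l).length + (subl pad l).length) pad with
    | true =>
      rw [h', cond_true, List.mem_append, List.mem_map] at h
      rcases h with h | ⟨k', hk', rfl⟩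
      · exact (ih h).trans (List.sublist_append_left _ _)
      · rw [List.reverse_cons]; exact (ih hk').append (List.Sublist.refl _)
    | false =>
      rw [h', cond_false] at h
      exact (ih h).trans (List.sublist_append_left _ _)

theorem length_subl {β : Type} {pad : ℕ} {l : List β} (h : 2 ^ l.length ≤ pad) :
    (subl pad l).length = 2 ^ l.length := by
  induction l using List.reverseRecOn with
  | nil => simp [subl]
  | append_singleton l b ih =>
    rw [List.length_append, List.length_singleton, pow_succ] at h
    have ih' := ih (by omega)
    rw [subl_append_singleton, Nat.ble_eq_true_of_le (by omega)]
    simp [ih', pow_succ]; omega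

/-- Under this hypothesis the cut-off never takes effect, so every subset given by a predicate is
listed. The reversal comes from `subl` putting new elements in front. -/
theorem filter_reverse_mem_subl {β : Type} {pad : ℕ} {l : List β} (h : 2 ^ l.length ≤ pad)
    (p : β → Bool) : (l.filter p).reverse ∈ subl pad l := by
  induction l using List.reverseRecOn with
  | nil => simp [subl]
  | append_singleton l b ih =>
    rw [List.length_append, List.length_singleton, pow_succ] at h
    have ih' := ih (by omega)
    rw [subl_append_singleton, Nat.ble_eq_true_of_le (by rw [length_subl (by omega)]; omega), cond_true,
      List.filter_append, List.mem_append, List.mem_map]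
    cases hb : p b with
    | true => right; exact ⟨_, ih', by simp [hb]⟩
    | false => left; simpa [hb] using ih'

@[fun_prop]
theorem PolyF.subl {n : α → ℕ} {l : α → List β} (hn : PolyF n) (hl : PolyF l) :
    PolyF (fun a => subl (n a) (l a)) := by
  unfold StBond.subl
  refine foldl_of_prefix (s := fun a (acc : List (List β)) b => bif Nat.ble (acc.length + acc.length) (n a)
    then acc ++ acc.map (fun k => b :: k) else acc) (by fun_prop) (by fun_prop) hl
    (fun a => (sz (n a) + 1) * (sz (l a) + 1) + 1)
    (((hn.1.add (PB.const 1)).mul (hl.1.add (PB.const 1))).add (PB.const 1)) ?_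
  intro a l' hl'
  have h1 : ∀ k ∈ StBond.subl (n a) l', sz k ≤ sz (l a) := by
    intro k hk
    rw [← sz_reverse k]
    exact sz_le_of_sublist ((sublist_of_mem_subl hk).trans hl'.sublist)
  have h2 := sz_le_length_mul h1
  have h3 := length_subl_le (n a) l'
  have h4 : (StBond.subl (n a) l').length ≤ sz (n a) + 1 := by simp only [sz_nat]; omega
  exact h2.trans (by gcongr)

/-! ### Reachability -/

/-- One step of the search: extend a known path by the arc `e`, if `e` leads to a new vertex. A
known vertex is stored with the arcs of a path to it, last arc first. -/
def reachStep (Ps : List (ℕ × List (ℕ × ℕ))) (e : ℕ × ℕ) : List (ℕ × List (ℕ × ℕ)) :=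
  bif Ps.any (fun q => Nat.beq q.1 e.2) || (Ps.filter fun q => Nat.beq q.1 e.1).isEmpty then Ps
  else (e.2, e :: ((Ps.filter fun q => Nat.beq q.1 e.1).headD (0, [])).2) :: Ps

/-- The vertices reachable from `s`, with paths. -/
def reach (arcs : List (ℕ × ℕ)) (s : ℕ) : List (ℕ × List (ℕ × ℕ)) :=
  ((List.range (arcs.length + 1)).flatMap fun _ => arcs).foldl reachStep [(s, [])]

/-- Paths without repeated vertices from `s`, given by their arcs, last arc first. -/
inductive SPath (A : ℕ × ℕ → Prop) (s : ℕ) : ℕ → List (ℕ × ℕ) → Prop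
  | nil : SPath A s s []
  | cons {x y : ℕ} {p : List (ℕ × ℕ)} : SPath A s x p → A (x, y) → y ≠ s → (∀ e ∈ p, y ≠ e.2) →
      SPath A s y ((x, y) :: p)

theorem SPath.mem {A : ℕ × ℕ → Prop} {s v : ℕ} {p : List (ℕ × ℕ)} (h : SPath A s v p) :
    ∀ e ∈ p, A e := by
  induction h with
  | nil => simp
  | cons _ ha _ _ ih =>
    intro e he
    rcases List.mem_cons.1 he with rfl | he
    · exact ha
    · exact ih e he

theorem SPath.nodup {A : ℕ × ℕ → Prop} {s v : ℕ} {p : List (ℕ × ℕ)} (h : SPath A s v p) :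
    p.Nodup := by
  induction h with
  | nil => simp
  | cons _ _ _ hy ih =>
    refine List.nodup_cons.2 ⟨fun hm => ?_, ih⟩
    exact hy _ hm rfl

theorem SPath.head_mem {A : ℕ × ℕ → Prop} {s v : ℕ} {p : List (ℕ × ℕ)} (h : SPath A s v p) :
    v = s ∨ ∃ e ∈ p, e.2 = v := by
  cases h with
  | nil => exact Or.inl rfl
  | cons => exact Or.inr ⟨_, List.mem_cons_self, rfl⟩

theorem SPath.fst_mem {A : ℕ × ℕ → Prop} {s v : ℕ} {p : List (ℕ × ℕ)} (h : SPath A s v p) :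
    ∀ e ∈ p, e.1 = s ∨ ∃ e' ∈ p, e'.2 = e.1 := by
  induction h with
  | nil => simp
  | cons hp _ _ _ ih =>
    intro e he
    rcases List.mem_cons.1 he with rfl | he
    · rcases hp.head_mem with h | ⟨e', h1, h2⟩
      · exact Or.inl h
      · exact Or.inr ⟨e', List.mem_cons_of_mem _ h1, h2⟩
    · rcases ih e he with h | ⟨e', h1, h2⟩
      · exact Or.inl h
      · exact Or.inr ⟨e', List.mem_cons_of_mem _ h1, h2⟩

/-- The invariant of the search. -/
structure ReachInv (A : ℕ × ℕ → Prop) (s : ℕ) (Ps : List (ℕ × List (ℕ × ℕ))) : Prop where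
  path : ∀ q ∈ Ps, SPath A s q.1 q.2
  nodup : (Ps.map Prod.fst).Nodup
  start : s ∈ Ps.map Prod.fst
  sub : ∀ q ∈ Ps, ∀ e ∈ q.2, e.2 ∈ Ps.map Prod.fst

theorem reachStep_of_mem {Ps : List (ℕ × List (ℕ × ℕ))} {e : ℕ × ℕ} (h : e.2 ∈ Ps.map Prod.fst) :
    reachStep Ps e = Ps := by
  have : Ps.any (fun q => Nat.beq q.1 e.2) = true := by
    obtain ⟨q, hq, hqe⟩ := List.mem_map.1 h
    exact List.any_eq_true.2 ⟨q, hq, by simpa using hqe⟩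
  simp [reachStep, this]

theorem reachStep_of_not_mem {Ps : List (ℕ × List (ℕ × ℕ))} {e : ℕ × ℕ}
    (h : e.1 ∉ Ps.map Prod.fst) : reachStep Ps e = Ps := by
  have : Ps.filter (fun q => Nat.beq q.1 e.1) = [] := by
    rw [List.filter_eq_nil_iff]
    intro q hq hqe
    exact h (List.mem_map.2 ⟨q, hq, by simpa using hqe⟩)
  simp [reachStep, this]

theorem reachStep_of_new {Ps : List (ℕ × List (ℕ × ℕ))} {e : ℕ × ℕ}
    (h1 : e.1 ∈ Ps.map Prod.fst) (h2 : e.2 ∉ Ps.map Prod.fst) :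
    ∃ p, (e.1, p) ∈ Ps ∧ reachStep Ps e = (e.2, e :: p) :: Ps := by
  have h3 : Ps.any (fun q => Nat.beq q.1 e.2) = false := by
    rw [List.any_eq_false]
    intro q hq hqe
    exact h2 (List.mem_map.2 ⟨q, hq, by simpa using hqe⟩)
  obtain ⟨q, hq, hqe⟩ := List.mem_map.1 h1
  have h4 : q ∈ Ps.filter (fun q => Nat.beq q.1 e.1) := List.mem_filter.2 ⟨hq, by simpa using hqe⟩
  cases h5 : Ps.filter (fun q => Nat.beq q.1 e.1) with
  | nil => rw [h5] at h4; simp at h4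
  | cons r l =>
    have h6 : r ∈ Ps.filter (fun q => Nat.beq q.1 e.1) := by rw [h5]; simp
    obtain ⟨h7, h8⟩ := List.mem_filter.1 h6
    have h8' : r.1 = e.1 := by simpa using h8
    refine ⟨r.2, by rw [← h8']; exact h7, ?_⟩
    simp [reachStep, h3, h5]

theorem ReachInv.step {A : ℕ × ℕ → Prop} {s : ℕ} {Ps : List (ℕ × List (ℕ × ℕ))}
    (h : ReachInv A s Ps) {e : ℕ × ℕ} (he : A e) : ReachInv A s (reachStep Ps e) := by
  by_cases h2 : e.2 ∈ Ps.map Prod.fst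
  · rwa [reachStep_of_mem h2]
  by_cases h1 : e.1 ∈ Ps.map Prod.fst
  · obtain ⟨p, hp, hr⟩ := reachStep_of_new h1 h2
    rw [hr]
    refine ⟨?_, ?_, ?_, ?_⟩
    · intro q hq
      rcases List.mem_cons.1 hq with rfl | hq
      · refine SPath.cons (h.path _ hp) he ?_ ?_
        · intro heq; exact h2 ((show e.2 = s from heq) ▸ h.start)
        · intro e' he' heq
          exact h2 ((show e.2 = e'.2 from heq) ▸ h.sub _ hp e' he')
      · exact h.path q hq
    · rw [List.map_cons]; exact List.nodup_cons.2 ⟨h2, h.nodup⟩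
    · rw [List.map_cons]; exact List.mem_cons_of_mem _ h.start
    · intro q hq e' he'
      rw [List.map_cons]
      rcases List.mem_cons.1 hq with rfl | hq
      · rcases List.mem_cons.1 he' with rfl | he'
        · exact List.mem_cons_self
        · exact List.mem_cons_of_mem _ (h.sub _ hp e' he')
      · exact List.mem_cons_of_mem _ (h.sub _ hq e' he')
  · rwa [reachStep_of_not_mem h1]

theorem ReachInv.foldl {A : ℕ × ℕ → Prop} {s : ℕ} {l : List (ℕ × ℕ)} (hl : ∀ e ∈ l, A e)
    {Ps : List (ℕ × List (ℕ × ℕ))} (h : ReachInv A s Ps) :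
    ReachInv A s (l.foldl reachStep Ps) := by
  induction l generalizing Ps with
  | nil => exact h
  | cons e l ih =>
    exact ih (fun x hx => hl x (List.mem_cons_of_mem _ hx)) (h.step (hl e List.mem_cons_self))

theorem ReachInv.init (A : ℕ × ℕ → Prop) (s : ℕ) : ReachInv A s [(s, [])] where
  path := by simp [SPath.nil]
  nodup := by simp
  start := by simp
  sub := by simp

theorem ReachInv.length_le {arcs : List (ℕ × ℕ)} {s : ℕ} {Ps : List (ℕ × List (ℕ × ℕ))}
    (h : ReachInv (· ∈ arcs) s Ps) : Ps.length ≤ arcs.length + 1 := by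
  have h1 : (Ps.map Prod.fst) ⊆ s :: arcs.map Prod.snd := by
    intro v hv
    obtain ⟨q, hq, rfl⟩ := List.mem_map.1 hv
    rcases (h.path q hq).head_mem with h1 | ⟨e, h1, h2⟩
    · rw [h1]; exact List.mem_cons_self
    · exact List.mem_cons_of_mem _ (List.mem_map.2 ⟨e, (h.path q hq).mem e h1, h2⟩)
  have h2 := (h.nodup.subperm h1).length_le
  simpa using h2

theorem ReachInv.sz_le {arcs : List (ℕ × ℕ)} {s : ℕ} {Ps : List (ℕ × List (ℕ × ℕ))}
    (h : ReachInv (· ∈ arcs) s Ps) :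
    sz Ps ≤ (sz arcs + 1) * ((sz s + sz arcs + (sz arcs * (sz arcs + 1) + 1) + 1) + 1) + 1 := by
  have h1 : ∀ q ∈ Ps, sz q ≤ sz s + sz arcs + (sz arcs * (sz arcs + 1) + 1) + 1 := by
    intro q hq
    have hp := h.path q hq
    have h2 : sz q.1 ≤ sz s + sz arcs := by
      rcases hp.head_mem with h2 | ⟨e, h2, h3⟩
      · rw [h2]; omega
      · have := sz_le_of_mem (hp.mem e h2)
        rw [sz_prod, h3] at this; omega
    have h3 : sz q.2 ≤ q.2.length * (sz arcs + 1) + 1 :=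
      sz_le_length_mul fun e he => (sz_le_of_mem (hp.mem e he)).le
    have h4 : q.2.length ≤ sz arcs :=
      ((hp.nodup.subperm fun e he => hp.mem e he).length_le).trans (length_lt_sz _).le
    have h5 := Nat.mul_le_mul_right (sz arcs + 1) h4
    rw [sz_prod]; omega
  have h2 := sz_le_length_mul h1
  have h3 : Ps.length ≤ sz arcs + 1 := h.length_le.trans (by have := length_lt_sz arcs; omega)
  exact h2.trans (by gcongr)

theorem reach_inv (arcs : List (ℕ × ℕ)) (s : ℕ) : ReachInv (· ∈ arcs) s (reach arcs s) := by
  refine ReachInv.foldl ?_ (ReachInv.init _ _)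
  intro e he
  obtain ⟨_, _, h⟩ := List.mem_flatMap.1 he
  exact h

theorem subset_reachStep (Ps : List (ℕ × List (ℕ × ℕ))) (e : ℕ × ℕ) : Ps <:+ reachStep Ps e := by
  unfold reachStep
  cases (Ps.any (fun q => Nat.beq q.1 e.2) ||
    (Ps.filter fun q => Nat.beq q.1 e.1).isEmpty)
  · exact List.suffix_cons _ _
  · exact List.suffix_refl _

theorem subset_foldl_reachStep (l : List (ℕ × ℕ)) (Ps : List (ℕ × List (ℕ × ℕ))) :
    Ps <:+ l.foldl reachStep Ps := by
  induction l generalizing Ps with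
  | nil => exact List.suffix_refl _
  | cons e l ih => exact (subset_reachStep Ps e).trans (ih _)

/-- No arc of `arcs` leads out of the known vertices. -/
def ReachClosed (arcs : List (ℕ × ℕ)) (Ps : List (ℕ × List (ℕ × ℕ))) : Prop :=
  ∀ e ∈ arcs, e.1 ∈ Ps.map Prod.fst → e.2 ∈ Ps.map Prod.fst

theorem ReachClosed.foldl {arcs l : List (ℕ × ℕ)} {Ps : List (ℕ × List (ℕ × ℕ))}
    (h : ReachClosed arcs Ps) (hl : ∀ e ∈ l, e ∈ arcs) : l.foldl reachStep Ps = Ps := by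
  induction l with
  | nil => rfl
  | cons e l ih =>
    have : reachStep Ps e = Ps := by
      by_cases h1 : e.1 ∈ Ps.map Prod.fst
      · exact reachStep_of_mem (h e (hl e List.mem_cons_self) h1)
      · exact reachStep_of_not_mem h1
    rw [List.foldl_cons, this]
    exact ih fun x hx => hl x (List.mem_cons_of_mem _ hx)

/-- The list only grows at the front. A pass that does not lengthen it has changed nothing at any of
its arcs, and then no arc leads out. -/
theorem reachClosed_or_lt (arcs : List (ℕ × ℕ)) (Ps : List (ℕ × List (ℕ × ℕ))) :
    ReachClosed arcs Ps ∨ Ps.length < (arcs.foldl reachStep Ps).length := by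
  by_contra hcon
  push Not at hcon
  obtain ⟨h1, h2⟩ := hcon
  have heq : ∀ (l : List (ℕ × ℕ)) (Qs : List (ℕ × List (ℕ × ℕ))), (l.foldl reachStep Qs).length ≤ Qs.length →
      ∀ e ∈ l, reachStep Qs e = Qs := by
    intro l
    induction l with
    | nil => simp
    | cons a l ih =>
      intro Qs hQ e he
      have h3 := (subset_foldl_reachStep l (reachStep Qs a)).length_le
      have h4 := (subset_reachStep Qs a)
      have h5 : reachStep Qs a = Qs :=
        (h4.eq_of_length (le_antisymm h4.length_le (h3.trans hQ))).symm
      rcases List.mem_cons.1 he with rfl | he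
      · exact h5
      · rw [List.foldl_cons, h5] at hQ
        exact ih Qs hQ e he
  apply h1
  intro e he he1
  by_contra he2
  obtain ⟨p, _, hr⟩ := reachStep_of_new he1 he2
  have := heq arcs Ps h2 e he
  rw [this] at hr
  have := congrArg List.length hr
  simp at this

/-- Each pass closes the set or finds a new vertex. Every known vertex is `s` or the head of an arc,
so there are at most `arcs.length + 1` of them, and that many passes suffice. -/
theorem reach_closed (arcs : List (ℕ × ℕ)) (s : ℕ) : ReachClosed arcs (reach arcs s) := by
  have key : ∀ k, ReachClosed arcs (((List.range k).flatMap fun _ => arcs).foldl reachStep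
      [(s, [])]) ∨ k < (((List.range k).flatMap fun _ => arcs).foldl reachStep [(s, [])]).length := by
    intro k
    induction k with
    | zero => right; simp
    | succ k ih =>
      rw [List.range_succ, List.flatMap_append, List.foldl_append]
      simp only [List.flatMap_cons, List.flatMap_nil, List.append_nil]
      rcases ih with ih | ih
      · left
        rwa [ih.foldl fun e he => he]
      · rcases reachClosed_or_lt arcs (((List.range k).flatMap fun _ => arcs).foldl reachStep
          [(s, [])]) with h | h
        · left; rwa [h.foldl fun e he => he]
        · right; omega
  rcases key (arcs.length + 1) with h | h
  · exact h
  · have := (reach_inv arcs s).length_le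
    rw [reach] at this; omega

theorem mem_reach_of_reflTransGen {arcs : List (ℕ × ℕ)} {s v : ℕ}
    (h : Relation.ReflTransGen (fun x y => (x, y) ∈ arcs) s v) :
    v ∈ (reach arcs s).map Prod.fst := by
  induction h with
  | refl => exact (reach_inv arcs s).start
  | tail _ hb ih => exact reach_closed arcs s _ hb ih

theorem SPath.reflTransGen {A : ℕ × ℕ → Prop} {s v : ℕ} {p : List (ℕ × ℕ)} (h : SPath A s v p) :
    Relation.ReflTransGen (fun x y => A (x, y)) s v := by
  induction h with
  | nil => exact .refl
  | cons _ ha _ _ ih => exact ih.tail ha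

theorem mem_reach_iff {arcs : List (ℕ × ℕ)} {s v : ℕ} :
    v ∈ (reach arcs s).map Prod.fst ↔ Relation.ReflTransGen (fun x y => (x, y) ∈ arcs) s v := by
  refine ⟨fun h => ?_, mem_reach_of_reflTransGen⟩
  obtain ⟨q, hq, rfl⟩ := List.mem_map.1 h
  exact ((reach_inv arcs s).path q hq).reflTransGen

@[fun_prop]
theorem PolyF.reachStep {f : α → List (ℕ × List (ℕ × ℕ))} {g : α → ℕ × ℕ} (hf : PolyF f)
    (hg : PolyF g) : PolyF (fun a => reachStep (f a) (g a)) := by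
  unfold StBond.reachStep; fun_prop

@[fun_prop]
theorem PolyF.reach {f : α → List (ℕ × ℕ)} {g : α → ℕ} (hf : PolyF f) (hg : PolyF g) :
    PolyF (fun a => reach (f a) (g a)) := by
  unfold StBond.reach
  refine foldl_of_prefix (s := fun _ Ps e => StBond.reachStep Ps e) (by fun_prop) (by fun_prop)
    (by fun_prop)
    (fun a => (sz (f a) + 1) * ((sz (g a) + sz (f a) + (sz (f a) * (sz (f a) + 1) + 1) + 1) + 1) + 1)
    ?_ ?_
  · have h1 := hf.1
    have h2 := hg.1
    have h3 := h1.add (PB.const 1)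
    exact (h3.mul ((((h2.add h1).add ((h1.mul h3).add (PB.const 1))).add (PB.const 1)).add
      (PB.const 1))).add (PB.const 1)
  · intro a l' hl'
    refine (ReachInv.foldl (A := (· ∈ f a)) ?_ (ReachInv.init _ _)).sz_le
    intro e he
    obtain ⟨_, _, h⟩ := List.mem_flatMap.1 (hl'.subset he)
    exact h

/-! ### Unit flows from node `0` to node `1` -/

/-- The residual arcs of the flow `F` in the network `E`. -/
def resid (E F : List (ℕ × ℕ)) : List (ℕ × ℕ) :=
  (E.filter fun e => !memP e F) ++ (E.filter fun e => memP e F).map fun e => (e.2, e.1)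

/-- Push one unit along the residual arc `e`. -/
def toggle (F : List (ℕ × ℕ)) (e : ℕ × ℕ) : List (ℕ × ℕ) :=
  bif memP (e.2, e.1) F then F.filter fun d => !(Nat.beq d.1 e.2 && Nat.beq d.2 e.1) else e :: F

/-- Push one unit along an augmenting path, if there is one. -/
def augment (E F : List (ℕ × ℕ)) : List (ℕ × ℕ) :=
  bif ((reach (resid E F) 0).filter fun q => Nat.beq q.1 1).isEmpty then F
  else E.filter fun e => memP e
    ((((reach (resid E F) 0).filter fun q => Nat.beq q.1 1).headD (0, [])).2.foldl toggle F)

/-- The flow after `q` augmentations. -/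
def maxFlow (E : List (ℕ × ℕ)) (q : ℕ) : List (ℕ × ℕ) := (augment E)^[q] []

theorem mem_resid {E F : List (ℕ × ℕ)} {e : ℕ × ℕ} :
    e ∈ resid E F ↔ (e ∈ E ∧ e ∉ F) ∨ ((e.2, e.1) ∈ E ∧ (e.2, e.1) ∈ F) := by
  obtain ⟨a, b⟩ := e
  simp only [resid, List.mem_append, List.mem_filter, List.mem_map, memP_iff, Bool.not_eq_true',
    Prod.exists, Prod.mk.injEq]
  refine or_congr (and_congr_right fun _ => ?_) ?_
  · rw [← Bool.not_eq_true, memP_iff]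
  · constructor
    · rintro ⟨x, y, h, rfl, rfl⟩; exact h
    · intro h; exact ⟨b, a, h, rfl, rfl⟩

theorem mem_toggle {F : List (ℕ × ℕ)} {e d : ℕ × ℕ} :
    d ∈ toggle F e ↔ if (e.2, e.1) ∈ F then d ∈ F ∧ d ≠ (e.2, e.1) else d = e ∨ d ∈ F := by
  unfold toggle
  by_cases h : (e.2, e.1) ∈ F
  · rw [memP_iff.2 h, if_pos h, cond_true, List.mem_filter]
    obtain ⟨a, b⟩ := d
    refine and_congr_right fun _ => ?_
    rw [Bool.not_eq_true', ← Bool.not_eq_true, Bool.and_eq_true, Nat.beq_eq, Nat.beq_eq, ne_eq,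
      Prod.mk.injEq]
  · rw [Bool.eq_false_iff.2 (fun h' => h (memP_iff.1 h')), if_neg h]
    simp

open Classical in
/-- Net number of arcs of `F` leaving `R`. -/
noncomputable def netOut (R : ℕ → Prop) (F : List (ℕ × ℕ)) : ℤ :=
  ∑ e ∈ F.toFinset, ((if R e.1 then 1 else 0) - (if R e.2 then 1 else 0))

/-- `F` is a flow of value `j` in the network `E`. -/
def IsFlow (E F : List (ℕ × ℕ)) (j : ℕ) : Prop :=
  (∀ e ∈ F, e ∈ E) ∧ ∀ R : ℕ → Prop, R 0 → ¬R 1 → netOut R F = j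

theorem netOut_congr {R : ℕ → Prop} {F F' : List (ℕ × ℕ)} (h : ∀ e, e ∈ F ↔ e ∈ F') :
    netOut R F = netOut R F' := by
  have : F.toFinset = F'.toFinset := by ext e; simp [h]
  rw [netOut, this, netOut]

open Classical in
theorem netOut_toggle {R : ℕ → Prop} {E F : List (ℕ × ℕ)} {e : ℕ × ℕ} (he : e ∈ resid E F) :
    netOut R (toggle F e) = netOut R F + ((if R e.1 then 1 else 0) - (if R e.2 then 1 else 0)) := by
  by_cases h : (e.2, e.1) ∈ F
  · have h1 : (toggle F e).toFinset = F.toFinset.erase (e.2, e.1) := by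
      ext d; simp [mem_toggle, h, and_comm]
    have h2 := Finset.add_sum_erase F.toFinset
      (fun e : ℕ × ℕ => ((if R e.1 then 1 else 0) - (if R e.2 then 1 else 0) : ℤ))
      (List.mem_toFinset.2 h)
    rw [netOut, netOut, h1]
    simp only at h2
    linarith
  · have h1 : (toggle F e).toFinset = insert e F.toFinset := by
      ext d; simp [mem_toggle, h]
    have h2 : e ∉ F.toFinset := by
      rw [List.mem_toFinset]
      rcases mem_resid.1 he with h' | h'
      · exact h'.2
      · exact absurd h'.2 h
    rw [netOut, netOut, h1, Finset.sum_insert h2]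
    ring

-- Toggling the last arc `(x, y)` affects only arcs that meet `y`. The rest of the path avoids `y`,
-- since vertices do not repeat, so its arcs stay residual and the remaining pushes are legitimate.
-- The changes of the net outflow telescope.
open Classical in
theorem push_path {E : List (ℕ × ℕ)} {A : ℕ × ℕ → Prop} {s v : ℕ} {p : List (ℕ × ℕ)}
    (hp : SPath A s v p) : ∀ F : List (ℕ × ℕ), (∀ e ∈ F, e ∈ E) → (∀ e ∈ p, e ∈ resid E F) →
      (∀ e ∈ p.foldl toggle F, e ∈ E) ∧ ∀ R : ℕ → Prop, netOut R (p.foldl toggle F)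
        = netOut R F + ((if R s then 1 else 0) - (if R v then 1 else 0)) := by
  induction hp with
  | nil => intro F hF _; exact ⟨hF, fun R => by simp⟩
  | @cons x y p hp _ hys hy ih =>
    intro F hF hres
    have h0 := hres (x, y) List.mem_cons_self
    have hF1 : ∀ e ∈ toggle F (x, y), e ∈ E := by
      intro e he
      rw [mem_toggle] at he
      split_ifs at he with h
      · exact hF e he.1
      · rcases he with rfl | he
        · rcases mem_resid.1 h0 with h' | h'
          · exact h'.1
          · exact absurd h'.2 h
        · exact hF e he
    have hmem : ∀ d : ℕ × ℕ, d.1 ≠ y → d.2 ≠ y → (d ∈ toggle F (x, y) ↔ d ∈ F) := by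
      intro d h1 h2
      rw [mem_toggle]
      have h3 : d ≠ (x, y) := fun h => h2 (by rw [h])
      have h4 : d ≠ (y, x) := fun h => h1 (by rw [h])
      split_ifs <;> simp [h3, h4]
    have hres1 : ∀ e ∈ p, e ∈ resid E (toggle F (x, y)) := by
      intro e he
      have h1 : e.2 ≠ y := (hy e he).symm
      have h2 : e.1 ≠ y := by
        rcases hp.fst_mem e he with h | ⟨e', h3, h4⟩
        · rw [h]; exact hys.symm
        · rw [← h4]; exact (hy e' h3).symm
      have h3 := hres e (List.mem_cons_of_mem _ he)
      rw [mem_resid] at h3 ⊢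
      rwa [hmem e h2 h1, hmem (e.2, e.1) h1 h2]
    obtain ⟨h1, h2⟩ := ih _ hF1 hres1
    refine ⟨h1, fun R => ?_⟩
    rw [List.foldl_cons, h2, netOut_toggle h0]
    ring

theorem augment_of_not_mem {E F : List (ℕ × ℕ)}
    (h : 1 ∉ (reach (resid E F) 0).map Prod.fst) : augment E F = F := by
  have : (reach (resid E F) 0).filter (fun q => Nat.beq q.1 1) = [] := by
    rw [List.filter_eq_nil_iff]
    intro q hq hq1
    exact h (List.mem_map.2 ⟨q, hq, by simpa using hq1⟩)
  simp [augment, this]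

/-- An augmenting path starts in every `R` of the definition and ends outside it, which adds one.
The new flow is filtered out of `E` so that flows remain sublists of `E` and cannot grow in size. -/
theorem IsFlow.augment {E F : List (ℕ × ℕ)} {j : ℕ} (hF : IsFlow E F j)
    (h : 1 ∈ (reach (resid E F) 0).map Prod.fst) : IsFlow E (augment E F) (j + 1) := by
  obtain ⟨q, hq, hq1⟩ := List.mem_map.1 h
  have h4 : q ∈ (reach (resid E F) 0).filter (fun q => Nat.beq q.1 1) :=
    List.mem_filter.2 ⟨hq, by simpa using hq1⟩
  cases h5 : (reach (resid E F) 0).filter (fun q => Nat.beq q.1 1) with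
  | nil => rw [h5] at h4; simp at h4
  | cons r l =>
    have h6 : r ∈ (reach (resid E F) 0).filter (fun q => Nat.beq q.1 1) := by rw [h5]; simp
    obtain ⟨h7, h8⟩ := List.mem_filter.1 h6
    have h8' : r.1 = 1 := by simpa using h8
    have hp := (reach_inv _ _).path r h7
    obtain ⟨h9, h10⟩ := push_path hp F hF.1 hp.mem
    have h11 : StBond.augment E F = E.filter fun e => memP e (r.2.foldl toggle F) := by
      simp [StBond.augment, h5]
    rw [h11]
    refine ⟨fun e he => (List.mem_filter.1 he).1, fun R h0 h1 => ?_⟩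
    rw [netOut_congr (F' := r.2.foldl toggle F), h10, hF.2 R h0 h1, h8', if_pos h0, if_neg h1]
    · push_cast; ring
    · intro e
      rw [List.mem_filter, memP_iff]
      exact ⟨fun h => h.2, fun h => ⟨h9 e h, h⟩⟩

/-- Every round raises the value by one until the sink is unreachable; from then on nothing changes.
Hence a value below `q` certifies maximality. -/
theorem maxFlow_spec (E : List (ℕ × ℕ)) (q : ℕ) : ∃ j ≤ q, IsFlow E (maxFlow E q) j ∧
    (j < q → 1 ∉ (reach (resid E (maxFlow E q)) 0).map Prod.fst) := by
  induction q with
  | zero =>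
    refine ⟨0, le_rfl, ⟨by simp [maxFlow], fun R _ _ => by simp [maxFlow, netOut]⟩, fun h => ?_⟩
    omega
  | succ q ih =>
    obtain ⟨j, hj, hF, hlt⟩ := ih
    have hs : maxFlow E (q + 1) = augment E (maxFlow E q) := Function.iterate_succ_apply' _ _ _
    by_cases h : 1 ∈ (reach (resid E (maxFlow E q)) 0).map Prod.fst
    · have : j = q := by
        by_contra hne
        exact hlt (by omega) h
      subst this
      exact ⟨j + 1, le_rfl, hs ▸ hF.augment h, fun h => absurd h (lt_irrefl _)⟩
    · refine ⟨j, by omega, ?_, fun _ => ?_⟩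
      · rw [hs, augment_of_not_mem h]; exact hF
      · rw [hs, augment_of_not_mem h]; exact h

open Classical in
/-- Weak duality. -/
theorem IsFlow.le_cut {E F : List (ℕ × ℕ)} {j : ℕ} (hF : IsFlow E F j) {R : ℕ → Prop} (h0 : R 0)
    (h1 : ¬R 1) {C : Finset (ℕ × ℕ)} (hC : ∀ e ∈ E, R e.1 → ¬R e.2 → e ∈ C) : j ≤ C.card := by
  have h2 := hF.2 R h0 h1
  have h3 : netOut R F ≤ ∑ e ∈ F.toFinset, if e ∈ C then (1 : ℤ) else 0 := by
    refine Finset.sum_le_sum fun e he => ?_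
    have h4 := hC e (hF.1 e (List.mem_toFinset.1 he))
    by_cases h5 : R e.1 <;> by_cases h6 : R e.2 <;> by_cases h7 : e ∈ C <;> simp_all
  rw [Finset.sum_boole] at h3
  have h4 : (F.toFinset.filter (· ∈ C)).card ≤ C.card :=
    Finset.card_le_card fun e he => (Finset.mem_filter.1 he).2
  have h5 : ((j : ℕ) : ℤ) ≤ C.card := by
    rw [← h2]; exact h3.trans (by exact_mod_cast h4)
  exact_mod_cast h5

-- No flow arc enters the set reachable in the residual network, since its reversal would be
-- residual. The net outflow of that set is therefore the plain number of outgoing flow arcs.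
open Classical in
theorem IsFlow.cut_eq {E F : List (ℕ × ℕ)} {j : ℕ} (hF : IsFlow E F j)
    (h1 : 1 ∉ (reach (resid E F) 0).map Prod.fst) :
    (F.toFinset.filter fun e => e.1 ∈ (reach (resid E F) 0).map Prod.fst ∧
      e.2 ∉ (reach (resid E F) 0).map Prod.fst).card = j := by
  have h2 := hF.2 (· ∈ (reach (resid E F) 0).map Prod.fst) (reach_inv _ _).start h1
  have h3 : netOut (· ∈ (reach (resid E F) 0).map Prod.fst) F
      = ∑ e ∈ F.toFinset, if e.1 ∈ (reach (resid E F) 0).map Prod.fst ∧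
      e.2 ∉ (reach (resid E F) 0).map Prod.fst then (1 : ℤ) else 0 := by
    refine Finset.sum_congr rfl fun e he => ?_
    have he' := List.mem_toFinset.1 he
    have h4 := reach_closed (resid E F) 0 (e.2, e.1) (mem_resid.2 (Or.inr ⟨hF.1 e he', he'⟩))
    simp only at h4
    by_cases h5 : e.1 ∈ (reach (resid E F) 0).map Prod.fst <;>
      by_cases h6 : e.2 ∈ (reach (resid E F) 0).map Prod.fst
    · simp only [h5, h6, not_true, and_false, if_false, if_true, sub_self]
    · simp only [h5, h6, not_false_iff, and_self, if_true, if_false, sub_zero]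
    · exact absurd (h4 h6) h5
    · simp only [h5, h6, false_and, if_false, sub_self]
  rw [h3, Finset.sum_boole] at h2
  exact_mod_cast h2

/-! ### Vertex separators -/

/-- The network for vertex-disjoint paths from `A` to `B` in the graph `E`: the vertex `v` is split
into the nodes `2 * v + 2` and `2 * v + 3`. -/
def net (n : ℕ) (E : List (ℕ × ℕ)) (A B : List ℕ) : List (ℕ × ℕ) :=
  (List.range n).map (fun v => (2 * v + 2, 2 * v + 3)) ++
    (E.map (fun e => (2 * e.1 + 3, 2 * e.2 + 2)) ++
      (A.map (fun a => (0, 2 * a + 2)) ++ B.map (fun b => (2 * b + 3, 1))))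

/-- The arc `e` of the network is charged to the vertex `v`. -/
def onVertex (v : ℕ) (e : ℕ × ℕ) : Bool :=
  (Nat.beq e.1 0 && Nat.beq e.2 (2 * v + 2)) ||
    (Nat.beq e.1 (2 * v + 2) || Nat.beq e.1 (2 * v + 3))

/-- The vertices below `n` to which an arc of `N` leaving `R` is charged. -/
def cutVertices (n : ℕ) (N : List (ℕ × ℕ)) (R : List ℕ) : List ℕ :=
  (List.range n).filter fun v => N.any fun e => memN e.1 R && (!memN e.2 R && onVertex v e)

/-- The cut vertices of a flow in the network `N`, if the flow is maximal. -/
def sepOfFlow (n : ℕ) (N F : List (ℕ × ℕ)) : List (List ℕ) :=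
  bif memN 1 ((reach (resid N F) 0).map fun q => q.1) then []
  else [cutVertices n N ((reach (resid N F) 0).map fun q => q.1)]

/-- A list with a vertex set of size at most `q` that separates `A` from `B`, if there is one. -/
def sep (n : ℕ) (E : List (ℕ × ℕ)) (A B : List ℕ) (q : ℕ) : List (List ℕ) :=
  sepOfFlow n (net n E A B) (maxFlow (net n E A B) q)

theorem mem_cutVertices {n : ℕ} {N : List (ℕ × ℕ)} {R : List ℕ} {v : ℕ} :
    v ∈ cutVertices n N R ↔ v < n ∧ ∃ e ∈ N, e.1 ∈ R ∧ e.2 ∉ R ∧ onVertex v e = true := by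
  simp only [cutVertices, List.mem_filter, List.mem_range, List.any_eq_true, Bool.and_eq_true,
    memN_iff, Bool.not_eq_true', ← Bool.not_eq_true]

/-- All arcs have capacity one, so a minimum cut may contain arcs of edges as well as arcs of split
vertices. Each cut arc is charged to one vertex, normally its tail, which gives at most as many
vertices as cut arcs; deleting them still separates. -/
theorem sep_sound {n : ℕ} {E : List (ℕ × ℕ)} {A B S : List ℕ} {q : ℕ}
    (hE : ∀ e ∈ E, e.2 < n) (hA : ∀ a ∈ A, a < n) (hS : S ∈ sep n E A B q) :
    S.toFinset.card ≤ q ∧ ∀ a ∈ A, a ∉ S → ∀ b,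
      Relation.ReflTransGen (fun x y => (x, y) ∈ E ∧ y ∉ S) a b → b ∉ B := by
  obtain ⟨j, hj, hF, -⟩ := maxFlow_spec (net n E A B) q
  set N := net n E A B with hN
  set F := maxFlow N q with hF'
  set R := (reach (resid N F) 0).map Prod.fst with hR
  have h1 : 1 ∉ R ∧ S = cutVertices n N R := by
    unfold sep sepOfFlow at hS
    cases h : memN 1 ((reach (resid N F) 0).map fun q => q.1) with
    | true => rw [← hN, ← hF', h] at hS; simp at hS
    | false =>
      rw [← hN, ← hF', h] at hS
      refine ⟨fun h' => ?_, by simpa using hS⟩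
      rw [memN_iff.2 h'] at h; exact absurd h (by simp)
  obtain ⟨h1, rfl⟩ := h1
  constructor
  · refine le_trans ?_ hj
    rw [← hF.cut_eq h1]
    refine Finset.card_le_card_of_surjOn (fun e : ℕ × ℕ => if e.1 = 0 then (e.2 - 2) / 2 else
      (e.1 - 2) / 2) ?_
    intro v hv
    obtain ⟨hvn, e, he, he1, he2, hev⟩ := mem_cutVertices.1 (List.mem_toFinset.1 hv)
    refine ⟨e, ?_, ?_⟩
    · simp only [Finset.mem_coe, Finset.mem_filter, List.mem_toFinset]
      refine ⟨?_, he1, he2⟩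
      -- An unused arc of the network is residual and cannot leave the reachable set; so every cut
      -- arc carries flow.
      by_contra hne
      exact he2 (reach_closed (resid N F) 0 e (mem_resid.2 (Or.inl ⟨he, hne⟩)) he1)
    · simp only [onVertex, Bool.or_eq_true, Bool.and_eq_true, Nat.beq_eq] at hev
      simp only
      split_ifs with h0 <;> omega
  · have hin : ∀ v < n, v ∉ cutVertices n N R → 2 * v + 2 ∈ R → 2 * v + 3 ∈ R := by
      intro v hv hvS h2
      by_contra h3
      refine hvS (mem_cutVertices.2 ⟨hv, (2 * v + 2, 2 * v + 3), ?_, h2, h3, by simp [onVertex]⟩)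
      simp [hN, net, hv]
    intro a ha haS b hab
    -- Along a walk that avoids the cut vertices the outgoing node stays in `R`: an arc leaving `R`
    -- would put the vertex it is charged to among the cut vertices.
    have key : b < n ∧ b ∉ cutVertices n N R ∧ 2 * b + 3 ∈ R := by
      induction hab with
      | refl =>
        refine ⟨hA a ha, haS, hin a (hA a ha) haS ?_⟩
        by_contra h2
        refine haS (mem_cutVertices.2 ⟨hA a ha, (0, 2 * a + 2), ?_, (reach_inv _ _).start, h2,
          by simp [onVertex]⟩)
        simp [hN, net, ha]
      | @tail x y _ hxy ih =>
        obtain ⟨h2, h3, h4⟩ := ih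
        refine ⟨hE _ hxy.1, hxy.2, hin y (hE _ hxy.1) hxy.2 ?_⟩
        by_contra h5
        refine h3 (mem_cutVertices.2 ⟨h2, (2 * x + 3, 2 * y + 2), ?_, h4, h5,
          by simp [onVertex]⟩)
        simp only [hN, net, List.mem_append, List.mem_map]
        exact Or.inr (Or.inl ⟨(x, y), hxy.1, rfl⟩)
    obtain ⟨h2, h3, h4⟩ := key
    intro hb
    refine h3 (mem_cutVertices.2 ⟨h2, (2 * b + 3, 1), ?_, h4, h1, by simp [onVertex]⟩)
    simp [hN, net, hb]

/-- If the sink were still reachable after `q` rounds, one more augmentation would give a flow of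
value `q + 1`. But the split arcs of `S` form a cut of at most `q` arcs. -/
theorem sep_complete {n : ℕ} {E : List (ℕ × ℕ)} {A B : List ℕ} {q : ℕ} {S : Finset ℕ}
    (hSq : S.card ≤ q) (hS : ∀ a ∈ A, a ∉ S → ∀ b,
      Relation.ReflTransGen (fun x y => (x, y) ∈ E ∧ y ∉ S) a b → b ∉ B) :
    ∃ T, T ∈ sep n E A B q := by
  unfold sep sepOfFlow
  set N := net n E A B with hN
  set F := maxFlow N q with hF'
  cases h : memN 1 ((reach (resid N F) 0).map fun q => q.1) with
  | false => exact ⟨_, List.mem_singleton_self _⟩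
  | true =>
    exfalso
    have h1 : 1 ∈ (reach (resid N F) 0).map Prod.fst := memN_iff.1 h
    obtain ⟨j, hj, hF, hlt⟩ := maxFlow_spec N q
    have hjq : j = q := by
      by_contra hne
      exact hlt (by omega) h1
    subst hjq
    have hF1 := hF.augment h1
    let Q : ℕ → Prop := fun v => ∃ a ∈ A, a ∉ S ∧
      Relation.ReflTransGen (fun x y => (x, y) ∈ E ∧ y ∉ S) a v
    have hQS : ∀ v, Q v → v ∉ S := by
      rintro v ⟨a, _, haS, hav⟩
      cases hav with
      | refl => exact haS
      | tail _ h => exact h.2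
    -- The source side of the cut: both nodes of the vertices reached from `A` outside `S`, but only
    -- the incoming nodes of the vertices of `S`.
    let R : ℕ → Prop := fun x => x = 0 ∨ (∃ v, x = 2 * v + 2 ∧ (v ∈ S ∨ Q v)) ∨
      ∃ v, x = 2 * v + 3 ∧ Q v
    have hR2 : ∀ v, R (2 * v + 2) ↔ v ∈ S ∨ Q v := by
      intro v
      constructor
      · rintro (h | ⟨w, h, hw⟩ | ⟨w, h, _⟩)
        · omega
        · obtain rfl : v = w := by omega
          exact hw
        · omega
      · exact fun h => Or.inr (Or.inl ⟨v, rfl, h⟩)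
    have hR3 : ∀ v, R (2 * v + 3) ↔ Q v := by
      intro v
      constructor
      · rintro (h | ⟨w, h, hw⟩ | ⟨w, h, hw⟩)
        · omega
        · omega
        · obtain rfl : v = w := by omega
          exact hw
      · exact fun h => Or.inr (Or.inr ⟨v, rfl, h⟩)
    have hR1 : ¬R 1 := by
      rintro (h | ⟨w, h, _⟩ | ⟨w, h, _⟩) <;> omega
    have hle := hF1.le_cut (R := R) (Or.inl rfl) hR1
      (C := S.image fun v => (2 * v + 2, 2 * v + 3)) (by
        intro e he h2 h3
        simp only [hN, net, List.mem_append, List.mem_map, List.mem_range] at he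
        rcases he with ⟨v, _, rfl⟩ | ⟨d, hd, rfl⟩ | ⟨a, ha, rfl⟩ | ⟨b, hb, rfl⟩
        · rcases (hR2 v).1 h2 with h4 | h4
          · exact Finset.mem_image.2 ⟨v, h4, rfl⟩
          · exact absurd ((hR3 v).2 h4) h3
        · exfalso
          apply h3
          obtain ⟨a, ha, haS, had⟩ := (hR3 _).1 h2
          refine (hR2 _).2 ?_
          by_cases h4 : d.2 ∈ S
          · exact Or.inl h4
          · exact Or.inr ⟨a, ha, haS, had.tail ⟨hd, h4⟩⟩
        · exfalso
          apply h3
          refine (hR2 _).2 ?_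
          by_cases h4 : a ∈ S
          · exact Or.inl h4
          · exact Or.inr ⟨a, ha, h4, .refl⟩
        · exfalso
          obtain ⟨a, ha, haS, hab⟩ := (hR3 _).1 h2
          exact hS a ha haS b hab hb)
    have := hle.trans Finset.card_image_le
    omega

/-! ### Flows and separators take polynomial time -/

@[fun_prop]
theorem PolyF.resid {f g : α → List (ℕ × ℕ)} (hf : PolyF f) (hg : PolyF g) :
    PolyF (fun a => resid (f a) (g a)) := by
  unfold StBond.resid; fun_prop

@[fun_prop]
theorem PolyF.toggle {f : α → List (ℕ × ℕ)} {g : α → ℕ × ℕ} (hf : PolyF f) (hg : PolyF g) :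
    PolyF (fun a => toggle (f a) (g a)) := by
  unfold StBond.toggle; fun_prop

@[fun_prop]
theorem PolyF.foldl_toggle {f g : α → List (ℕ × ℕ)} (hf : PolyF f) (hg : PolyF g) :
    PolyF (fun a => (f a).foldl StBond.toggle (g a)) := by
  refine foldl_of_growth (s := fun _ F e => StBond.toggle F e) (by fun_prop) hg hf
    (fun a => sz (f a)) hf.1 ?_
  intro a e he F
  have h1 := sz_le_of_mem he
  unfold StBond.toggle
  cases StBond.memP (e.2, e.1) F
  · simp only [cond_false, sz_cons]; omega
  · exact (sz_le_of_sublist List.filter_sublist).trans (Nat.le_add_right _ _)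

@[fun_prop]
theorem PolyF.augment {f g : α → List (ℕ × ℕ)} (hf : PolyF f) (hg : PolyF g) :
    PolyF (fun a => augment (f a) (g a)) := by
  unfold StBond.augment; fun_prop

@[fun_prop]
theorem PolyF.maxFlow {f : α → List (ℕ × ℕ)} {g : α → ℕ} (hf : PolyF f) (hg : PolyF g) :
    PolyF (fun a => maxFlow (f a) (g a)) := by
  unfold StBond.maxFlow
  refine iterate_of_growth (s := fun a F => StBond.augment (f a) F) (by fun_prop) (by fun_prop) hg
    (fun a => sz (f a)) hf.1 ?_
  intro a F
  unfold StBond.augment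
  cases List.isEmpty _
  · exact (sz_le_of_sublist List.filter_sublist).trans (Nat.le_add_left _ _)
  · simp

@[fun_prop]
theorem PolyF.net {n : α → ℕ} {E : α → List (ℕ × ℕ)} {A B : α → List ℕ} (hn : PolyF n)
    (hE : PolyF E) (hA : PolyF A) (hB : PolyF B) :
    PolyF (fun a => net (n a) (E a) (A a) (B a)) := by
  unfold StBond.net; fun_prop

@[fun_prop]
theorem PolyF.onVertex {n : α → ℕ} {e : α → ℕ × ℕ} (hn : PolyF n) (he : PolyF e) :
    PolyF (fun a => onVertex (n a) (e a)) := by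
  unfold StBond.onVertex; fun_prop

@[fun_prop]
theorem PolyF.cutVertices {n : α → ℕ} {N : α → List (ℕ × ℕ)} {R : α → List ℕ} (hn : PolyF n)
    (hN : PolyF N) (hR : PolyF R) : PolyF (fun a => cutVertices (n a) (N a) (R a)) := by
  unfold StBond.cutVertices; fun_prop

@[fun_prop]
theorem PolyF.sepOfFlow {n : α → ℕ} {N F : α → List (ℕ × ℕ)} (hn : PolyF n) (hN : PolyF N)
    (hF : PolyF F) : PolyF (fun a => sepOfFlow (n a) (N a) (F a)) := by
  unfold StBond.sepOfFlow; fun_prop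

@[fun_prop]
theorem PolyF.sep {n : α → ℕ} {E : α → List (ℕ × ℕ)} {A B : α → List ℕ} {q : α → ℕ} (hn : PolyF n)
    (hE : PolyF E) (hA : PolyF A) (hB : PolyF B) (hq : PolyF q) :
    PolyF (fun a => sep (n a) (E a) (A a) (B a) (q a)) := by
  unfold StBond.sep; fun_prop

/-! ### Balanced separations from tree decompositions -/

/-- The nodes of a tree on the side of `j` of the edge `i j`. -/
def branch {ι : Type} (T : SimpleGraph ι) (i j : ι) : Set ι :=
  {l | (T.deleteEdges {s(i, j)}).Reachable j l}

theorem not_mem_branch {ι : Type} {T : SimpleGraph ι} (hT : T.IsTree) {i j : ι} (h : T.Adj i j) :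
    i ∉ branch T i j := by
  intro hi
  have h1 := SimpleGraph.isAcyclic_iff_forall_isBridge.1 hT.2 ((SimpleGraph.mem_edgeSet T).2 h)
  exact (SimpleGraph.isBridge_iff.1 h1) (SimpleGraph.Reachable.symm hi)

theorem mem_branch_of_adj {ι : Type} {T : SimpleGraph ι} {i j l l' : ι} (hl : l ∈ branch T i j)
    (h : T.Adj l l') (hne : s(l, l') ≠ s(i, j)) : l' ∈ branch T i j := by
  refine SimpleGraph.Reachable.trans hl (SimpleGraph.Adj.reachable ?_)
  rw [SimpleGraph.deleteEdges_adj]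
  exact ⟨h, by simpa using hne⟩

theorem exists_branch {ι : Type} {T : SimpleGraph ι} (hT : T.IsTree) {i a : ι} (h : i ≠ a) :
    ∃ j, T.Adj i j ∧ a ∈ branch T i j ∧ T.dist j a < T.dist i a := by
  obtain ⟨p, hp⟩ := hT.1.exists_walk_length_eq_dist i a
  have hpath := p.isPath_of_length_eq_dist hp
  cases p with
  | nil => exact absurd rfl h
  | @cons _ j _ hij p =>
    refine ⟨j, hij, ?_, ?_⟩
    · rw [SimpleGraph.Walk.cons_isPath_iff] at hpath
      refine ⟨p.toDeleteEdges {s(i, j)} ?_⟩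
      intro e he hes
      rw [Set.mem_singleton_iff] at hes
      subst hes
      exact hpath.2 (p.fst_mem_support_of_mem_edges he)
    · have := SimpleGraph.dist_le p
      rw [SimpleGraph.Walk.length_cons] at hp; omega

/-- The nodes whose bags contain `y` are connected. The only tree edge out of the branch is `i j`,
and crossing it requires `y` in both bags. -/
theorem TreeDecomposition.mem_branch {V ι : Type} {G : SimpleGraph V} (D : TreeDecomposition G ι)
    {i j : ι} {y : V} (hy : ¬(y ∈ D.bag i ∧ y ∈ D.bag j)) {l l' : ι}
    (hl : y ∈ D.bag l) (hl' : y ∈ D.bag l') (h : l ∈ branch D.tree i j) :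
    l' ∈ branch D.tree i j := by
  obtain ⟨p⟩ := (D.connected_bags y).preconnected ⟨l, hl⟩ ⟨l', hl'⟩
  have key : ∀ (u v : {i | y ∈ D.bag i}), (D.tree.induce {i | y ∈ D.bag i}).Walk u v →
      (u : ι) ∈ branch D.tree i j → (v : ι) ∈ branch D.tree i j := by
    intro u v p
    induction p with
    | nil => exact fun h => h
    | @cons u v w huv p ih =>
      intro hu
      refine ih (mem_branch_of_adj hu huv ?_)
      intro heq
      apply hy
      rcases Sym2.eq_iff.1 heq with ⟨h1, h2⟩ | ⟨h1, h2⟩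
      · exact ⟨h1 ▸ u.2, h2 ▸ v.2⟩
      · exact ⟨h2 ▸ v.2, h1 ▸ u.2⟩
  exact key _ _ p h

-- A walk through the tree. `X` has all its outside neighbours in the bag of the current node `i`
-- and contains at least `k + 2` vertices of `W`. If it contains at most `2k + 3` of them, the bag
-- of `i` is the separator. Otherwise `X` is split, or the walk moves one edge towards a bag `a`
-- meeting `X`. Either `X` shrinks or it stays the same and `a` gets closer, whence the nested
-- induction on `m` and `d`.
open Classical in
theorem TreeDecomposition.exists_separation_aux {V ι : Type} {G : SimpleGraph V}
    (D : TreeDecomposition G ι) {k : ℕ} (hk : ∀ i, (D.bag i).card ≤ k + 1) {W : Finset V}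
    (hW : 4 * k + 6 ≤ W.card) (m : ℕ) : ∀ X : Finset V, X.card = m → ∀ (d : ℕ) (i a : ι) (x : V),
      D.tree.dist i a = d → x ∈ X → x ∈ D.bag a → (∀ y ∈ X, y ∉ D.bag i) →
      (∀ y ∈ X, ∀ z, G.Adj y z → z ∈ X ∨ z ∈ D.bag i) → k + 2 ≤ (X ∩ W).card →
      ∃ S X : Finset V, S.card ≤ k + 1 ∧ (∀ y ∈ X, y ∉ S) ∧
        (∀ y ∈ X, ∀ z, G.Adj y z → z ∈ X ∨ z ∈ S) ∧ k + 2 ≤ (X ∩ W).card ∧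
        k + 2 ≤ (W \ (X ∪ S)).card := by
  induction m using Nat.strong_induction_on with
  | _ m ihm =>
  intro X hX d
  induction d using Nat.strong_induction_on with
  | _ d ihd =>
  intro i a x hd hxX hxa hdisj hcl hXW
  -- Here `W` keeps at least `(4k + 6) - (2k + 3) - (k + 1) = k + 2` vertices outside `X` and the
  -- bag.
  by_cases hsmall : (X ∩ W).card ≤ 2 * k + 3
  · refine ⟨D.bag i, X, hk i, hdisj, hcl, hXW, ?_⟩
    have h1 : W ⊆ (X ∩ W) ∪ D.bag i ∪ (W \ (X ∪ D.bag i)) := by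
      intro w hw
      simp only [Finset.mem_union, Finset.mem_inter, Finset.mem_sdiff]
      tauto
    have h2 := (Finset.card_le_card h1).trans (Finset.card_union_le _ _)
    have h3 := Finset.card_union_le (X ∩ W) (D.bag i)
    have h4 := hk i
    omega
  have hia : i ≠ a := by
    rintro rfl; exact hdisj x hxX hxa
  obtain ⟨j, hij, haj, hdist⟩ := exists_branch D.isTree hia
  have hiB := not_mem_branch D.isTree hij
  set B := branch D.tree i j with hB
  have hside : ∀ y ∈ X, ∀ l l', y ∈ D.bag l → y ∈ D.bag l' → l ∈ B → l' ∈ B :=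
    fun y hy l l' h1 h2 h3 => D.mem_branch (fun h => hdisj y hy h.1) h1 h2 h3
  set X₁ := X.filter fun y => ∃ l ∈ B, y ∈ D.bag l with hX₁
  set X₂ := X.filter fun y => ¬∃ l ∈ B, y ∈ D.bag l with hX₂
  have hx₁ : x ∈ X₁ := Finset.mem_filter.2 ⟨hxX, a, haj, hxa⟩
  have hsplit : (X ∩ W).card ≤ (X₁ ∩ W).card + (X₂ ∩ W).card := by
    refine le_trans (Finset.card_le_card ?_) (Finset.card_union_le _ _)
    intro y hy
    simp only [hX₁, hX₂, Finset.mem_union, Finset.mem_inter, Finset.mem_filter] at hy ⊢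
    by_cases h : ∃ l ∈ B, y ∈ D.bag l
    · exact Or.inl ⟨⟨hy.1, h⟩, hy.2⟩
    · exact Or.inr ⟨⟨hy.1, h⟩, hy.2⟩
  -- No edge joins `X₁` and `X₂`, as the bags of a vertex of `X` lie all inside or all outside the
  -- branch. Of the at least `2k + 4` vertices of `X ∩ W`, one part contains `k + 2`.
  by_cases hne : X₂.Nonempty
  · by_cases h1 : k + 2 ≤ (X₁ ∩ W).card
    · refine ihm X₁.card ?_ X₁ rfl _ i a x rfl hx₁ hxa
        (fun y hy => hdisj y (Finset.mem_filter.1 hy).1) ?_ h1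
      · rw [← hX]
        refine Finset.card_lt_card ⟨Finset.filter_subset _ _, fun hsub => ?_⟩
        obtain ⟨y, hy⟩ := hne
        obtain ⟨h2, h3⟩ := Finset.mem_filter.1 hy
        exact h3 (Finset.mem_filter.1 (hsub h2)).2
      · intro y hy z hyz
        obtain ⟨hyX, l, hl, hyl⟩ := Finset.mem_filter.1 hy
        refine (hcl y hyX z hyz).imp (fun hz => Finset.mem_filter.2 ⟨hz, ?_⟩) fun h => h
        obtain ⟨l', h2, h3⟩ := D.exists_edge_bag y z hyz
        exact ⟨l', hside y hyX l l' hyl h2 hl, h3⟩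
    · have h2 : k + 2 ≤ (X₂ ∩ W).card := by omega
      obtain ⟨y, hy⟩ := hne
      obtain ⟨b, hb⟩ := D.exists_mem_bag y
      refine ihm X₂.card ?_ X₂ rfl _ i b y rfl hy hb
        (fun y hy => hdisj y (Finset.mem_filter.1 hy).1) ?_ h2
      · rw [← hX]
        refine Finset.card_lt_card ⟨Finset.filter_subset _ _, fun hsub => ?_⟩
        exact (Finset.mem_filter.1 (hsub hxX)).2 (Finset.mem_filter.1 hx₁).2
      · intro y hy z hyz
        obtain ⟨hyX, hyn⟩ := Finset.mem_filter.1 hy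
        refine (hcl y hyX z hyz).imp (fun hz => Finset.mem_filter.2 ⟨hz, ?_⟩) fun h => h
        rintro ⟨l, hl, hzl⟩
        obtain ⟨l', h2, h3⟩ := D.exists_edge_bag y z hyz
        exact hyn ⟨l', hside z hz l l' hzl h3 hl, h2⟩
  · have hall : ∀ y ∈ X, ∃ l ∈ B, y ∈ D.bag l := by
      intro y hy
      by_contra hcon
      exact hne ⟨y, Finset.mem_filter.2 ⟨hy, hcon⟩⟩
    -- Now every bag meeting `X` lies in the branch, and `i` does not. A vertex of the bag of `i`
    -- adjacent to `X` therefore occurs on both sides of the edge `i j`, hence also in the bag of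
    -- `j`.
    have hcl' : ∀ y ∈ X \ D.bag j, ∀ z, G.Adj y z → z ∈ X \ D.bag j ∨ z ∈ D.bag j := by
      intro y hy z hyz
      obtain ⟨hyX, hyj⟩ := Finset.mem_sdiff.1 hy
      by_cases hzj : z ∈ D.bag j
      · exact Or.inr hzj
      left
      refine Finset.mem_sdiff.2 ⟨?_, hzj⟩
      rcases hcl y hyX z hyz with h | hzi
      · exact h
      · exfalso
        obtain ⟨l, h2, h3⟩ := D.exists_edge_bag y z hyz
        obtain ⟨l', hl', hyl'⟩ := hall y hyX
        have hl : l ∈ B := hside y hyX l' l hyl' h2 hl'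
        exact hiB (D.mem_branch (fun h => hzj h.2) h3 hzi hl)
    have hW' : k + 2 ≤ ((X \ D.bag j) ∩ W).card := by
      have h1 : X ∩ W ⊆ ((X \ D.bag j) ∩ W) ∪ D.bag j := by
        intro w hw
        simp only [Finset.mem_union, Finset.mem_inter, Finset.mem_sdiff] at hw ⊢
        tauto
      have h2 := (Finset.card_le_card h1).trans (Finset.card_union_le _ _)
      have h3 := hk j
      omega
    by_cases heq : X \ D.bag j = X
    · rw [heq] at hcl' hW'
      refine ihd (D.tree.dist j a) (by omega) j a x rfl hxX hxa ?_ hcl' hW'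
      intro y hy
      rw [← heq] at hy
      exact (Finset.mem_sdiff.1 hy).2
    · have hpos : ((X \ D.bag j) ∩ W).Nonempty := Finset.card_pos.1 (by omega)
      obtain ⟨y, hy⟩ := hpos
      obtain ⟨b, hb⟩ := D.exists_mem_bag y
      refine ihm _ ?_ (X \ D.bag j) rfl _ j b y rfl (Finset.mem_inter.1 hy).1 hb
        (fun y hy => (Finset.mem_sdiff.1 hy).2) hcl' hW'
      rw [← hX]
      exact Finset.card_lt_card (lt_of_le_of_ne Finset.sdiff_subset heq)

-- The walk starts at an arbitrary node, with `X` the complement of its bag; this contains at least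
-- `3k + 5` vertices of `W`.
open Classical in
theorem TreeDecomposition.exists_separation {V ι : Type} [Fintype V] {G : SimpleGraph V}
    (D : TreeDecomposition G ι) {k : ℕ} (hk : ∀ i, (D.bag i).card ≤ k + 1) {W : Finset V}
    (hW : 4 * k + 6 ≤ W.card) : ∃ S X : Finset V, S.card ≤ k + 1 ∧ (∀ y ∈ X, y ∉ S) ∧
      (∀ y ∈ X, ∀ z, G.Adj y z → z ∈ X ∨ z ∈ S) ∧ k + 2 ≤ (X ∩ W).card ∧
      k + 2 ≤ (W \ (X ∪ S)).card := by
  obtain ⟨i⟩ := D.isTree.1.nonempty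
  have h1 : W ⊆ ((Finset.univ \ D.bag i) ∩ W) ∪ D.bag i := by
    intro w hw
    simp only [Finset.mem_union, Finset.mem_inter, Finset.mem_sdiff, Finset.mem_univ]
    tauto
  have h2 := (Finset.card_le_card h1).trans (Finset.card_union_le _ _)
  have h3 := hk i
  have h4 : k + 2 ≤ ((Finset.univ \ D.bag i) ∩ W).card := by omega
  obtain ⟨x, hx⟩ := Finset.card_pos.1 (show 0 < ((Finset.univ \ D.bag i) ∩ W).card by omega)
  obtain ⟨a, ha⟩ := D.exists_mem_bag x
  refine D.exists_separation_aux hk hW _ _ rfl _ i a x rfl (Finset.mem_inter.1 hx).1 ha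
    (fun y hy => (Finset.mem_sdiff.1 hy).2) ?_ h4
  intro y _ z _
  by_cases hz : z ∈ D.bag i
  · exact Or.inr hz
  · exact Or.inl (Finset.mem_sdiff.2 ⟨Finset.mem_univ z, hz⟩)

/-- The treewidth is attained. -/
theorem exists_treeDecomposition {V : Type} [Finite V] (G : SimpleGraph V) :
    ∃ (ι : Type) (_ : Finite ι) (D : TreeDecomposition G ι),
      ∀ i, (D.bag i).card ≤ treewidth G + 1 := by
  have := Fintype.ofFinite V
  -- An infimum in `ℕ` is attained only over a nonempty set; the tree with one node and the full
  -- vertex set as its bag provides a member.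
  refine Nat.sInf_mem (s := {w : ℕ | ∃ (ι : Type) (_ : Finite ι) (D : TreeDecomposition G ι),
    ∀ i, (D.bag i).card ≤ w + 1}) ⟨Fintype.card V, Unit, inferInstance, ?_, ?_⟩
  · refine ⟨⊥, ?_, fun _ => Finset.univ, ?_, ?_, ?_⟩
    · exact SimpleGraph.IsTree.of_subsingleton
    · exact fun v => ⟨(), Finset.mem_univ v⟩
    · exact fun u v _ => ⟨(), Finset.mem_univ u, Finset.mem_univ v⟩
    · intro v
      have : Nonempty {i : Unit | v ∈ (fun _ : Unit => (Finset.univ : Finset V)) i} :=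
        ⟨⟨(), Finset.mem_univ v⟩⟩
      exact (SimpleGraph.IsTree.of_subsingleton (G := SimpleGraph.induce _ _)).1
  · intro i
    exact (Finset.card_le_univ _).trans (Nat.le_succ _)

/-! ### Ordering the vertices -/

/-- The component of `v` in the graph `E` without `P`. -/
def comp (E : List (ℕ × ℕ)) (P : List ℕ) (v : ℕ) : List ℕ :=
  (reach (E.filter fun e => !memN e.1 P && !memN e.2 P) v).map fun q => q.1

/-- The vertices of `P` adjacent to `C`. -/
def bdry (E : List (ℕ × ℕ)) (P C : List ℕ) : List ℕ :=
  P.filter fun w => C.any fun u => memP (u, w) E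

/-- A list with a set of at most `k + 1` vertices that separates two large subsets of `W`, if there
is one. -/
def findSep (n : ℕ) (E : List (ℕ × ℕ)) (k pad : ℕ) (W : List ℕ) : List (List ℕ) :=
  (subl pad W).flatMap fun A => (subl pad W).flatMap fun B =>
    bif Nat.ble (k + 2) A.length && Nat.ble (k + 2) B.length then sep n E A B (k + 1) else []

/-- Put a separator of the component `C` of `v`, with boundary `W`, in front of `P`. -/
def extendBy (n : ℕ) (E : List (ℕ × ℕ)) (k pad : ℕ) (P : List ℕ) (v : ℕ) (C W : List ℕ) :
    Bool × List ℕ :=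
  bif Nat.ble (4 * k + 6) W.length then
    bif (findSep n E k pad W).isEmpty then (false, P)
    else (true, ((List.range n).filter fun u =>
      memN u C && memN u ((findSep n E k pad W).headD [])) ++ P)
  else (true, v :: P)

/-- Place some more vertices. -/
def placeStep (n : ℕ) (E : List (ℕ × ℕ)) (k pad : ℕ) (st : Bool × List ℕ) : Bool × List ℕ :=
  bif ((List.range n).filter fun v => !memN v st.2).isEmpty then st
  else
    (st.1 && (extendBy n E k pad st.2 (((List.range n).filter fun v => !memN v st.2).headD 0)
      (comp E st.2 (((List.range n).filter fun v => !memN v st.2).headD 0))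
      (bdry E st.2 (comp E st.2 (((List.range n).filter fun v => !memN v st.2).headD 0)))).1,
    (extendBy n E k pad st.2 (((List.range n).filter fun v => !memN v st.2).headD 0)
      (comp E st.2 (((List.range n).filter fun v => !memN v st.2).headD 0))
      (bdry E st.2 (comp E st.2 (((List.range n).filter fun v => !memN v st.2).headD 0)))).2)

/-- All vertices, the vertices to be eliminated last at the end; and whether it worked. -/
def place (n : ℕ) (E : List (ℕ × ℕ)) (k pad s t : ℕ) : Bool × List ℕ :=
  (placeStep n E k pad)^[n] (true, [s, t])

/-! ### Correctness of the vertex order -/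

/-- Adjacency outside `P`. -/
def AdjOff (E : List (ℕ × ℕ)) (P : List ℕ) (x y : ℕ) : Prop := (x, y) ∈ E ∧ x ∉ P ∧ y ∉ P

/-- `w` is a vertex of `P` adjacent to the component of `u` outside `P`. -/
def Touch (E : List (ℕ × ℕ)) (P : List ℕ) (u w : ℕ) : Prop :=
  w ∈ P ∧ ∃ x, ReflTransGen (AdjOff E P) u x ∧ (x, w) ∈ E

theorem mem_comp {E : List (ℕ × ℕ)} {P : List ℕ} {u v : ℕ} :
    u ∈ comp E P v ↔ ReflTransGen (AdjOff E P) v u := by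
  refine mem_reach_iff.trans ?_
  have : (fun x y => (x, y) ∈ E.filter fun e => !memN e.1 P && !memN e.2 P) = AdjOff E P := by
    funext x y
    simp only [AdjOff, List.mem_filter, Bool.and_eq_true, Bool.not_eq_true', ← Bool.not_eq_true,
      memN_iff]
  rw [this]

theorem mem_bdry {E : List (ℕ × ℕ)} {P : List ℕ} {v w : ℕ} :
    w ∈ bdry E P (comp E P v) ↔ Touch E P v w := by
  simp only [bdry, List.mem_filter, List.any_eq_true, memP_iff, Touch, mem_comp]

theorem AdjOff.not_mem {E : List (ℕ × ℕ)} {P : List ℕ} {u v : ℕ} (hu : u ∉ P)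
    (h : ReflTransGen (AdjOff E P) u v) : v ∉ P := by
  cases h with
  | refl => exact hu
  | tail _ h => exact h.2.2

theorem AdjOff.mono {E : List (ℕ × ℕ)} {P P' : List ℕ} (hP : P ⊆ P') {u v : ℕ}
    (h : ReflTransGen (AdjOff E P') u v) : ReflTransGen (AdjOff E P) u v :=
  ReflTransGen.mono (fun _ _ h => ⟨h.1, fun h' => h.2.1 (hP h'), fun h' => h.2.2 (hP h')⟩) _ _ h

theorem AdjOff.symm {E : List (ℕ × ℕ)} (hE : ∀ x y, (x, y) ∈ E → (y, x) ∈ E) {P : List ℕ} {u v : ℕ}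
    (h : ReflTransGen (AdjOff E P) u v) : ReflTransGen (AdjOff E P) v u := by
  induction h with
  | refl => exact .refl
  | tail _ h ih => exact .head ⟨hE _ _ h.1, h.2.2, h.2.1⟩ ih

/-- Components outside `P` have at most `b` neighbours. -/
def Bounded (E : List (ℕ × ℕ)) (P : List ℕ) (b : ℕ) : Prop :=
  ∀ u, u ∉ P → ∀ T : Finset ℕ, (∀ w ∈ T, Touch E P u w) → T.card ≤ b

/-- Eliminating the vertices of `P` in order, except for `s` and `t`, every vertex has at most `b`
neighbours when it is eliminated. -/
def GoodOrder (E : List (ℕ × ℕ)) (s t : ℕ) (P : List ℕ) (b : ℕ) : Prop :=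
  ∀ v rest, (v :: rest) <:+ P → v ≠ s → v ≠ t → ∀ T : Finset ℕ, (∀ w ∈ T, Touch E rest v w) →
    T.card ≤ b

/-- The invariant of the placement. -/
structure PlaceInv (n : ℕ) (E : List (ℕ × ℕ)) (k s t : ℕ) (P : List ℕ) : Prop where
  nodup : P.Nodup
  lt : ∀ v ∈ P, v < n
  bounded : Bounded E P (4 * k + 6)
  good : GoodOrder E s t P (5 * k + 7)
  suffix : [s, t] <:+ P

/-- A graph on the numbers below `n`, given by its symmetric list of edges. -/
structure IsGraph (n : ℕ) (E : List (ℕ × ℕ)) : Prop where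
  symm : ∀ x y, (x, y) ∈ E → (y, x) ∈ E
  lt : ∀ e ∈ E, e.2 < n

theorem PlaceInv.init {n : ℕ} {E : List (ℕ × ℕ)} {k s t : ℕ} (hs : s < n) (ht : t < n)
    (hst : s ≠ t) : PlaceInv n E k s t [s, t] where
  nodup := by simp [hst]
  lt := by simp [hs, ht]
  bounded := by
    intro u _ T hT
    have : T ⊆ {s, t} := fun w hw => by simpa using (hT w hw).1
    have := (Finset.card_le_card this).trans Finset.card_le_two
    omega
  good := by
    intro v rest h hvs hvt
    have : v ∈ [s, t] := h.subset List.mem_cons_self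
    simp [hvs, hvt] at this
  suffix := List.suffix_refl _

/-- A vertex of the chunk sees at most `4k + 6` vertices of `P`, because its component outside the
remaining vertices lies in a component outside `P`, and at most `k + 1` vertices of the chunk. -/
theorem PlaceInv.goodOrder_append {n : ℕ} {E : List (ℕ × ℕ)} {k s t : ℕ} {P chunk : List ℕ}
    (h : PlaceInv n E k s t P) (hch : ∀ u ∈ chunk, u ∉ P) (hcard : chunk.toFinset.card ≤ k + 1) :
    GoodOrder E s t (chunk ++ P) (5 * k + 7) := by
  intro v rest hsuf hvs hvt T hT
  obtain ⟨pre, hpre⟩ := hsuf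
  rcases List.append_eq_append_iff.1 hpre with ⟨c, hcs, hc⟩ | ⟨c, _, hc⟩
  · cases c with
    | nil =>
      exact h.good v rest (by rw [hc]; exact List.suffix_refl _) hvs hvt T hT
    | cons v' c =>
      rw [List.cons_append, List.cons.injEq] at hc
      obtain ⟨rfl, rfl⟩ := hc
      have hcs : (v :: c) <:+ chunk := ⟨pre, hcs.symm⟩
      have hvP : v ∉ P := hch v (hcs.subset List.mem_cons_self)
      have h1 : T.card ≤ (T.filter (· ∈ P)).card + chunk.toFinset.card := by
        refine le_trans (Finset.card_le_card ?_) (Finset.card_union_le _ _)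
        intro w hw
        rw [Finset.mem_union, Finset.mem_filter, List.mem_toFinset]
        rcases List.mem_append.1 (hT w hw).1 with h2 | h2
        · exact Or.inr (hcs.subset (List.mem_cons_of_mem _ h2))
        · exact Or.inl ⟨hw, h2⟩
      have h2 := h.bounded v hvP (T.filter (· ∈ P)) (by
        intro w hw
        obtain ⟨hw, hwP⟩ := Finset.mem_filter.1 hw
        obtain ⟨_, x, hx, hxw⟩ := hT w hw
        exact ⟨hwP, x, AdjOff.mono (List.subset_append_right _ _) hx, hxw⟩)
      omega
  · exact h.good v rest ⟨c, hc.symm⟩ hvs hvt T hT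

theorem touch_append {E : List (ℕ × ℕ)} {P chunk : List ℕ} {u w : ℕ}
    (h : Touch E (chunk ++ P) u w) :
    Touch E P u w ∨ (w ∈ chunk ∧ ∃ x, ReflTransGen (AdjOff E P) u x ∧ (x, w) ∈ E) := by
  obtain ⟨hw, x, hx, hxw⟩ := h
  have hx' := AdjOff.mono (List.subset_append_right chunk P) hx
  rcases List.mem_append.1 hw with h | h
  · exact Or.inr ⟨h, x, hx', hxw⟩
  · exact Or.inl ⟨h, x, hx', hxw⟩

/-- Only the component of `v` needs checking: another component outside `P` has no edge to the
chunk, so its boundary does not grow. -/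
theorem PlaceInv.append {n : ℕ} {E : List (ℕ × ℕ)} {k s t : ℕ} {P chunk : List ℕ} {v : ℕ}
    (h : PlaceInv n E k s t P) (hE : IsGraph n E) (hch : ∀ u ∈ chunk, u ∈ comp E P v) (hv : v ∉ P)
    (hnd : chunk.Nodup) (hlt : ∀ u ∈ chunk, u < n) (hcard : chunk.toFinset.card ≤ k + 1)
    (hb : ∀ u ∈ comp E P v, u ∉ chunk → ∀ T : Finset ℕ, (∀ w ∈ T, Touch E (chunk ++ P) u w) →
      T.card ≤ 4 * k + 6) : PlaceInv n E k s t (chunk ++ P) := by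
  have hchP : ∀ u ∈ chunk, u ∉ P := fun u hu => AdjOff.not_mem hv (mem_comp.1 (hch u hu))
  refine ⟨?_, ?_, ?_, h.goodOrder_append hchP hcard, h.suffix.trans (List.suffix_append _ _)⟩
  · exact List.Nodup.append hnd h.nodup fun u hu hu' => hchP u hu hu'
  · intro u hu
    rcases List.mem_append.1 hu with hu | hu
    · exact hlt u hu
    · exact h.lt u hu
  · intro u hu T hT
    by_cases huC : u ∈ comp E P v
    · exact hb u huC (fun h' => hu (List.mem_append_left _ h')) T hT
    · refine h.bounded u (fun h' => hu (List.mem_append_right _ h')) T fun w hw => ?_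
      rcases touch_append (hT w hw) with h1 | ⟨h1, x, hx, hxw⟩
      · exact h1
      · exfalso
        apply huC
        have h2 := mem_comp.1 (hch w h1)
        have h3 : AdjOff E P w x := by
          refine ⟨hE.symm _ _ hxw, hchP w h1, AdjOff.not_mem ?_ hx⟩
          exact fun h' => hu (List.mem_append_right _ h')
        exact mem_comp.2 ((h2.tail h3).trans (AdjOff.symm hE.symm hx))

theorem touch_of_mem_comp {E : List (ℕ × ℕ)} {P : List ℕ} {u v w : ℕ} (hu : u ∈ comp E P v)
    (h : Touch E P u w) : w ∈ bdry E P (comp E P v) := by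
  obtain ⟨hw, x, hx, hxw⟩ := h
  exact mem_bdry.2 ⟨hw, x, (mem_comp.1 hu).trans hx, hxw⟩

theorem PlaceInv.length_bdry_le {n : ℕ} {E : List (ℕ × ℕ)} {k s t : ℕ} {P : List ℕ} {v : ℕ}
    (h : PlaceInv n E k s t P) (hv : v ∉ P) : (bdry E P (comp E P v)).length ≤ 4 * k + 6 := by
  have hnd : (bdry E P (comp E P v)).Nodup := h.nodup.filter _
  rw [← List.toFinset_card_of_nodup hnd]
  exact h.bounded v hv _ fun w hw => mem_bdry.1 (List.mem_toFinset.1 hw)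

/-- A single new vertex enlarges a boundary by at most one; strictness of the bound leaves room for
it. -/
theorem PlaceInv.cons {n : ℕ} {E : List (ℕ × ℕ)} {k s t : ℕ} {P : List ℕ} {v : ℕ}
    (h : PlaceInv n E k s t P) (hE : IsGraph n E) (hv : v ∉ P) (hvn : v < n)
    (hlt : (bdry E P (comp E P v)).length < 4 * k + 6) : PlaceInv n E k s t (v :: P) := by
  refine h.append (chunk := [v]) hE ?_ hv (by simp) (by simpa using hvn) (by simp) ?_
  · intro u hu
    rw [List.mem_singleton] at hu
    subst hu
    exact mem_comp.2 .refl
  · intro u hu _ T hT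
    have h1 : T ⊆ insert v (bdry E P (comp E P v)).toFinset := by
      intro w hw
      rw [Finset.mem_insert, List.mem_toFinset]
      rcases touch_append (hT w hw) with h1 | ⟨h1, _⟩
      · exact Or.inr (touch_of_mem_comp hu h1)
      · exact Or.inl (List.mem_singleton.1 h1)
    have h2 := (Finset.card_le_card h1).trans (Finset.card_insert_le _ _)
    have h3 := List.toFinset_card_le (bdry E P (comp E P v))
    omega

/-- Two boundary vertices outside a separator are not touched by the same part. -/
theorem not_touch_of_sep {E : List (ℕ × ℕ)} (hE : ∀ x y, (x, y) ∈ E → (y, x) ∈ E)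
    {A B S Q : List ℕ}
    (hS : ∀ a ∈ A, a ∉ S → ∀ b, ReflTransGen (fun x y => (x, y) ∈ E ∧ y ∉ S) a b → b ∉ B)
    {u a b : ℕ} (hQ : ∀ x, ReflTransGen (AdjOff E Q) u x → x ∉ S) (ha : a ∈ A) (haS : a ∉ S)
    (hb : b ∈ B) (hbS : b ∉ S) (hua : Touch E Q u a) (hub : Touch E Q u b) : False := by
  obtain ⟨-, x, hx, hxa⟩ := hua
  obtain ⟨-, y, hy, hyb⟩ := hub
  have key : ∀ z z', ReflTransGen (AdjOff E Q) u z → ReflTransGen (AdjOff E Q) z z' →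
      ReflTransGen (fun x y => (x, y) ∈ E ∧ y ∉ S) z z' := by
    intro z z' hz h
    induction h with
    | refl => exact .refl
    | tail h1 h2 ih => exact ih.tail ⟨h2.1, hQ _ ((hz.trans h1).tail h2)⟩
  refine hS a ha haS b ?_ hb
  refine ReflTransGen.head ⟨hE _ _ hxa, hQ x hx⟩ (ReflTransGen.tail ?_ ⟨hyb, hbS⟩)
  exact key x y hx ((AdjOff.symm hE hx).trans hy)

/-- A part that avoids `S` cannot touch both `A \ S` and `B \ S`; let `D` be one of `A`, `B` for
which `D \ S` is untouched. The boundary gains at most `C` and loses `D \ S`. Since `C` and `D ∩ S`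
are disjoint subsets of `S`, their sizes add up to at most `k + 1`, less than the size of `D`, so
the loss outweighs the gain. -/
theorem card_touch_le {n : ℕ} {E : List (ℕ × ℕ)} (hE : IsGraph n E) {A B S Q : List ℕ}
    {k u : ℕ} {W C T : Finset ℕ} (hS : S.toFinset.card ≤ k + 1)
    (hS' : ∀ a ∈ A, a ∉ S → ∀ b, ReflTransGen (fun x y => (x, y) ∈ E ∧ y ∉ S) a b → b ∉ B)
    (hA : k + 2 ≤ A.toFinset.card) (hB : k + 2 ≤ B.toFinset.card) (hAW : A.toFinset ⊆ W)
    (hBW : B.toFinset ⊆ W) (hC : ∀ c ∈ C, c ∈ S ∧ c ∉ W)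
    (hQ : ∀ x, ReflTransGen (AdjOff E Q) u x → x ∉ S) (hT : ∀ w ∈ T, Touch E Q u w)
    (hTW : T ⊆ C ∪ W) : T.card ≤ W.card := by
  have key : ∀ D : Finset ℕ, D ⊆ W → k + 2 ≤ D.card → (∀ d ∈ D, d ∉ S → d ∉ T) →
      T.card ≤ W.card := by
    intro D hDW hD hDT
    have h1 : T ⊆ C ∪ (W \ (D \ S.toFinset)) := by
      intro w hw
      rw [Finset.mem_union, Finset.mem_sdiff, Finset.mem_sdiff, List.mem_toFinset]
      rcases Finset.mem_union.1 (hTW hw) with h | h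
      · exact Or.inl h
      · exact Or.inr ⟨h, fun h' => hDT w h'.1 h'.2 hw⟩
    have h2 := (Finset.card_le_card h1).trans (Finset.card_union_le _ _)
    have h3 := Finset.card_sdiff_add_card_eq_card (Finset.sdiff_subset.trans hDW :
      D \ S.toFinset ⊆ W)
    have h4 := Finset.card_sdiff_add_card_inter D S.toFinset
    have h5 : C.card + (D ∩ S.toFinset).card ≤ S.toFinset.card := by
      rw [← Finset.card_union_of_disjoint]
      · refine Finset.card_le_card (Finset.union_subset (fun c hc => ?_) Finset.inter_subset_right)
        exact List.mem_toFinset.2 (hC c hc).1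
      · rw [Finset.disjoint_left]
        intro c hc hc'
        exact (hC c hc).2 (hDW (Finset.mem_inter.1 hc').1)
    omega
  by_cases h : ∃ a ∈ A, a ∉ S ∧ a ∈ T
  · obtain ⟨a, ha, haS, haT⟩ := h
    refine key B.toFinset hBW hB fun b hb hbS hbT => ?_
    exact not_touch_of_sep hE.symm hS' hQ ha haS (List.mem_toFinset.1 hb) hbS (hT a haT) (hT b hbT)
  · refine key A.toFinset hAW hA fun a ha haS haT => h ⟨a, List.mem_toFinset.1 ha, haS, haT⟩

theorem mem_findSep {n : ℕ} {E : List (ℕ × ℕ)} {k pad : ℕ} {W S : List ℕ} :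
    S ∈ findSep n E k pad W ↔ ∃ A ∈ subl pad W, ∃ B ∈ subl pad W, k + 2 ≤ A.length ∧
      k + 2 ≤ B.length ∧ S ∈ sep n E A B (k + 1) := by
  simp only [findSep, List.mem_flatMap]
  refine exists_congr fun A => and_congr_right fun _ => exists_congr fun B =>
    and_congr_right fun _ => ?_
  cases h : Nat.ble (k + 2) A.length && Nat.ble (k + 2) B.length with
  | true =>
    rw [Bool.and_eq_true, Nat.ble_eq, Nat.ble_eq] at h
    simp [h]
  | false =>
    rw [← Bool.not_eq_true, Bool.and_eq_true, Nat.ble_eq, Nat.ble_eq] at h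
    simp only [cond_false, List.not_mem_nil, false_iff]
    tauto

theorem subl_spec {pad : ℕ} {W A : List ℕ} (hW : W.Nodup) (h : A ∈ subl pad W) :
    A.toFinset.card = A.length ∧ ∀ a ∈ A, a ∈ W := by
  have h1 := sublist_of_mem_subl h
  exact ⟨List.toFinset_card_of_nodup (List.nodup_reverse.1 (h1.nodup hW)),
    fun a ha => h1.subset (List.mem_reverse.2 ha)⟩

/-- The second claim is the progress: were `S` disjoint from the component of `v`, this component
would connect a vertex of `A \ S` to one of `B \ S`. Both exist because `S` is smaller than `A` and
`B`. -/
theorem PlaceInv.sep {n : ℕ} {E : List (ℕ × ℕ)} {k s t pad : ℕ} {P S : List ℕ} {v : ℕ}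
    (h : PlaceInv n E k s t P) (hE : IsGraph n E) (hv : v ∉ P) (hvn : v < n)
    (hS : S ∈ findSep n E k pad (bdry E P (comp E P v))) :
    PlaceInv n E k s t (((List.range n).filter fun u => memN u (comp E P v) && memN u S) ++ P) ∧
      ((List.range n).filter fun u => memN u (comp E P v) && memN u S) ≠ [] := by
  obtain ⟨A, hA, B, hB, hAl, hBl, hS⟩ := mem_findSep.1 hS
  have hnd : (bdry E P (comp E P v)).Nodup := h.nodup.filter _
  obtain ⟨hAc, hAW⟩ := subl_spec hnd hA
  obtain ⟨hBc, hBW⟩ := subl_spec hnd hB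
  have hWP : ∀ w ∈ bdry E P (comp E P v), w ∈ P := fun w hw => (List.mem_filter.1 hw).1
  obtain ⟨hS1, hS2⟩ := sep_sound (fun e he => hE.lt e he)
    (fun a ha => h.lt a (hWP a (hAW a ha))) hS
  have hClt : ∀ u ∈ comp E P v, u < n := by
    intro u hu
    cases mem_comp.1 hu with
    | refl => exact hvn
    | tail _ h => exact hE.lt _ h.1
  set chunk := (List.range n).filter fun u => memN u (comp E P v) && memN u S with hchunk
  have hmem : ∀ u, u ∈ chunk ↔ u ∈ comp E P v ∧ u ∈ S := by
    intro u
    simp only [hchunk, List.mem_filter, List.mem_range, Bool.and_eq_true, memN_iff]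
    exact ⟨fun h => h.2, fun h => ⟨hClt u h.1, h⟩⟩
  have hCP : ∀ u ∈ comp E P v, u ∉ P := fun u hu => AdjOff.not_mem hv (mem_comp.1 hu)
  constructor
  · refine h.append hE (fun u hu => ((hmem u).1 hu).1) hv (List.nodup_range.filter _)
      (fun u hu => hClt u ((hmem u).1 hu).1) ?_ ?_
    · refine (Finset.card_le_card ?_).trans hS1
      intro u hu
      exact List.mem_toFinset.2 ((hmem u).1 (List.mem_toFinset.1 hu)).2
    · intro u hu huch T hT
      refine (card_touch_le (T := T) (C := chunk.toFinset)
        (W := (bdry E P (comp E P v)).toFinset) hE hS1 hS2 (by omega) (by omega)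
        ?_ ?_ ?_ ?_ hT ?_).trans ?_
      · intro a ha
        exact List.mem_toFinset.2 (hAW a (List.mem_toFinset.1 ha))
      · intro a ha
        exact List.mem_toFinset.2 (hBW a (List.mem_toFinset.1 ha))
      · intro c hc
        have h1 := (hmem c).1 (List.mem_toFinset.1 hc)
        exact ⟨h1.2, fun h' => hCP c h1.1 (hWP c (List.mem_toFinset.1 h'))⟩
      · intro x hx hxS
        have h1 : x ∈ comp E P v := mem_comp.2 ((mem_comp.1 hu).trans
          (AdjOff.mono (List.subset_append_right _ _) hx))
        have h2 : x ∉ chunk ++ P := AdjOff.not_mem (fun h' => by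
          rcases List.mem_append.1 h' with h' | h'
          · exact huch h'
          · exact hCP u hu h') hx
        exact h2 (List.mem_append_left _ ((hmem x).2 ⟨h1, hxS⟩))
      · intro w hw
        rw [Finset.mem_union, List.mem_toFinset, List.mem_toFinset]
        rcases touch_append (hT w hw) with h1 | ⟨h1, _⟩
        · exact Or.inr (touch_of_mem_comp hu h1)
        · exact Or.inl h1
      · exact (List.toFinset_card_le _).trans (h.length_bdry_le hv)
  · intro hnil
    have hQ : ∀ x, ReflTransGen (AdjOff E P) v x → x ∉ S := by
      intro x hx hxS
      have := (hmem x).2 ⟨mem_comp.2 hx, hxS⟩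
      rw [hnil] at this
      simp at this
    have hex : ∀ D : List ℕ, k + 2 ≤ D.toFinset.card → ∃ d ∈ D, d ∉ S := by
      intro D hD
      by_contra hcon
      push Not at hcon
      have : D.toFinset ⊆ S.toFinset := fun d hd =>
        List.mem_toFinset.2 (hcon d (List.mem_toFinset.1 hd))
      have := Finset.card_le_card this
      omega
    obtain ⟨a, ha, haS⟩ := hex A (by omega)
    obtain ⟨b, hb, hbS⟩ := hex B (by omega)
    exact not_touch_of_sep hE.symm hS2 hQ ha haS hb hbS (mem_bdry.1 (hAW a ha))
      (mem_bdry.1 (hBW b hb))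

/-- Large sets have balanced separations with small separators. -/
def HasSeparations (n : ℕ) (E : List (ℕ × ℕ)) (k : ℕ) : Prop :=
  ∀ W : Finset ℕ, (∀ w ∈ W, w < n) → 4 * k + 6 ≤ W.card → ∃ S X : Finset ℕ, S.card ≤ k + 1 ∧
    (∀ y ∈ X, y ∉ S) ∧ (∀ y ∈ X, ∀ z, (y, z) ∈ E → z ∈ X ∨ z ∈ S) ∧ k + 2 ≤ (X ∩ W).card ∧
    k + 2 ≤ (W \ (X ∪ S)).card

/-- A balanced separation splits `W` into its parts inside `X` and outside `X ∪ S`. Both are among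
the listed sublists, and `S` separates them, so the flow computation for this pair succeeds. -/
theorem exists_mem_findSep {n : ℕ} {E : List (ℕ × ℕ)} {k pad : ℕ} {W : List ℕ}
    (hsep : HasSeparations n E k) (hWn : ∀ w ∈ W, w < n) (hnd : W.Nodup)
    (hlen : 4 * k + 6 ≤ W.length) (hpad : 2 ^ W.length ≤ pad) :
    ∃ S, S ∈ findSep n E k pad W := by
  obtain ⟨S, X, hS, hXS, hcl, h1, h2⟩ := hsep W.toFinset
    (fun w hw => hWn w (List.mem_toFinset.1 hw)) (by rwa [List.toFinset_card_of_nodup hnd])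
  have hcard : ∀ p : ℕ → Bool, ((W.filter p).reverse).length = (W.toFinset.filter (p · = true)).card
      := by
    intro p
    rw [List.length_reverse, ← List.toFinset_card_of_nodup (hnd.filter p)]
    congr 1
    ext x
    simp
  obtain ⟨T, hT⟩ := sep_complete (n := n) (E := E)
    (A := (W.filter fun w => decide (w ∈ X)).reverse)
    (B := (W.filter fun w => decide (w ∉ X ∧ w ∉ S)).reverse) hS (by
      intro a ha _ b hab hb
      simp only [List.mem_reverse, List.mem_filter, decide_eq_true_eq] at ha hb
      have : b ∈ X := by
        clear hb
        induction hab with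
        | refl => exact ha.2
        | tail _ h ih => exact (hcl _ ih _ h.1).resolve_right h.2
      exact hb.2.1 this)
  refine ⟨T, mem_findSep.2 ⟨_, filter_reverse_mem_subl hpad _, _, filter_reverse_mem_subl hpad _,
    ?_, ?_, hT⟩⟩
  · rw [hcard]
    refine h1.trans (Finset.card_le_card fun x hx => ?_)
    obtain ⟨hx1, hx2⟩ := Finset.mem_inter.1 hx
    exact Finset.mem_filter.2 ⟨hx2, by simpa using hx1⟩
  · rw [hcard]
    refine h2.trans (Finset.card_le_card fun x hx => ?_)
    obtain ⟨hx1, hx2⟩ := Finset.mem_sdiff.1 hx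
    exact Finset.mem_filter.2 ⟨hx1, by simpa using hx2⟩

/-- One placement step: it keeps the invariant and makes progress, or it fails, which does not
happen in graphs with separations. -/
theorem placeStep_spec {n : ℕ} {E : List (ℕ × ℕ)} {k pad s t : ℕ} {P : List ℕ}
    (hE : IsGraph n E) (h : PlaceInv n E k s t P) :
    (((placeStep n E k pad (true, P)).1 = true →
      PlaceInv n E k s t (placeStep n E k pad (true, P)).2 ∧
        ((∀ v < n, v ∈ (placeStep n E k pad (true, P)).2) ∨
          P.length < (placeStep n E k pad (true, P)).2.length)) ∧
      (HasSeparations n E k → 2 ^ (4 * k + 6) ≤ pad → (placeStep n E k pad (true, P)).1 = true)) := by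
  unfold placeStep
  simp only
  cases hU : (List.range n).filter fun v => !memN v P with
  | nil =>
    simp only [List.isEmpty_nil, cond_true, true_implies, implies_true, and_true]
    refine ⟨h, Or.inl fun v hv => ?_⟩
    rw [List.filter_eq_nil_iff] at hU
    have := hU v (List.mem_range.2 hv)
    simpa using this
  | cons v U =>
    have hvU : v ∈ (List.range n).filter fun v => !memN v P := by rw [hU]; simp
    simp only [List.mem_filter, List.mem_range, Bool.not_eq_true', ← Bool.not_eq_true,
      memN_iff] at hvU
    obtain ⟨hvn, hv⟩ := hvU
    simp only [List.isEmpty_cons, cond_false, List.headD_cons, Bool.true_and]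
    unfold extendBy
    cases hble : Nat.ble (4 * k + 6) (bdry E P (comp E P v)).length with
    | false =>
      simp only [cond_false, true_implies, implies_true, and_true]
      refine ⟨h.cons hE hv hvn ?_, Or.inr (by simp)⟩
      by_contra hcon
      rw [Nat.ble_eq_true_of_le (by omega)] at hble
      exact absurd hble (by simp)
    | true =>
      have hble' := Nat.le_of_ble_eq_true hble
      simp only [cond_true]
      cases hf : findSep n E k pad (bdry E P (comp E P v)) with
      | nil =>
        simp only [List.isEmpty_nil, cond_true, Bool.false_eq_true, false_implies, true_and]
        intro hsep hpad
        have hlen := h.length_bdry_le hv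
        obtain ⟨S, hS⟩ := exists_mem_findSep hsep
          (fun w hw => h.lt w (List.mem_filter.1 hw).1) (h.nodup.filter _) hble'
          ((Nat.pow_le_pow_right (by norm_num) hlen).trans hpad)
        have hS' : S ∈ findSep n E k pad (bdry E P (comp E P v)) := hS
        rw [hf] at hS'
        simp at hS'
      | cons S Ss =>
        simp only [List.isEmpty_cons, cond_false, List.headD_cons, true_implies, implies_true,
          and_true]
        obtain ⟨h1, h2⟩ := h.sep (S := S) (pad := pad) hE hv hvn (by rw [hf]; simp)
        refine ⟨h1, Or.inr ?_⟩
        rw [List.length_append]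
        have := List.length_pos_iff.2 h2
        omega

theorem placeStep_fst_of_false {n : ℕ} {E : List (ℕ × ℕ)} {k pad : ℕ} {P : List ℕ} :
    (placeStep n E k pad (false, P)).1 = false := by
  unfold placeStep
  cases List.isEmpty _ <;> simp

theorem PlaceInv.length_le {n : ℕ} {E : List (ℕ × ℕ)} {k s t : ℕ} {P : List ℕ}
    (h : PlaceInv n E k s t P) : P.length ≤ n := by
  have := (h.nodup.subperm (l₂ := List.range n) fun v hv => List.mem_range.2 (h.lt v hv)).length_le
  simpa using this

theorem place_spec {n : ℕ} {E : List (ℕ × ℕ)} {k pad s t : ℕ} (hE : IsGraph n E) (hs : s < n)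
    (ht : t < n) (hst : s ≠ t) :
    ((place n E k pad s t).1 = true → PlaceInv n E k s t (place n E k pad s t).2 ∧
      ∀ v < n, v ∈ (place n E k pad s t).2) ∧
    (HasSeparations n E k → 2 ^ (4 * k + 6) ≤ pad → (place n E k pad s t).1 = true) := by
  have key : ∀ i, (((placeStep n E k pad)^[i] (true, [s, t])).1 = true →
      PlaceInv n E k s t ((placeStep n E k pad)^[i] (true, [s, t])).2 ∧
      ((∀ v < n, v ∈ ((placeStep n E k pad)^[i] (true, [s, t])).2) ∨
        i + 2 ≤ ((placeStep n E k pad)^[i] (true, [s, t])).2.length)) ∧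
    (HasSeparations n E k → 2 ^ (4 * k + 6) ≤ pad →
      ((placeStep n E k pad)^[i] (true, [s, t])).1 = true) := by
    intro i
    induction i with
    | zero =>
      exact ⟨fun _ => ⟨PlaceInv.init hs ht hst, Or.inr (by simp)⟩, fun _ _ => rfl⟩
    | succ i ih =>
      rw [Function.iterate_succ_apply']
      generalize (placeStep n E k pad)^[i] (true, [s, t]) = st at ih ⊢
      obtain ⟨b, P⟩ := st
      cases b with
      | false =>
        refine ⟨fun h => ?_, fun h1 h2 => absurd (ih.2 h1 h2) (by simp)⟩
        rw [placeStep_fst_of_false] at h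
        exact absurd h (by simp)
      | true =>
        obtain ⟨h1, h2⟩ := ih.1 rfl
        simp only at h1 h2
        obtain ⟨h3, h4⟩ := placeStep_spec (pad := pad) hE h1
        refine ⟨fun h => ?_, h4⟩
        obtain ⟨h5, h6⟩ := h3 h
        refine ⟨h5, ?_⟩
        rcases h6 with h6 | h6
        · exact Or.inl h6
        · rcases h2 with h2 | h2
          · left
            have : (List.range n).filter (fun v => !memN v P) = [] := by
              rw [List.filter_eq_nil_iff]
              intro v hv
              simpa using h2 v (List.mem_range.1 hv)
            have h7 : placeStep n E k pad (true, P) = (true, P) := by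
              unfold placeStep; simp only [this, List.isEmpty_nil, cond_true]
            rw [h7]; exact h2
          · right; omega
  refine ⟨fun h => ?_, (key n).2⟩
  obtain ⟨h1, h2⟩ := (key n).1 h
  -- The list starts with two vertices and gains at least one per step; after `n` steps without
  -- completion it would hold more than `n` distinct numbers below `n`.
  refine ⟨h1, h2.resolve_right fun h3 => ?_⟩
  have := h1.length_le
  omega

/-! ### The vertex order takes polynomial time -/

@[fun_prop]
theorem PolyF.comp_list {E : α → List (ℕ × ℕ)} {P : α → List ℕ} {v : α → ℕ} (hE : PolyF E)
    (hP : PolyF P) (hv : PolyF v) : PolyF (fun a => StBond.comp (E a) (P a) (v a)) := by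
  unfold StBond.comp; fun_prop

@[fun_prop]
theorem PolyF.bdry {E : α → List (ℕ × ℕ)} {P C : α → List ℕ} (hE : PolyF E)
    (hP : PolyF P) (hC : PolyF C) : PolyF (fun a => bdry (E a) (P a) (C a)) := by
  unfold StBond.bdry; fun_prop

@[fun_prop]
theorem PolyF.findSep {n : α → ℕ} {E : α → List (ℕ × ℕ)} {k pad : α → ℕ} {W : α → List ℕ}
    (hn : PolyF n) (hE : PolyF E) (hk : PolyF k) (hpad : PolyF pad) (hW : PolyF W) :
    PolyF (fun a => findSep (n a) (E a) (k a) (pad a) (W a)) := by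
  unfold StBond.findSep; fun_prop

@[fun_prop]
theorem PolyF.extendBy {n : α → ℕ} {E : α → List (ℕ × ℕ)} {k pad v : α → ℕ} {P C W : α → List ℕ}
    (hn : PolyF n) (hE : PolyF E) (hk : PolyF k) (hpad : PolyF pad) (hP : PolyF P) (hv : PolyF v)
    (hC : PolyF C) (hW : PolyF W) :
    PolyF (fun a => extendBy (n a) (E a) (k a) (pad a) (P a) (v a) (C a) (W a)) := by
  unfold StBond.extendBy; fun_prop

@[fun_prop]
theorem PolyF.placeStep {n : α → ℕ} {E : α → List (ℕ × ℕ)} {k pad : α → ℕ}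
    {st : α → Bool × List ℕ} (hn : PolyF n) (hE : PolyF E) (hk : PolyF k) (hpad : PolyF pad)
    (hst : PolyF st) : PolyF (fun a => placeStep (n a) (E a) (k a) (pad a) (st a)) := by
  unfold StBond.placeStep; fun_prop

theorem sz_extendBy_le (n : ℕ) (E : List (ℕ × ℕ)) (k pad : ℕ) (P : List ℕ) (v : ℕ) (C W : List ℕ) :
    sz (extendBy n E k pad P v C W).2 ≤ sz P + (sz (List.range n) + sz v + 1) := by
  unfold extendBy
  cases Nat.ble (4 * k + 6) W.length
  · simp only [cond_false, sz_cons]; omega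
  · cases (findSep n E k pad W).isEmpty
    · simp only [cond_true, cond_false]
      have h1 := sz_append ((List.range n).filter fun u =>
        memN u C && memN u ((findSep n E k pad W).headD [])) P
      have h2 := sz_le_of_sublist ((List.filter_sublist (l := List.range n)
        (p := fun u => memN u C && memN u ((findSep n E k pad W).headD []))))
      omega
    · simp only [cond_true]; omega

@[fun_prop]
theorem PolyF.place {n : α → ℕ} {E : α → List (ℕ × ℕ)} {k pad s t : α → ℕ}
    (hn : PolyF n) (hE : PolyF E) (hk : PolyF k) (hpad : PolyF pad) (hs : PolyF s) (ht : PolyF t) :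
    PolyF (fun a => place (n a) (E a) (k a) (pad a) (s a) (t a)) := by
  unfold StBond.place
  have hr : PolyF (fun a => List.range (n a)) := by fun_prop
  refine iterate_of_growth (s := fun a st => StBond.placeStep (n a) (E a) (k a) (pad a) st)
    (by fun_prop) (by fun_prop) hn (fun a => 3 + (sz (List.range (n a)) + sz (n a) + 1))
    ((PB.const 3).add ((hr.1.add hn.1).add (PB.const 1))) ?_
  intro a st
  unfold StBond.placeStep
  cases hU : (List.range (n a)).filter fun v => !StBond.memN v st.2 with
  | nil => simp
  | cons v U =>
    have hv : v ∈ (List.range (n a)).filter fun v => !StBond.memN v st.2 := by rw [hU]; simp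
    have hvn := List.mem_range.1 (List.mem_filter.1 hv).1
    simp only [List.isEmpty_cons, cond_false, List.headD_cons, sz_mk]
    have h1 := sz_extendBy_le (n a) (E a) (k a) (pad a) st.2 v (StBond.comp (E a) st.2 v)
      (StBond.bdry (E a) st.2 (StBond.comp (E a) st.2 v))
    have h2 := sz_bool_le (st.1 && (StBond.extendBy (n a) (E a) (k a) (pad a) st.2 v
      (StBond.comp (E a) st.2 v) (StBond.bdry (E a) st.2 (StBond.comp (E a) st.2 v))).1)
    have h3 := sz_prod st
    simp only [sz_nat] at *
    omega

/-! ### Bucket elimination -/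

/-- A partial solution on a set of vertices: a relation, and a number of cut edges. Pairs of
different vertices are connected on their side of the cut; a pair `(u, u)` means that `u` is on the
side of the source. -/
abbrev Entry : Type := List (ℕ × ℕ) × ℕ

/-- A set of vertices, with partial solutions on it. -/
abbrev Factor : Type := List ℕ × List Entry

/-- All pairs of elements. -/
def prodPairs (W : List ℕ) : List (ℕ × ℕ) := W.flatMap fun a => W.map fun b => (a, b)

/-- All possible entries on `W`, up to the order in the relation. -/
def cands (pad cap : ℕ) (W : List ℕ) : List Entry :=
  (subl pad (prodPairs W)).flatMap fun K => (List.range (cap + 1)).map fun c => (K, c)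

/-- Entries on `W₁` and `W₂` with the relations `K₁` and `K₂` agree on the sides. -/
def compat (W₁ W₂ : List ℕ) (K₁ K₂ : List (ℕ × ℕ)) : Bool :=
  W₁.all fun u => !memN u W₂ || bif memP (u, u) K₁ then memP (u, u) K₂ else !memP (u, u) K₂

/-- The combination of two factors on the scope `W`. -/
def joinOn (pad cap : ℕ) (W : List ℕ) (f g : Factor) : Factor :=
  (W, (cands pad cap W).filter fun x => f.2.any fun e => g.2.any fun d =>
    compat f.1 g.1 e.1 d.1 && (sameSet x.1 (e.1 ++ d.1) && Nat.beq x.2 (min (e.2 + d.2) cap)))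

/-- The combination of two factors. -/
def joinF (n pad cap : ℕ) (f g : Factor) : Factor :=
  joinOn pad cap ((List.range n).filter fun u => memN u f.1 || memN u g.1) f g

/-- Remove `v` from a relation and connect its neighbours. -/
def elimRel (v : ℕ) (K : List (ℕ × ℕ)) : List (ℕ × ℕ) :=
  (K.filter fun x => !Nat.beq x.1 v && !Nat.beq x.2 v) ++
    K.flatMap fun x => (K.filter fun y => (Nat.beq x.2 v && Nat.beq y.1 v) &&
      (!Nat.beq x.1 y.2 && (!Nat.beq x.1 v && !Nat.beq y.2 v))).map fun y => (x.1, y.2)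

/-- The vertex `v` is related to another vertex. -/
def hasNbr (v : ℕ) (K : List (ℕ × ℕ)) : Bool := K.any fun x => Nat.beq x.1 v && !Nat.beq x.2 v

/-- The projection of a factor to the scope `W`, without `v`. -/
def forgetOn (pad cap v : ℕ) (W : List ℕ) (f : Factor) : Factor :=
  (W, (cands pad cap W).filter fun x => f.2.any fun e =>
    hasNbr v e.1 && (sameSet x.1 (elimRel v e.1) && Nat.beq x.2 e.2))

/-- Eliminate `v` from a factor. -/
def forgetF (n pad cap v : ℕ) (f : Factor) : Factor :=
  forgetOn pad cap v ((List.range n).filter fun u => memN u f.1 && !Nat.beq u v) f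

/-- Both sides for `v`. -/
def seed (v : ℕ) : Factor := ([v], [([], 0), ([(v, v)], 0)])

/-- The terminals are on different sides. -/
def seedST (s t : ℕ) : Factor := ([s, t], [([(s, s)], 0)])

/-- Combine all factors of a list. -/
def joinAll (n pad cap : ℕ) (f : Factor) (J : List Factor) : Factor :=
  J.foldl (fun f g => joinF n pad cap f g) f

/-- Eliminate the vertex `v`. -/
def elimStep (n pad cap : ℕ) (Fs : List Factor) (v : ℕ) : List Factor :=
  forgetF n pad cap v (joinAll n pad cap (seed v) (Fs.filter fun f => memN v f.1)) ::
    Fs.filter fun f => !memN v f.1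

/-- Eliminate the vertices of `L`. -/
def elimAll (n pad cap : ℕ) (Fs : List Factor) (L : List ℕ) : List Factor :=
  L.foldl (fun Fs v => elimStep n pad cap Fs v) Fs

/-- Some entry separates the terminals and has `cap` cut edges. -/
def finalTest (cap s t : ℕ) (f : Factor) : Bool :=
  f.2.any fun e => memP (s, s) e.1 && (!memP (t, t) e.1 && Nat.ble cap e.2)

/-! ### Correctness of bucket elimination -/

/-- The entry `e` of `f` has the sides `σ`. -/
def Agree (σ : ℕ → Prop) (f : Factor) (e : Entry) : Prop :=
  e ∈ f.2 ∧ ∀ u ∈ f.1, σ u ↔ (u, u) ∈ e.1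

/-- The union of the relations of the entries. -/
def Linked (es : List Entry) (x y : ℕ) : Prop := ∃ e ∈ es, (x, y) ∈ e.1

/-- The factors have a common solution on the vertices `P` with at least `cap` cut edges. -/
def Feas (s t cap : ℕ) (P : List ℕ) (Fs : List Factor) : Prop :=
  ∃ (σ : ℕ → Prop) (es : List Entry), List.Forall₂ (Agree σ) Fs es ∧ σ s ∧ ¬σ t ∧
    (∀ u ∈ P, ReflTransGen (Linked es) u s ∨ ReflTransGen (Linked es) u t) ∧
    cap ≤ (es.map Prod.snd).sum

/-- Scopes consist of numbers below `n`; entries live on the scope. -/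
structure WF (n cap : ℕ) (f : Factor) : Prop where
  lt : ∀ u ∈ f.1, u < n
  le : ∀ e ∈ f.2, e.2 ≤ cap
  mem : ∀ e ∈ f.2, ∀ x ∈ e.1, x.1 ∈ f.1 ∧ x.2 ∈ f.1

theorem mem_prodPairs {W : List ℕ} {x : ℕ × ℕ} : x ∈ prodPairs W ↔ x.1 ∈ W ∧ x.2 ∈ W := by
  obtain ⟨a, b⟩ := x
  simp [prodPairs]

theorem length_prodPairs (W : List ℕ) : (prodPairs W).length = W.length * W.length := by
  simp [prodPairs, List.length_flatMap]

theorem mem_of_mem_cands {pad cap : ℕ} {W : List ℕ} {x : Entry} (h : x ∈ cands pad cap W) :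
    x.2 ≤ cap ∧ ∀ y ∈ x.1, y.1 ∈ W ∧ y.2 ∈ W := by
  simp only [cands, List.mem_flatMap, List.mem_map, List.mem_range] at h
  obtain ⟨K, hK, c, hc, rfl⟩ := h
  refine ⟨by simp only; omega, fun y hy => mem_prodPairs.1 ?_⟩
  exact (sublist_of_mem_subl hK).subset (List.mem_reverse.2 hy)

/-- Relations are represented by lists in a fixed order. A computed relation is found among the
candidates only up to order and repetition, which is why joins and projections compare with
`sameSet`. -/
theorem exists_mem_cands {pad cap : ℕ} {W : List ℕ} (hW : 2 ^ (W.length * W.length) ≤ pad)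
    {L : List (ℕ × ℕ)} (hL : ∀ y ∈ L, y.1 ∈ W ∧ y.2 ∈ W) {c : ℕ} (hc : c ≤ cap) :
    ∃ K, (K, c) ∈ cands pad cap W ∧ ∀ y, y ∈ K ↔ y ∈ L := by
  refine ⟨((prodPairs W).filter fun y => memP y L).reverse, ?_, fun y => ?_⟩
  · simp only [cands, List.mem_flatMap, List.mem_map, List.mem_range]
    exact ⟨_, filter_reverse_mem_subl (by rwa [length_prodPairs]) _, c, by omega, rfl⟩
  · rw [List.mem_reverse, List.mem_filter, memP_iff, mem_prodPairs]
    exact ⟨fun h => h.2, fun h => ⟨hL y h, h⟩⟩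

theorem compat_iff {W₁ W₂ : List ℕ} {K₁ K₂ : List (ℕ × ℕ)} :
    compat W₁ W₂ K₁ K₂ = true ↔ ∀ u ∈ W₁, u ∈ W₂ → ((u, u) ∈ K₁ ↔ (u, u) ∈ K₂) := by
  simp only [compat, List.all_eq_true, Bool.or_eq_true, Bool.not_eq_true', ← Bool.not_eq_true,
    memN_iff]
  refine forall₂_congr fun u _ => ?_
  rw [imp_iff_not_or]
  refine or_congr_right ?_
  rw [← memP_iff, ← memP_iff]
  cases memP (u, u) K₁ <;> cases memP (u, u) K₂ <;> simp

theorem mem_joinF {n pad cap : ℕ} {f g : Factor} {x : Entry} :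
    x ∈ (joinF n pad cap f g).2 ↔ x ∈ cands pad cap (joinF n pad cap f g).1 ∧
      ∃ e ∈ f.2, ∃ d ∈ g.2, (∀ u ∈ f.1, u ∈ g.1 → ((u, u) ∈ e.1 ↔ (u, u) ∈ d.1)) ∧
        (∀ y, y ∈ x.1 ↔ y ∈ e.1 ∨ y ∈ d.1) ∧ x.2 = min (e.2 + d.2) cap := by
  simp only [joinF, joinOn, List.mem_filter, List.any_eq_true, Bool.and_eq_true, compat_iff,
    sameSet_iff, Nat.beq_eq, List.mem_append]

theorem mem_joinF_fst {n pad cap : ℕ} {f g : Factor} {u : ℕ} :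
    u ∈ (joinF n pad cap f g).1 ↔ u < n ∧ (u ∈ f.1 ∨ u ∈ g.1) := by
  simp only [joinF, joinOn, List.mem_filter, List.mem_range, Bool.or_eq_true, memN_iff]

theorem mem_elimRel {v : ℕ} {K : List (ℕ × ℕ)} {a b : ℕ} :
    (a, b) ∈ elimRel v K ↔ ((a, b) ∈ K ∨ (a ≠ b ∧ (a, v) ∈ K ∧ (v, b) ∈ K)) ∧ a ≠ v ∧ b ≠ v := by
  simp only [elimRel, List.mem_append, List.mem_filter, List.mem_flatMap, List.mem_map,
    Bool.and_eq_true, Bool.not_eq_true', ← Bool.not_eq_true, Nat.beq_eq, Prod.exists,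
    Prod.mk.injEq]
  constructor
  · rintro (⟨h, h1, h2⟩ | ⟨a', b', h, a'', b'', ⟨h1, ⟨rfl, rfl⟩, h3, h4, h5⟩, rfl, rfl⟩)
    · exact ⟨Or.inl h, h1, h2⟩
    · exact ⟨Or.inr ⟨h3, h, h1⟩, h4, h5⟩
  · rintro ⟨h | ⟨h1, h2, h3⟩, h4, h5⟩
    · exact Or.inl ⟨h, h4, h5⟩
    · exact Or.inr ⟨a, v, h2, v, b, ⟨h3, ⟨rfl, rfl⟩, h1, h4, h5⟩, rfl, rfl⟩

theorem hasNbr_iff {v : ℕ} {K : List (ℕ × ℕ)} : hasNbr v K = true ↔ ∃ b, b ≠ v ∧ (v, b) ∈ K := by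
  simp only [hasNbr, List.any_eq_true, Bool.and_eq_true, Bool.not_eq_true', ← Bool.not_eq_true,
    Nat.beq_eq, Prod.exists]
  constructor
  · rintro ⟨a, b, h, rfl, h2⟩; exact ⟨b, h2, h⟩
  · rintro ⟨b, h1, h2⟩; exact ⟨v, b, h2, rfl, h1⟩

theorem mem_forgetF {n pad cap v : ℕ} {f : Factor} {x : Entry} :
    x ∈ (forgetF n pad cap v f).2 ↔ x ∈ cands pad cap (forgetF n pad cap v f).1 ∧
      ∃ e ∈ f.2, (∃ b, b ≠ v ∧ (v, b) ∈ e.1) ∧ (∀ y, y ∈ x.1 ↔ y ∈ elimRel v e.1) ∧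
        x.2 = e.2 := by
  simp only [forgetF, forgetOn, List.mem_filter, List.any_eq_true, Bool.and_eq_true, hasNbr_iff,
    sameSet_iff, Nat.beq_eq]

theorem mem_forgetF_fst {n pad cap v : ℕ} {f : Factor} {u : ℕ} :
    u ∈ (forgetF n pad cap v f).1 ↔ u < n ∧ u ∈ f.1 ∧ u ≠ v := by
  simp only [forgetF, forgetOn, List.mem_filter, List.mem_range, Bool.and_eq_true, memN_iff,
    Bool.not_eq_true', ← Bool.not_eq_true, Nat.beq_eq, ne_eq]

theorem wf_joinF {n pad cap : ℕ} {f g : Factor} : WF n cap (joinF n pad cap f g) where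
  lt _ hu := (mem_joinF_fst.1 hu).1
  le _ he := (mem_of_mem_cands (mem_joinF.1 he).1).1
  mem _ he := (mem_of_mem_cands (mem_joinF.1 he).1).2

theorem wf_forgetF {n pad cap v : ℕ} {f : Factor} : WF n cap (forgetF n pad cap v f) where
  lt _ hu := (mem_forgetF_fst.1 hu).1
  le _ he := (mem_of_mem_cands (mem_forgetF.1 he).1).1
  mem _ he := (mem_of_mem_cands (mem_forgetF.1 he).1).2

theorem wf_seed {n cap v : ℕ} (hv : v < n) : WF n cap (seed v) where
  lt := by simp [seed, hv]
  le := by simp [seed]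
  mem := by simp [seed]

theorem wf_seedST {n cap s t : ℕ} (hs : s < n) (ht : t < n) : WF n cap (seedST s t) where
  lt := by simp [seedST, hs, ht]
  le := by simp [seedST]
  mem := by simp [seedST]

theorem reflTransGen_of_step {r r' : ℕ → ℕ → Prop} (h : ∀ x y, r x y → ReflTransGen r' x y)
    {u w : ℕ} (huw : ReflTransGen r u w) : ReflTransGen r' u w := by
  induction huw with
  | refl => exact .refl
  | tail _ hb ih => exact ih.trans (h _ _ hb)

theorem Feas.perm {s t cap : ℕ} {P : List ℕ} {Fs Gs : List Factor} (hp : Fs.Perm Gs)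
    (h : Feas s t cap P Fs) : Feas s t cap P Gs := by
  obtain ⟨σ, es, h1, h2, h3, h4, h5⟩ := h
  have h6 : Relation.Comp List.Perm (List.Forall₂ (Agree σ)) Gs es := ⟨Fs, hp.symm, h1⟩
  rw [← List.forall₂_comp_perm_eq_perm_comp_forall₂] at h6
  obtain ⟨es', h7, h8⟩ := h6
  refine ⟨σ, es', h7, h2, h3, fun u hu => ?_, ?_⟩
  · have : Linked es' = Linked es := by
      funext x y
      simp only [Linked, h8.mem_iff]
    rw [this]; exact h4 u hu
  · rw [(h8.map _).sum_eq]; exact h5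

theorem feas_perm {s t cap : ℕ} {P : List ℕ} {Fs Gs : List Factor} (hp : Fs.Perm Gs) :
    Feas s t cap P Fs ↔ Feas s t cap P Gs := ⟨Feas.perm hp, Feas.perm hp.symm⟩

/-- The union of the relations leaves `Linked` unchanged, and truncating a partial sum at `cap` does
not affect whether the total reaches `cap`. Well-formedness ensures that a side mark in one relation
concerns a vertex of its own scope, so agreement on common vertices makes the marks of the union
correct. -/
theorem feas_joinF {n pad cap s t : ℕ} {P : List ℕ} {f g : Factor} {Fs : List Factor}
    (hf : WF n cap f) (hg : WF n cap g)
    (hpad : 2 ^ ((joinF n pad cap f g).1.length * (joinF n pad cap f g).1.length) ≤ pad) :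
    Feas s t cap P (f :: g :: Fs) ↔ Feas s t cap P (joinF n pad cap f g :: Fs) := by
  have hlink : ∀ (x e d : Entry) (es : List Entry), (∀ y, y ∈ x.1 ↔ y ∈ e.1 ∨ y ∈ d.1) →
      Linked (x :: es) = Linked (e :: d :: es) := by
    intro x e d es h
    funext a b
    simp only [Linked, List.mem_cons, exists_eq_or_imp, h]
    rw [or_assoc]
  constructor
  · rintro ⟨σ, es, h1, h2, h3, h4, h5⟩
    cases h1 with
    | @cons _ e _ es he h1 =>
    cases h1 with
    | @cons _ d _ es hd h1 =>
    obtain ⟨he, heσ⟩ := he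
    obtain ⟨hd, hdσ⟩ := hd
    obtain ⟨K, hK, hKm⟩ := exists_mem_cands (c := min (e.2 + d.2) cap) (L := e.1 ++ d.1) hpad (by
      intro y hy
      rcases List.mem_append.1 hy with hy | hy
      · have h := hf.mem e he y hy
        exact ⟨mem_joinF_fst.2 ⟨hf.lt _ h.1, Or.inl h.1⟩,
          mem_joinF_fst.2 ⟨hf.lt _ h.2, Or.inl h.2⟩⟩
      · have h := hg.mem d hd y hy
        exact ⟨mem_joinF_fst.2 ⟨hg.lt _ h.1, Or.inr h.1⟩,
          mem_joinF_fst.2 ⟨hg.lt _ h.2, Or.inr h.2⟩⟩) (min_le_right _ _)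
    have hKm' : ∀ y, y ∈ (K, min (e.2 + d.2) cap).1 ↔ y ∈ e.1 ∨ y ∈ d.1 := fun y => by
      rw [hKm, List.mem_append]
    refine ⟨σ, (K, min (e.2 + d.2) cap) :: es, List.Forall₂.cons ⟨mem_joinF.2 ⟨hK, e, he, d, hd,
      fun u hu hu' => (heσ u hu).symm.trans (hdσ u hu'), hKm', rfl⟩, ?_⟩ h1, h2, h3, ?_, ?_⟩
    · intro u hu
      rw [hKm']
      obtain ⟨_, hu | hu⟩ := mem_joinF_fst.1 hu
      · exact ⟨fun h => Or.inl ((heσ u hu).1 h), fun h => h.elim (heσ u hu).2 fun h =>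
          (hdσ u (hg.mem d hd _ h).1).2 h⟩
      · exact ⟨fun h => Or.inr ((hdσ u hu).1 h), fun h => h.elim (fun h =>
          (heσ u (hf.mem e he _ h).1).2 h) (hdσ u hu).2⟩
    · rw [hlink _ e d es hKm']; exact h4
    · simp only [List.map_cons, List.sum_cons] at h5 ⊢
      omega
  · rintro ⟨σ, es, h1, h2, h3, h4, h5⟩
    cases h1 with
    | @cons _ x _ es hx h1 =>
    obtain ⟨hx, hxσ⟩ := hx
    obtain ⟨_, e, he, d, hd, hcomp, hxm, hx2⟩ := mem_joinF.1 hx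
    refine ⟨σ, e :: d :: es, List.Forall₂.cons ⟨he, fun u hu => ?_⟩
      (List.Forall₂.cons ⟨hd, fun u hu => ?_⟩ h1), h2, h3, ?_, ?_⟩
    · rw [hxσ u (mem_joinF_fst.2 ⟨hf.lt u hu, Or.inl hu⟩), hxm]
      exact ⟨fun h => h.elim id fun h => (hcomp u hu (hg.mem d hd _ h).1).2 h, Or.inl⟩
    · rw [hxσ u (mem_joinF_fst.2 ⟨hg.lt u hu, Or.inr hu⟩), hxm]
      exact ⟨fun h => h.elim (fun h => (hcomp u (hf.mem e he _ h).1 hu).1 h) id, Or.inr⟩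
    · rw [← hlink x e d es hxm]; exact h4
    · simp only [List.map_cons, List.sum_cons] at h5 ⊢
      omega

/-- The seed adds only loops and no cut edges. It guarantees that `v` is in the scope to be
eliminated even if no factor mentions it; the projection then rejects an isolated vertex. -/
theorem feas_cons_seed {cap s t v : ℕ} {P : List ℕ} {Fs : List Factor} :
    Feas s t cap P Fs ↔ Feas s t cap P (seed v :: Fs) := by
  constructor
  · rintro ⟨σ, es, h1, h2, h3, h4, h5⟩
    by_cases hv : σ v
    · refine ⟨σ, ([(v, v)], 0) :: es, List.Forall₂.cons ⟨by simp [seed], by simp [seed, hv]⟩ h1,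
        h2, h3, fun u hu => ?_, by simpa using h5⟩
      have : ∀ x y, Linked es x y → ReflTransGen (Linked (([(v, v)], 0) :: es)) x y :=
        fun x y ⟨e, he, h⟩ => .single ⟨e, List.mem_cons_of_mem _ he, h⟩
      exact (h4 u hu).imp (reflTransGen_of_step this) (reflTransGen_of_step this)
    · refine ⟨σ, ([], 0) :: es, List.Forall₂.cons ⟨by simp [seed], by simp [seed, hv]⟩ h1,
        h2, h3, fun u hu => ?_, by simpa using h5⟩
      have : ∀ x y, Linked es x y → ReflTransGen (Linked (([], 0) :: es)) x y :=
        fun x y ⟨e, he, h⟩ => .single ⟨e, List.mem_cons_of_mem _ he, h⟩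
      exact (h4 u hu).imp (reflTransGen_of_step this) (reflTransGen_of_step this)
  · rintro ⟨σ, es, h1, h2, h3, h4, h5⟩
    cases h1 with
    | @cons _ x _ es hx h1 =>
    have hx' : x.2 = 0 ∧ ∀ y ∈ x.1, y = (v, v) := by
      have := hx.1
      simp only [seed, List.mem_cons, List.not_mem_nil, or_false] at this
      rcases this with rfl | rfl <;> simp
    refine ⟨σ, es, h1, h2, h3, fun u hu => ?_, by simpa [hx'.1] using h5⟩
    have : ∀ a b, Linked (x :: es) a b → ReflTransGen (Linked es) a b := by
      rintro a b ⟨e, he, h⟩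
      rcases List.mem_cons.1 he with rfl | he
      · have := hx'.2 _ h
        rw [Prod.mk.injEq] at this
        rw [this.1, this.2]
      · exact .single ⟨e, he, h⟩
    exact (h4 u hu).imp (reflTransGen_of_step this) (reflTransGen_of_step this)

theorem feas_cons_seedST {cap s t : ℕ} (hst : s ≠ t) {P : List ℕ} {Fs : List Factor} :
    Feas s t cap P Fs ↔ Feas s t cap P (seedST s t :: Fs) := by
  constructor
  · rintro ⟨σ, es, h1, h2, h3, h4, h5⟩
    refine ⟨σ, ([(s, s)], 0) :: es, List.Forall₂.cons ⟨by simp [seedST], ?_⟩ h1,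
      h2, h3, fun u hu => ?_, by simpa using h5⟩
    · simp [seedST, h2, h3, hst.symm]
    · have : ∀ x y, Linked es x y → ReflTransGen (Linked (([(s, s)], 0) :: es)) x y :=
        fun x y ⟨e, he, h⟩ => .single ⟨e, List.mem_cons_of_mem _ he, h⟩
      exact (h4 u hu).imp (reflTransGen_of_step this) (reflTransGen_of_step this)
  · rintro ⟨σ, es, h1, h2, h3, h4, h5⟩
    cases h1 with
    | @cons _ x _ es hx h1 =>
    have hx' : x = ([(s, s)], 0) := by simpa [seedST] using hx.1
    subst hx'
    refine ⟨σ, es, h1, h2, h3, fun u hu => ?_, by simpa using h5⟩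
    have : ∀ a b, Linked (([(s, s)], 0) :: es) a b → ReflTransGen (Linked es) a b := by
      rintro a b ⟨e, he, h⟩
      rcases List.mem_cons.1 he with rfl | he
      · have : a = s ∧ b = s := by simpa using h
        rw [this.1, this.2]
      · exact .single ⟨e, he, h⟩
    exact (h4 u hu).imp (reflTransGen_of_step this) (reflTransGen_of_step this)

/-- A path can bypass `v` if each two-step passage through `v` has a substitute. The second
conclusion treats a path already at `v`, entered from `a`; it makes the induction work when steps
remain at `v`. -/
theorem reflTransGen_elim {r r' : ℕ → ℕ → Prop} {v : ℕ}
    (h1 : ∀ x y, x ≠ v → y ≠ v → r x y → ReflTransGen r' x y)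
    (h2 : ∀ x y, x ≠ v → y ≠ v → r x v → r v y → ReflTransGen r' x y) {u w : ℕ}
    (h : ReflTransGen r u w) (hw : w ≠ v) : (u ≠ v → ReflTransGen r' u w) ∧
      (u = v → ∀ a, a ≠ v → r a v → ReflTransGen r' a w) := by
  induction h using ReflTransGen.head_induction_on with
  | refl => exact ⟨fun _ => .refl, fun h => absurd h hw⟩
  | @head u x hux _ ih =>
    constructor
    · intro hu
      by_cases hx : x = v
      · exact ih.2 hx u hu (hx ▸ hux)
      · exact (h1 u x hu hx hux).trans (ih.1 hx)
    · intro hu a ha hav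
      subst hu
      by_cases hx : x = u
      · exact ih.2 hx a ha hav
      · exact (h2 a x ha hx hav hux).trans (ih.1 hx)

theorem not_linked_of_forall₂ {n cap v : ℕ} {σ : ℕ → Prop} {Fs : List Factor} {es : List Entry}
    (h : List.Forall₂ (Agree σ) Fs es) (hFs : ∀ g ∈ Fs, WF n cap g ∧ v ∉ g.1) {x y : ℕ}
    (hxy : Linked es x y) : x ≠ v ∧ y ≠ v := by
  obtain ⟨e, he, hxy⟩ := hxy
  have key : ∀ (Fs : List Factor) (es : List Entry), List.Forall₂ (Agree σ) Fs es →
      (∀ g ∈ Fs, WF n cap g ∧ v ∉ g.1) → ∀ e ∈ es, (x, y) ∈ e.1 → x ≠ v ∧ y ≠ v := by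
    intro Fs es h
    induction h with
    | nil => simp
    | @cons g d Fs es hd _ ih =>
      intro hFs e he hxy
      rcases List.mem_cons.1 he with rfl | he
      · obtain ⟨h1, h2⟩ := hFs g List.mem_cons_self
        have h3 := h1.mem e hd.1 _ hxy
        exact ⟨fun h => h2 (h ▸ h3.1), fun h => h2 (h ▸ h3.2)⟩
      · exact ih (fun g hg => hFs g (List.mem_cons_of_mem _ hg)) e he hxy
  exact key Fs es h hFs e he hxy

theorem forall₂_agree_congr {σ σ' : ℕ → Prop} {v : ℕ} (hσ : ∀ u, u ≠ v → (σ u ↔ σ' u))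
    {Fs : List Factor} {es : List Entry} (h : List.Forall₂ (Agree σ) Fs es)
    (hFs : ∀ g ∈ Fs, v ∉ g.1) : List.Forall₂ (Agree σ') Fs es := by
  induction h with
  | nil => exact .nil
  | @cons g d Fs es hd _ ih =>
    refine .cons ⟨hd.1, fun u hu => ?_⟩ (ih fun g hg => hFs g (List.mem_cons_of_mem _ hg))
    rw [← hσ u (fun h => hFs g List.mem_cons_self (h ▸ hu)), hd.2 u hu]

/-- Only `f` mentions `v`, so all links at `v` lie in one entry. If `v` reaches a terminal, that
entry links it to another vertex, and paths through `v` can be shortcut. Conversely such a neighbour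
remains in `P` and reaches a terminal, so `v` does too, and shortcuts expand into two steps. Since
`elimRel` adds no pair `(a, a)`, side marks are preserved. -/
theorem feas_forgetF {n pad cap s t v : ℕ} {P : List ℕ} {f : Factor} {Fs : List Factor}
    (hf : WF n cap f) (hFs : ∀ g ∈ Fs, WF n cap g ∧ v ∉ g.1) (hvP : v ∉ P) (hs : s ∈ P)
    (ht : t ∈ P) (hfP : ∀ u ∈ f.1, u ∈ v :: P)
    (hpad : 2 ^ ((forgetF n pad cap v f).1.length * (forgetF n pad cap v f).1.length) ≤ pad) :
    Feas s t cap (v :: P) (f :: Fs) ↔ Feas s t cap P (forgetF n pad cap v f :: Fs) := by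
  have hsv : s ≠ v := fun h => hvP (h ▸ hs)
  have htv : t ≠ v := fun h => hvP (h ▸ ht)
  constructor
  · rintro ⟨σ, es, h1, h2, h3, h4, h5⟩
    cases h1 with
    | @cons _ e _ es he h1 =>
    obtain ⟨he, heσ⟩ := he
    have hnl := fun x y => not_linked_of_forall₂ (x := x) (y := y) h1 hFs
    obtain ⟨K, hK, hKm⟩ := exists_mem_cands (c := e.2) (L := elimRel v e.1) hpad (by
      rintro ⟨a, b⟩ hy
      obtain ⟨h6, h7, h8⟩ := mem_elimRel.1 hy
      have h9 : a ∈ f.1 ∧ b ∈ f.1 := by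
        rcases h6 with h6 | ⟨_, h6, h6'⟩
        · exact hf.mem e he _ h6
        · exact ⟨(hf.mem e he _ h6).1, (hf.mem e he _ h6').2⟩
      exact ⟨mem_forgetF_fst.2 ⟨hf.lt _ h9.1, h9.1, h7⟩,
        mem_forgetF_fst.2 ⟨hf.lt _ h9.2, h9.2, h8⟩⟩) (hf.le e he)
    have hnbr : ∃ b, b ≠ v ∧ (v, b) ∈ e.1 := by
      have key : ∀ w, w ≠ v → ReflTransGen (Linked (e :: es)) v w → ∃ b, b ≠ v ∧ (v, b) ∈ e.1 := by
        intro w hw h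
        by_contra hcon
        push Not at hcon
        have : ∀ x, ReflTransGen (Linked (e :: es)) v x → x = v := by
          intro x hx
          induction hx with
          | refl => rfl
          | @tail y z _ hyz ih =>
            subst ih
            obtain ⟨d, hd, hdm⟩ := hyz
            rcases List.mem_cons.1 hd with rfl | hd
            · by_contra hz
              exact hcon z hz hdm
            · exact absurd rfl (hnl _ _ ⟨d, hd, hdm⟩).1
        exact hw (this w h)
      rcases h4 v List.mem_cons_self with h | h
      · exact key s hsv h
      · exact key t htv h
    refine ⟨σ, (K, e.2) :: es, List.Forall₂.cons ⟨mem_forgetF.2 ⟨hK, e, he, hnbr, hKm, rfl⟩, ?_⟩ h1,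
      h2, h3, fun u hu => ?_, h5⟩
    · intro u hu
      obtain ⟨_, hu, huv⟩ := mem_forgetF_fst.1 hu
      rw [hKm, mem_elimRel, heσ u hu]
      simp [huv]
    · have hu' : u ≠ v := fun h => hvP (h ▸ hu)
      have g1 : ∀ x y, x ≠ v → y ≠ v → Linked (e :: es) x y →
          ReflTransGen (Linked ((K, e.2) :: es)) x y := by
        rintro x y hx hy ⟨d, hd, hdm⟩
        rcases List.mem_cons.1 hd with rfl | hd
        · exact .single ⟨_, List.mem_cons_self, (hKm _).2 (mem_elimRel.2 ⟨Or.inl hdm, hx, hy⟩)⟩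
        · exact .single ⟨d, List.mem_cons_of_mem _ hd, hdm⟩
      have g2 : ∀ x y, x ≠ v → y ≠ v → Linked (e :: es) x v → Linked (e :: es) v y →
          ReflTransGen (Linked ((K, e.2) :: es)) x y := by
        rintro x y hx hy ⟨d, hd, hdm⟩ ⟨d', hd', hdm'⟩
        rcases List.mem_cons.1 hd with rfl | hd
        · rcases List.mem_cons.1 hd' with rfl | hd'
          · by_cases hxy : x = y
            · rw [hxy]
            · exact .single ⟨_, List.mem_cons_self,
                (hKm _).2 (mem_elimRel.2 ⟨Or.inr ⟨hxy, hdm, hdm'⟩, hx, hy⟩)⟩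
          · exact absurd rfl (hnl _ _ ⟨d', hd', hdm'⟩).1
        · exact absurd rfl (hnl _ _ ⟨d, hd, hdm⟩).2
      exact (h4 u (List.mem_cons_of_mem _ hu)).imp
        (fun h => (reflTransGen_elim g1 g2 h hsv).1 hu')
        (fun h => (reflTransGen_elim g1 g2 h htv).1 hu')
  · rintro ⟨σ, es, h1, h2, h3, h4, h5⟩
    cases h1 with
    | @cons _ x _ es hx h1 =>
    obtain ⟨hx, hxσ⟩ := hx
    obtain ⟨_, e, he, ⟨b, hbv, hvb⟩, hxm, hx2⟩ := mem_forgetF.1 hx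
    -- The projected entry does not record the side of `v`; it is read off from the entry `e` it
    -- came from.
    let σ' : ℕ → Prop := fun u => if u = v then (v, v) ∈ e.1 else σ u
    have hσ' : ∀ u, u ≠ v → (σ u ↔ σ' u) := fun u hu => by simp [σ', hu]
    have hreach : ∀ a c, ReflTransGen (Linked (x :: es)) a c →
        ReflTransGen (Linked (e :: es)) a c := by
      intro a c
      refine reflTransGen_of_step ?_
      rintro a c ⟨d, hd, hdm⟩
      rcases List.mem_cons.1 hd with rfl | hd
      · obtain ⟨h6 | ⟨_, h6, h7⟩, _, _⟩ := mem_elimRel.1 ((hxm _).1 hdm)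
        · exact .single ⟨e, List.mem_cons_self, h6⟩
        · exact .head ⟨e, List.mem_cons_self, h6⟩ (.single ⟨e, List.mem_cons_self, h7⟩)
      · exact .single ⟨d, List.mem_cons_of_mem _ hd, hdm⟩
    refine ⟨σ', e :: es, List.Forall₂.cons ⟨he, fun u hu => ?_⟩
      (forall₂_agree_congr hσ' h1 fun g hg => (hFs g hg).2), (hσ' s hsv).1 h2,
      fun h => h3 ((hσ' t htv).2 h), fun u hu => ?_, ?_⟩
    · by_cases huv : u = v
      · simp [σ', huv]
      · rw [← hσ' u huv, hxσ u (mem_forgetF_fst.2 ⟨hf.lt u hu, hu, huv⟩), hxm, mem_elimRel]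
        simp [huv]
    · rcases List.mem_cons.1 hu with rfl | hu
      · have hbP : b ∈ P := by
          have := hfP b (hf.mem e he _ hvb).2
          exact (List.mem_cons.1 this).resolve_left hbv
        have h6 : Linked (e :: es) u b := ⟨e, List.mem_cons_self, hvb⟩
        exact (h4 b hbP).imp (fun h => .head h6 (hreach _ _ h)) (fun h => .head h6 (hreach _ _ h))
      · exact (h4 u hu).imp (hreach _ _) (hreach _ _)
    · simp only [List.map_cons, List.sum_cons] at h5 ⊢
      omega

theorem pad_of_subset {W : List ℕ} {U : Finset ℕ} {b pad : ℕ} (hW : W.Nodup) (hU : U.card ≤ b)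
    (hWU : ∀ u ∈ W, u ∈ U) (hpad : 2 ^ (b * b) ≤ pad) : 2 ^ (W.length * W.length) ≤ pad := by
  refine le_trans (Nat.pow_le_pow_right (by norm_num) ?_) hpad
  have h1 : W.length ≤ b := by
    rw [← List.toFinset_card_of_nodup hW]
    exact (Finset.card_le_card fun u hu => hWU u (List.mem_toFinset.1 hu)).trans hU
  exact Nat.mul_le_mul h1 h1

/-- A single small set `U` containing all scopes keeps every intermediate join within the range
where no candidates are cut off. -/
theorem feas_joinAll {n pad cap s t b : ℕ} {P : List ℕ} {f : Factor} {J Fs : List Factor}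
    {U : Finset ℕ} (hf : WF n cap f) (hJ : ∀ g ∈ J, WF n cap g) (hfU : ∀ u ∈ f.1, u ∈ U)
    (hJU : ∀ g ∈ J, ∀ u ∈ g.1, u ∈ U) (hU : U.card ≤ b) (hpad : 2 ^ (b * b) ≤ pad) :
    (Feas s t cap P (f :: (J ++ Fs)) ↔ Feas s t cap P (joinAll n pad cap f J :: Fs)) ∧
      WF n cap (joinAll n pad cap f J) ∧
      ∀ u, u ∈ (joinAll n pad cap f J).1 ↔ u ∈ f.1 ∨ ∃ g ∈ J, u ∈ g.1 := by
  induction J generalizing f with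
  | nil => exact ⟨Iff.rfl, hf, by simp [joinAll]⟩
  | cons g J ih =>
    have hg := hJ g List.mem_cons_self
    have hjU : ∀ u ∈ (joinF n pad cap f g).1, u ∈ U := by
      intro u hu
      rcases (mem_joinF_fst.1 hu).2 with h | h
      · exact hfU u h
      · exact hJU g List.mem_cons_self u h
    have hpad' := pad_of_subset (List.nodup_range.filter _) hU hjU hpad
    obtain ⟨h1, h2, h3⟩ := ih (f := joinF n pad cap f g) wf_joinF
      (fun g hg => hJ g (List.mem_cons_of_mem _ hg)) hjU
      (fun g hg => hJU g (List.mem_cons_of_mem _ hg))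
    refine ⟨(feas_joinF hf hg hpad').trans h1, h2, fun u => (h3 u).trans ?_⟩
    rw [mem_joinF_fst, List.exists_mem_cons_iff, ← or_assoc]
    refine or_congr_left ⟨fun h => h.2, fun h => ⟨?_, h⟩⟩
    exact h.elim (hf.lt u) (hg.lt u)

/-- `a` and `b` are connected by a path with all inner vertices outside `P`. -/
def PathOff (E : List (ℕ × ℕ)) (P : List ℕ) (a b : ℕ) : Prop :=
  (a, b) ∈ E ∨ ∃ x y, x ∉ P ∧ (a, x) ∈ E ∧ ReflTransGen (AdjOff E P) x y ∧ (y, b) ∈ E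

/-- The invariant of the elimination, with the vertices `P` left. -/
structure ElimInv (n cap : ℕ) (E : List (ℕ × ℕ)) (P : List ℕ) (Fs : List Factor) : Prop where
  wf : ∀ f ∈ Fs, WF n cap f
  mem : ∀ f ∈ Fs, ∀ u ∈ f.1, u ∈ P
  path : ∀ f ∈ Fs, ∀ a ∈ f.1, ∀ b ∈ f.1, a ≠ b → PathOff E P a b

theorem PathOff.of_cons {E : List (ℕ × ℕ)} {P : List ℕ} {v a b : ℕ} (h : PathOff E (v :: P) a b) :
    PathOff E P a b := by
  rcases h with h | ⟨x, y, hx, hax, hxy, hyb⟩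
  · exact Or.inl h
  · exact Or.inr ⟨x, y, fun h => hx (List.mem_cons_of_mem _ h), hax,
      AdjOff.mono (List.subset_cons_self _ _) hxy, hyb⟩

theorem PathOff.touch {E : List (ℕ × ℕ)} {P : List ℕ} {v b : ℕ} (hv : v ∉ P) (hb : b ∈ P)
    (h : PathOff E (v :: P) v b) : Touch E P v b := by
  rcases h with h | ⟨x, y, hx, hax, hxy, hyb⟩
  · exact ⟨hb, v, .refl, h⟩
  · exact ⟨hb, y, .head ⟨hax, hv, fun h => hx (List.mem_cons_of_mem _ h)⟩
      (AdjOff.mono (List.subset_cons_self _ _) hxy), hyb⟩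

theorem PathOff.of_touch {n : ℕ} {E : List (ℕ × ℕ)} {P : List ℕ} {v a b : ℕ} (hE : IsGraph n E)
    (hv : v ∉ P) (ha : Touch E P v a) (hb : Touch E P v b) : PathOff E P a b := by
  obtain ⟨_, x, hx, hxa⟩ := ha
  obtain ⟨_, y, hy, hyb⟩ := hb
  exact Or.inr ⟨x, y, AdjOff.not_mem hv hx, hE.symm _ _ hxa, (AdjOff.symm hE.symm hx).trans hy, hyb⟩

-- Two vertices in a common scope are joined by a path through eliminated vertices. So all scopes
-- containing `v` lie in the set of `v` and the vertices it touches, which has at most `b + 1`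
-- elements; after elimination, two remaining vertices of the new scope are joined through `v`.
open Classical in
theorem elimStep_spec {n pad cap s t v b : ℕ} {E : List (ℕ × ℕ)} {P : List ℕ} {Fs : List Factor}
    (hE : IsGraph n E) (h : ElimInv n cap E (v :: P) Fs) (hvn : v < n) (hvP : v ∉ P) (hs : s ∈ P)
    (ht : t ∈ P) (hb : ∀ T : Finset ℕ, (∀ w ∈ T, Touch E P v w) → T.card ≤ b)
    (hpad : 2 ^ ((b + 1) * (b + 1)) ≤ pad) :
    (Feas s t cap (v :: P) Fs ↔ Feas s t cap P (elimStep n pad cap Fs v)) ∧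
      ElimInv n cap E P (elimStep n pad cap Fs v) := by
  set U : Finset ℕ := insert v (P.toFinset.filter fun w => Touch E P v w) with hUdef
  have hU : U.card ≤ b + 1 := by
    refine (Finset.card_insert_le _ _).trans ?_
    have := hb (P.toFinset.filter fun w => Touch E P v w) fun w hw => (Finset.mem_filter.1 hw).2
    omega
  set J := Fs.filter fun f => memN v f.1 with hJ
  set O := Fs.filter fun f => !memN v f.1 with hO
  have hJm : ∀ f, f ∈ J ↔ f ∈ Fs ∧ v ∈ f.1 := fun f => by
    rw [hJ, List.mem_filter, memN_iff]
  have hOm : ∀ f, f ∈ O ↔ f ∈ Fs ∧ v ∉ f.1 := fun f => by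
    rw [hO, List.mem_filter, Bool.not_eq_true', ← Bool.not_eq_true, memN_iff]
  have htouch : ∀ f ∈ J, ∀ u ∈ f.1, u = v ∨ (u ∈ P ∧ Touch E P v u) := by
    intro f hf u hu
    obtain ⟨hf, hvf⟩ := (hJm f).1 hf
    by_cases huv : u = v
    · exact Or.inl huv
    · have huP := (List.mem_cons.1 (h.mem f hf u hu)).resolve_left huv
      exact Or.inr ⟨huP, (h.path f hf v hvf u hu (Ne.symm huv)).touch hvP huP⟩
  have hJU : ∀ f ∈ J, ∀ u ∈ f.1, u ∈ U := by
    intro f hf u hu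
    rw [hUdef, Finset.mem_insert, Finset.mem_filter, List.mem_toFinset]
    exact htouch f hf u hu
  obtain ⟨h1, h2, h3⟩ := feas_joinAll (s := s) (t := t) (P := v :: P) (J := J) (Fs := O)
    (wf_seed (cap := cap) hvn) (fun g hg => h.wf g ((hJm g).1 hg).1)
    (by simp [seed, hUdef]) hJU hU hpad
  set f := joinAll n pad cap (seed v) J with hf
  have hfm : ∀ u ∈ f.1, u = v ∨ (u ∈ P ∧ Touch E P v u) := by
    intro u hu
    rcases (h3 u).1 hu with h4 | ⟨g, hg, h4⟩
    · left; simpa [seed] using h4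
    · exact htouch g hg u h4
  have hOwf : ∀ g ∈ O, WF n cap g ∧ v ∉ g.1 := fun g hg =>
    ⟨h.wf g ((hOm g).1 hg).1, ((hOm g).1 hg).2⟩
  have hpad' := pad_of_subset (W := (forgetF n pad cap v f).1) (U := U)
    (List.nodup_range.filter _) hU (by
      intro u hu
      rw [hUdef, Finset.mem_insert, Finset.mem_filter, List.mem_toFinset]
      exact hfm u (mem_forgetF_fst.1 hu).2.1) hpad
  constructor
  · have hperm : Fs.Perm (J ++ O) := (List.filter_append_perm _ _).symm
    rw [feas_perm hperm, feas_cons_seed (v := v), h1,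
      feas_forgetF h2 hOwf hvP hs ht (fun u hu => List.mem_cons.2 ((hfm u hu).imp id And.left))
        hpad']
    rfl
  · refine ⟨?_, ?_, ?_⟩
    · intro g hg
      rcases List.mem_cons.1 hg with rfl | hg
      · exact wf_forgetF
      · exact (hOwf g hg).1
    · intro g hg u hu
      rcases List.mem_cons.1 hg with rfl | hg
      · obtain ⟨_, h4, h5⟩ := mem_forgetF_fst.1 hu
        exact ((hfm u h4).resolve_left h5).1
      · refine (List.mem_cons.1 (h.mem g ((hOm g).1 hg).1 u hu)).resolve_left ?_
        rintro rfl
        exact (hOwf g hg).2 hu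
    · intro g hg x hx y hy hxy
      rcases List.mem_cons.1 hg with rfl | hg
      · obtain ⟨_, h4, h5⟩ := mem_forgetF_fst.1 hx
        obtain ⟨_, h6, h7⟩ := mem_forgetF_fst.1 hy
        exact PathOff.of_touch hE hvP ((hfm x h4).resolve_left h5).2 ((hfm y h6).resolve_left h7).2
      · exact (h.path g ((hOm g).1 hg).1 x hx y hy hxy).of_cons

theorem elimAll_spec {n pad cap s t b : ℕ} {E : List (ℕ × ℕ)} {L : List ℕ} {Fs : List Factor}
    (hE : IsGraph n E) (h : ElimInv n cap E (L ++ [s, t]) Fs) (hL : ∀ v ∈ L, v < n)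
    (hnd : (L ++ [s, t]).Nodup) (hgood : GoodOrder E s t (L ++ [s, t]) b)
    (hpad : 2 ^ ((b + 1) * (b + 1)) ≤ pad) :
    (Feas s t cap (L ++ [s, t]) Fs ↔ Feas s t cap [s, t] (elimAll n pad cap Fs L)) ∧
      ElimInv n cap E [s, t] (elimAll n pad cap Fs L) := by
  induction L generalizing Fs with
  | nil => exact ⟨Iff.rfl, h⟩
  | cons v L ih =>
    rw [List.cons_append] at h hnd hgood ⊢
    obtain ⟨hv, hnd'⟩ := List.nodup_cons.1 hnd
    have hvs : v ≠ s := by rintro rfl; exact hv (by simp)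
    have hvt : v ≠ t := by rintro rfl; exact hv (by simp)
    obtain ⟨h1, h2⟩ := elimStep_spec (s := s) (t := t) hE h (hL v List.mem_cons_self) hv (by simp)
      (by simp) (hgood v _ (List.suffix_refl _) hvs hvt) hpad
    obtain ⟨h3, h4⟩ := ih h2 (fun u hu => hL u (List.mem_cons_of_mem _ hu)) hnd'
      fun u rest hsuf => hgood u rest (hsuf.trans (List.suffix_cons _ _))
    exact ⟨h1.trans h3, h4⟩

/-- With only the terminals left, the connectivity condition is vacuous; `seedST` puts both into the
joint scope, so an entry of the last factor determines their sides. -/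
theorem finalTest_spec {n pad cap s t : ℕ} {E : List (ℕ × ℕ)} {Fs : List Factor} (hs : s < n)
    (ht : t < n) (hst : s ≠ t) (h : ElimInv n cap E [s, t] Fs) (hpad : 2 ^ (2 * 2) ≤ pad) :
    Feas s t cap [s, t] Fs ↔ finalTest cap s t (joinAll n pad cap (seedST s t) Fs) = true := by
  obtain ⟨h1, h2, h3⟩ := feas_joinAll (s := s) (t := t) (P := [s, t]) (J := Fs) (Fs := [])
    (U := {s, t}) (wf_seedST (cap := cap) hs ht) h.wf (by simp [seedST])
    (fun g hg u hu => by simpa using h.mem g hg u hu) Finset.card_le_two hpad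
  rw [List.append_nil] at h1
  rw [feas_cons_seedST hst, h1]
  set f := joinAll n pad cap (seedST s t) Fs with hf
  have hsf : s ∈ f.1 := (h3 s).2 (Or.inl (by simp [seedST]))
  have htf : t ∈ f.1 := (h3 t).2 (Or.inl (by simp [seedST]))
  simp only [finalTest, List.any_eq_true, Bool.and_eq_true, memP_iff, Bool.not_eq_true',
    ← Bool.not_eq_true, Nat.ble_eq]
  constructor
  · rintro ⟨σ, es, h4, h5, h6, h7, h8⟩
    cases h4 with
    | @cons _ e _ es he h4 =>
    cases h4
    refine ⟨e, he.1, (he.2 s hsf).1 h5, fun h => h6 ((he.2 t htf).2 h), by simpa using h8⟩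
  · rintro ⟨e, he, h4, h5, h6⟩
    refine ⟨fun u => (u, u) ∈ e.1, [e], List.Forall₂.cons ⟨he, fun u _ => Iff.rfl⟩ .nil, h4, h5, ?_,
      by simpa using h6⟩
    intro u hu
    simp only [List.mem_cons, List.not_mem_nil, or_false] at hu
    rcases hu with rfl | rfl
    · exact Or.inl .refl
    · exact Or.inr .refl

/-! ### Bucket elimination takes polynomial time -/

@[fun_prop]
theorem PolyF.cands {p c : α → ℕ} {W : α → List ℕ} (hp : PolyF p) (hc : PolyF c) (hW : PolyF W) :
    PolyF (fun a => cands (p a) (c a) (W a)) := by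
  unfold StBond.cands prodPairs; fun_prop

@[fun_prop]
theorem PolyF.compat {W₁ W₂ : α → List ℕ} {K₁ K₂ : α → List (ℕ × ℕ)} (h₁ : PolyF W₁)
    (h₂ : PolyF W₂) (h₃ : PolyF K₁) (h₄ : PolyF K₂) :
    PolyF (fun a => compat (W₁ a) (W₂ a) (K₁ a) (K₂ a)) := by
  unfold StBond.compat; fun_prop

@[fun_prop]
theorem PolyF.joinF {n p c : α → ℕ} {f g : α → Factor} (hn : PolyF n) (hp : PolyF p)
    (hc : PolyF c) (hf : PolyF f) (hg : PolyF g) :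
    PolyF (fun a => joinF (n a) (p a) (c a) (f a) (g a)) := by
  unfold StBond.joinF joinOn; fun_prop

@[fun_prop]
theorem PolyF.elimRel {v : α → ℕ} {K : α → List (ℕ × ℕ)} (hv : PolyF v) (hK : PolyF K) :
    PolyF (fun a => elimRel (v a) (K a)) := by
  unfold StBond.elimRel; fun_prop

@[fun_prop]
theorem PolyF.forgetF {n p c v : α → ℕ} {f : α → Factor} (hn : PolyF n) (hp : PolyF p)
    (hc : PolyF c) (hv : PolyF v) (hf : PolyF f) :
    PolyF (fun a => forgetF (n a) (p a) (c a) (v a) (f a)) := by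
  unfold StBond.forgetF forgetOn hasNbr; fun_prop

@[fun_prop]
theorem PolyF.finalTest {c s t : α → ℕ} {f : α → Factor} (hc : PolyF c) (hs : PolyF s)
    (ht : PolyF t) (hf : PolyF f) : PolyF (fun a => finalTest (c a) (s a) (t a) (f a)) := by
  unfold StBond.finalTest; fun_prop

/-- Joins and projections select from the candidates instead of multiplying their arguments. Their
size is therefore bounded independently of the factors they come from, and repeated joins do not
blow up. -/
theorem exists_sz_factor_le : ∃ q : ℕ × ℕ × ℕ → ℕ, PB q ∧ ∀ n pad cap (W : List ℕ) (T : List Entry),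
    W.Sublist (List.range n) → T.Sublist (cands pad cap W) → sz (W, T) ≤ q (n, pad, cap) := by
  have h : PolyF (fun p : ℕ × ℕ × List ℕ => cands p.1 p.2.1 p.2.2) := by fun_prop
  obtain ⟨c, hc⟩ := h.1
  have hr : PolyF (fun p : ℕ × ℕ × ℕ => List.range p.1) := by fun_prop
  refine ⟨fun p => sz (List.range p.1) + (sz p + sz (List.range p.1) + 1) ^ c + 1,
    (hr.1.add (((PB.size.add hr.1).add (PB.const 1)).pow c)).add (PB.const 1), ?_⟩
  intro n pad cap W T hW hT
  have h1 := sz_le_of_sublist hW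
  have h2 := (sz_le_of_sublist hT).trans (hc (pad, cap, W))
  have h3 : (sz (pad, cap, W) + 1) ^ c ≤ (sz (n, pad, cap) + sz (List.range n) + 1) ^ c :=
    Nat.pow_le_pow_left (by simp only [sz_mk]; omega) c
  simp only [sz_mk W T]; omega

@[fun_prop]
theorem PolyF.joinAll {n p c : α → ℕ} {f : α → Factor} {J : α → List Factor} (hn : PolyF n)
    (hp : PolyF p) (hc : PolyF c) (hf : PolyF f) (hJ : PolyF J) :
    PolyF (fun a => joinAll (n a) (p a) (c a) (f a) (J a)) := by
  obtain ⟨q, hq, hb⟩ := exists_sz_factor_le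
  unfold StBond.joinAll
  refine foldl_of_growth (s := fun a (f g : Factor) => StBond.joinF (n a) (p a) (c a) f g) (by fun_prop)
    hf hJ (fun a => q (n a, p a, c a)) ((hn.mk (hp.mk hc)).pb_comp hq) fun a g _ f => ?_
  exact (hb _ _ _ _ _ List.filter_sublist List.filter_sublist).trans (Nat.le_add_left _ _)

@[fun_prop]
theorem PolyF.elimStep {n p c v : α → ℕ} {Fs : α → List Factor} (hn : PolyF n)
    (hp : PolyF p) (hc : PolyF c) (hF : PolyF Fs) (hv : PolyF v) :
    PolyF (fun a => elimStep (n a) (p a) (c a) (Fs a) (v a)) := by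
  unfold StBond.elimStep seed; fun_prop

theorem exists_sz_elimStep_le : ∃ q : ℕ × ℕ × ℕ → ℕ, PB q ∧ ∀ n pad cap Fs v,
    sz (elimStep n pad cap Fs v) ≤ sz Fs + q (n, pad, cap) := by
  obtain ⟨q, hq, hb⟩ := exists_sz_factor_le
  refine ⟨fun p => q p + 1, hq.add (PB.const 1), fun n pad cap Fs v => ?_⟩
  have h1 := sz_le_of_sublist (List.filter_sublist (l := Fs) (p := fun f => !memN v f.1))
  unfold elimStep forgetF forgetOn
  rw [sz_cons]
  refine (Nat.add_le_add_right (Nat.add_le_add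
    (hb n pad cap _ _ List.filter_sublist List.filter_sublist) h1) 1).trans (by simp only; omega)

@[fun_prop]
theorem PolyF.elimAll {n p c : α → ℕ} {Fs : α → List Factor} {L : α → List ℕ} (hn : PolyF n)
    (hp : PolyF p) (hc : PolyF c) (hF : PolyF Fs) (hL : PolyF L) :
    PolyF (fun a => elimAll (n a) (p a) (c a) (Fs a) (L a)) := by
  obtain ⟨q, hq, hb⟩ := exists_sz_elimStep_le
  unfold StBond.elimAll
  exact foldl_of_growth (s := fun a (Fs : List Factor) v => StBond.elimStep (n a) (p a) (c a) Fs v)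
    (by fun_prop) hF hL (fun a => q (n a, p a, c a)) ((hn.mk (hp.mk hc)).pb_comp hq)
    fun a v _ Fs => hb _ _ _ _ _

/-! ### The initial factors -/

/-- The factor of an edge. -/
def edgeF (e : ℕ × ℕ) : Factor :=
  ([e.1, e.2], [([(e.1, e.2), (e.2, e.1)], 0),
    ([(e.1, e.2), (e.2, e.1), (e.1, e.1), (e.2, e.2)], 0), ([(e.1, e.1)], 1), ([(e.2, e.2)], 1)])

/-- The factors of all edges. -/
def initF (E : List (ℕ × ℕ)) : List Factor :=
  (E.filter fun e => Nat.ble (e.1 + 1) e.2).map edgeF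

/-- Is there a bond separating `s` and `t` with at least `cap` edges? The list `P` is an elimination
order ending with `s` and `t`. -/
def solve (n : ℕ) (E : List (ℕ × ℕ)) (pad cap s t : ℕ) (P : List ℕ) : Bool :=
  finalTest cap s t (joinAll n pad cap (seedST s t) (elimAll n pad cap (initF E)
    (P.filter fun v => !Nat.beq v s && !Nat.beq v t)))

@[fun_prop]
theorem PolyF.initF {E : α → List (ℕ × ℕ)} (hE : PolyF E) : PolyF (fun a => initF (E a)) := by
  unfold StBond.initF edgeF; fun_prop

@[fun_prop]
theorem PolyF.solve {n p c s t : α → ℕ} {E : α → List (ℕ × ℕ)} {P : α → List ℕ} (hn : PolyF n)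
    (hE : PolyF E) (hp : PolyF p) (hc : PolyF c) (hs : PolyF s) (ht : PolyF t) (hP : PolyF P) :
    PolyF (fun a => solve (n a) (E a) (p a) (c a) (s a) (t a) (P a)) := by
  unfold StBond.solve seedST; fun_prop

/-! ### Bonds as common solutions of the edge factors -/

/-- Adjacent, and on the same side. -/
def SameSide (E : List (ℕ × ℕ)) (σ : ℕ → Prop) (x y : ℕ) : Prop := (x, y) ∈ E ∧ (σ x ↔ σ y)

open Classical in
/-- The number of edges between the sides. -/
noncomputable def cutCount (E : List (ℕ × ℕ)) (σ : ℕ → Prop) : ℕ :=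
  (E.filter fun e => Nat.ble (e.1 + 1) e.2 && decide ¬(σ e.1 ↔ σ e.2)).length

/-- The graph `E` on the vertices below `n` has a bond with at least `cap` edges. -/
def HasBond (n : ℕ) (E : List (ℕ × ℕ)) (s t cap : ℕ) : Prop :=
  ∃ σ : ℕ → Prop, σ s ∧ ¬σ t ∧
    (∀ u < n, ReflTransGen (SameSide E σ) u s ∨ ReflTransGen (SameSide E σ) u t) ∧
    cap ≤ cutCount E σ

open Classical in
/-- The entry of the factor of the edge `e` with the sides `σ`. -/
noncomputable def edgeEntry (σ : ℕ → Prop) (e : ℕ × ℕ) : Entry :=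
  if σ e.1 then
    if σ e.2 then ([(e.1, e.2), (e.2, e.1), (e.1, e.1), (e.2, e.2)], 0) else ([(e.1, e.1)], 1)
  else if σ e.2 then ([(e.2, e.2)], 1) else ([(e.1, e.2), (e.2, e.1)], 0)

/-- The four entries of an edge correspond to the four choices of sides for its two ends, so the
sides determine the entry. -/
theorem agree_edgeF_iff {σ : ℕ → Prop} {e : ℕ × ℕ} (he : e.1 ≠ e.2) {d : Entry} :
    Agree σ (edgeF e) d ↔ d = edgeEntry σ e := by
  obtain ⟨u, v⟩ := e
  have he' : v ≠ u := fun h => he h.symm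
  simp only at he
  constructor
  · rintro ⟨h1, h2⟩
    have hu := h2 u (by simp [edgeF])
    have hv := h2 v (by simp [edgeF])
    simp only [edgeF, List.mem_cons, List.not_mem_nil, or_false] at h1
    rcases h1 with rfl | rfl | rfl | rfl <;> simp [he, he'] at hu hv <;>
      simp [edgeEntry, hu, hv]
  · rintro rfl
    by_cases hu : σ u <;> by_cases hv : σ v <;>
      simp [Agree, edgeEntry, edgeF, hu, hv, he, he']

theorem forall₂_edgeF_iff {σ : ℕ → Prop} {l : List (ℕ × ℕ)} (hl : ∀ e ∈ l, e.1 ≠ e.2)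
    {es : List Entry} :
    List.Forall₂ (Agree σ) (l.map edgeF) es ↔ es = l.map (edgeEntry σ) := by
  induction l generalizing es with
  | nil => simp
  | cons e l ih =>
    rw [List.map_cons, List.map_cons, List.forall₂_cons_left_iff]
    constructor
    · rintro ⟨d, es', h1, h2, rfl⟩
      rw [(agree_edgeF_iff (hl e List.mem_cons_self)).1 h1,
        (ih fun x hx => hl x (List.mem_cons_of_mem _ hx)).1 h2]
    · rintro rfl
      exact ⟨_, _, (agree_edgeF_iff (hl e List.mem_cons_self)).2 rfl,
        (ih fun x hx => hl x (List.mem_cons_of_mem _ hx)).2 rfl, rfl⟩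

open Classical in
theorem sum_edgeEntry (σ : ℕ → Prop) (E : List (ℕ × ℕ)) :
    (((E.filter fun e => Nat.ble (e.1 + 1) e.2).map (edgeEntry σ)).map Prod.snd).sum =
      cutCount E σ := by
  unfold cutCount
  rw [List.filter_congr (q := fun e : ℕ × ℕ => decide (¬(σ e.1 ↔ σ e.2)) &&
    Nat.ble (e.1 + 1) e.2) fun _ _ => Bool.and_comm _ _, ← List.filter_filter]
  generalize E.filter (fun e => Nat.ble (e.1 + 1) e.2) = l
  induction l with
  | nil => rfl
  | cons e l ih =>
    rw [List.map_cons, List.map_cons, List.sum_cons, ih, List.filter_cons]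
    by_cases hu : σ e.1 <;> by_cases hv : σ e.2 <;> simp [edgeEntry, hu, hv, Nat.add_comm]

/-- Diagonal pairs are side marks rather than adjacencies, hence the restriction to different
vertices; loops do not affect reachability. -/
theorem linked_edgeEntry_iff {σ : ℕ → Prop} {E : List (ℕ × ℕ)}
    (hE : ∀ x y, (x, y) ∈ E → (y, x) ∈ E) {x y : ℕ} (hxy : x ≠ y) :
    Linked ((E.filter fun e => Nat.ble (e.1 + 1) e.2).map (edgeEntry σ)) x y ↔
      SameSide E σ x y := by
  simp only [Linked, List.mem_map, List.mem_filter, SameSide]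
  constructor
  · rintro ⟨_, ⟨⟨u, v⟩, ⟨h1, -⟩, rfl⟩, h2⟩
    have h3 := hE _ _ h1
    by_cases hu : σ u <;> by_cases hv : σ v <;>
      simp only [edgeEntry, hu, hv, if_true, if_false, List.mem_cons, List.not_mem_nil, or_false,
        Prod.mk.injEq] at h2
    · rcases h2 with ⟨rfl, rfl⟩ | ⟨rfl, rfl⟩ | ⟨rfl, rfl⟩ | ⟨rfl, rfl⟩ <;> simp_all
    · exact absurd (h2.1.trans h2.2.symm) hxy
    · exact absurd (h2.1.trans h2.2.symm) hxy
    · rcases h2 with ⟨rfl, rfl⟩ | ⟨rfl, rfl⟩ <;> simp_all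
  · rintro ⟨h1, h2⟩
    rcases Nat.lt_or_gt_of_ne hxy with h | h
    · refine ⟨_, ⟨(x, y), ⟨h1, Nat.ble_eq_true_of_le h⟩, rfl⟩, ?_⟩
      by_cases hy : σ y <;> simp [edgeEntry, h2, hy]
    · refine ⟨_, ⟨(y, x), ⟨hE _ _ h1, Nat.ble_eq_true_of_le h⟩, rfl⟩, ?_⟩
      by_cases hy : σ y <;> simp [edgeEntry, h2, hy]

theorem reflTransGen_congr_of_ne {α : Type} {r r' : α → α → Prop}
    (h : ∀ x y, x ≠ y → (r x y ↔ r' x y)) {x y : α} :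
    ReflTransGen r x y ↔ ReflTransGen r' x y := by
  have key : ∀ {r r' : α → α → Prop}, (∀ x y, x ≠ y → r x y → r' x y) → 
      ReflTransGen r x y → ReflTransGen r' x y := by
    intro r r' h h1
    induction h1 with
    | refl => exact .refl
    | @tail b c _ h1 ih =>
      by_cases hbc : b = c
      · exact hbc ▸ ih
      · exact ih.tail (h b c hbc h1)
  exact ⟨key fun x y hxy => (h x y hxy).1, key fun x y hxy => (h x y hxy).2⟩

theorem feas_initF_iff {n : ℕ} {E : List (ℕ × ℕ)} {s t cap : ℕ} {P : List ℕ} (hE : IsGraph n E)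
    (hP : ∀ v, v ∈ P ↔ v < n) : Feas s t cap P (initF E) ↔ HasBond n E s t cap := by
  have hl : ∀ e ∈ E.filter (fun e => Nat.ble (e.1 + 1) e.2), e.1 ≠ e.2 := fun e he =>
    (Nat.lt_of_succ_le (Nat.le_of_ble_eq_true (List.mem_filter.1 he).2)).ne
  unfold Feas HasBond initF
  refine exists_congr fun σ => ?_
  simp only [forall₂_edgeF_iff hl, exists_eq_left, sum_edgeEntry, hP,
    reflTransGen_congr_of_ne fun x y hxy => linked_edgeEntry_iff (σ := σ) hE.symm hxy]

theorem elimInv_initF {n cap : ℕ} {E : List (ℕ × ℕ)} {P : List ℕ} (hE : IsGraph n E)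
    (hcap : 1 ≤ cap) (hP : ∀ v, v ∈ P ↔ v < n) : ElimInv n cap E P (initF E) := by
  have hlt : ∀ f ∈ initF E, ∀ u ∈ f.1, u < n := by
    intro f hf u hu
    obtain ⟨e, he, rfl⟩ := List.mem_map.1 hf
    have h1 := (List.mem_filter.1 he).1
    simp only [edgeF, List.mem_cons, List.not_mem_nil, or_false] at hu
    rcases hu with rfl | rfl
    · exact hE.lt _ (hE.symm _ _ h1)
    · exact hE.lt _ h1
  refine ⟨fun f hf => ⟨hlt f hf, ?_, ?_⟩, fun f hf u hu => (hP u).2 (hlt f hf u hu), ?_⟩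
  · obtain ⟨e, he, rfl⟩ := List.mem_map.1 hf
    intro d hd
    simp only [edgeF, List.mem_cons, List.not_mem_nil, or_false] at hd
    rcases hd with rfl | rfl | rfl | rfl <;> simp [hcap]
  · obtain ⟨e, he, rfl⟩ := List.mem_map.1 hf
    intro d hd x hx
    simp only [edgeF, List.mem_cons, List.not_mem_nil, or_false] at hd
    rcases hd with rfl | rfl | rfl | rfl <;> simp at hx <;> simp only [edgeF] <;> grind
  · intro f hf a ha b hb hab
    obtain ⟨e, he, rfl⟩ := List.mem_map.1 hf
    have h1 := (List.mem_filter.1 he).1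
    simp only [edgeF, List.mem_cons, List.not_mem_nil, or_false] at ha hb
    rcases ha with rfl | rfl <;> rcases hb with rfl | rfl
    · exact absurd rfl hab
    · exact Or.inl h1
    · exact Or.inl (hE.symm _ _ h1)
    · exact absurd rfl hab

theorem solve_spec {n k pad cap s t : ℕ} {E : List (ℕ × ℕ)} {P : List ℕ} (hE : IsGraph n E)
    (hs : s < n) (ht : t < n) (hst : s ≠ t) (hcap : 1 ≤ cap) (h : PlaceInv n E k s t P)
    (hP : ∀ v < n, v ∈ P) (hpad : 2 ^ ((5 * k + 8) * (5 * k + 8)) ≤ pad) :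
    solve n E pad cap s t P = true ↔ HasBond n E s t cap := by
  have hP' : ∀ v, v ∈ P ↔ v < n := fun v => ⟨h.lt v, hP v⟩
  obtain ⟨L, rfl⟩ := h.suffix
  have hL : (L ++ [s, t]).filter (fun v => !Nat.beq v s && !Nat.beq v t) = L := by
    have h1 := h.nodup
    rw [List.nodup_append] at h1
    rw [List.filter_append, List.filter_eq_self.2]
    · simp
    · intro v hv
      have h2 := h1.2.2 v hv s (by simp)
      have h3 := h1.2.2 v hv t (by simp)
      rw [Bool.and_eq_true, Bool.not_eq_true', Bool.not_eq_true', ← Bool.not_eq_true,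
        ← Bool.not_eq_true, Nat.beq_eq, Nat.beq_eq]
      exact ⟨h2, h3⟩
  obtain ⟨h1, h2⟩ := elimAll_spec (cap := cap) hE (elimInv_initF hE hcap hP')
    (fun v hv => h.lt v (List.mem_append_left _ hv)) h.nodup h.good hpad
  rw [solve, hL, ← finalTest_spec hs ht hst h2 ?_, ← h1, feas_initF_iff hE hP']
  -- The last scope has two vertices, and `2 ≤ 5k + 8`.
  exact le_trans (Nat.pow_le_pow_right (by norm_num) (by nlinarith)) hpad

/-! ### Reading the input -/

/-- The number of leading ones. -/
def lead (w : List Bool) : ℕ := w.reverse.foldl (fun n b => bif b then n + 1 else 0) 0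

/-- What follows a number in unary. -/
def skip (w : List Bool) : List Bool := w.drop (lead w + 1)

/-- The number with binary digits `w`, but at most `m`. -/
def binVal (m : ℕ) (w : List Bool) : ℕ :=
  w.reverse.foldl (fun k b => min (k + k + bif b then 1 else 0) m) 0

/-- The number of vertices of the encoded graph. -/
def numV (w : List Bool) : ℕ := lead w

/-- The edges of the encoded graph, in both directions. -/
def edgeList (w : List Bool) : List (ℕ × ℕ) :=
  (prodPairs (List.range (numV w))).filter fun e =>
    ((skip w).drop (e.1 * numV w + e.2)).headD false

/-- The part of the input after the adjacency matrix. -/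
def afterMatrix (w : List Bool) : List Bool := (skip w).drop (numV w * numV w)

/-- The source. -/
def src (w : List Bool) : ℕ := lead (afterMatrix w)

/-- The target. -/
def tgt (w : List Bool) : ℕ := lead (skip (afterMatrix w))

/-- The required size of the cut, reduced to at most one more than the number of all pairs. -/
def capOf (w : List Bool) : ℕ :=
  binVal (numV w * numV w + 1) (skip (skip (afterMatrix w)))

@[fun_prop]
theorem PolyF.lead {w : α → List Bool} (hw : PolyF w) : PolyF (fun a => lead (w a)) := by
  unfold StBond.lead
  refine foldl_of_growth (s := fun _ (n : ℕ) b => bif b then n + 1 else 0) (by fun_prop)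
    (by fun_prop) (by fun_prop) (fun _ => 2) (PB.const 2) fun a b _ n => ?_
  cases b <;> simp
  omega

@[fun_prop]
theorem PolyF.skip {w : α → List Bool} (hw : PolyF w) : PolyF (fun a => skip (w a)) := by
  unfold StBond.skip; fun_prop

@[fun_prop]
theorem PolyF.binVal {m : α → ℕ} {w : α → List Bool} (hm : PolyF m) (hw : PolyF w) :
    PolyF (fun a => binVal (m a) (w a)) := by
  unfold StBond.binVal
  refine foldl_of_growth (s := fun a (k : ℕ) b => min (k + k + bif b then 1 else 0) (m a))
    (by fun_prop) (by fun_prop) (by fun_prop) (fun a => sz (m a)) hm.1 fun a b _ k => ?_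
  have := min_le_right (k + k + bif b then 1 else 0) (m a)
  simp only [sz_nat]; omega

@[fun_prop]
theorem PolyF.numV {w : α → List Bool} (hw : PolyF w) : PolyF (fun a => numV (w a)) := by
  unfold StBond.numV; fun_prop

@[fun_prop]
theorem PolyF.edgeList {w : α → List Bool} (hw : PolyF w) : PolyF (fun a => edgeList (w a)) := by
  unfold StBond.edgeList prodPairs; fun_prop

@[fun_prop]
theorem PolyF.src {w : α → List Bool} (hw : PolyF w) : PolyF (fun a => src (w a)) := by
  unfold StBond.src afterMatrix; fun_prop

@[fun_prop]
theorem PolyF.tgt {w : α → List Bool} (hw : PolyF w) : PolyF (fun a => tgt (w a)) := by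
  unfold StBond.tgt afterMatrix; fun_prop

@[fun_prop]
theorem PolyF.capOf {w : α → List Bool} (hw : PolyF w) : PolyF (fun a => capOf (w a)) := by
  unfold StBond.capOf afterMatrix; fun_prop

theorem lead_unary_append (m : ℕ) (l : List Bool) : lead (unary m ++ l) = m := by
  have h1 (l : List Bool) : lead (false :: l) = 0 := by simp [lead, List.foldl_append]
  have h2 (l : List Bool) : lead (true :: l) = lead l + 1 := by simp [lead, List.foldl_append]
  unfold unary
  rw [List.append_assoc]
  induction m with
  | zero => exact h1 l
  | succ m ih => rw [List.replicate_succ, List.cons_append, h2, ih]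

theorem skip_unary_append (m : ℕ) (l : List Bool) : skip (unary m ++ l) = l := by
  rw [skip, lead_unary_append]
  have h : (unary m).length = m + 1 := by simp [unary]
  rw [← h, List.drop_left]

/-- Truncating after each digit commutes with the final minimum, because doubling and adding a digit
is monotone and does not decrease the value. The truncation matters: numbers are unary here, while
`k` comes in binary and may be exponentially large. -/
theorem binVal_bits (m k : ℕ) : binVal m (Nat.bits k) = min k m := by
  have h : ∀ l : List Bool, binVal m l =
      min (Nat.ofDigits 2 (l.map fun b => bif b then 1 else 0)) m := by
    intro l
    induction l with
    | nil => simp [binVal]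
    | cons b l ih =>
      have h1 : binVal m (b :: l) = min (binVal m l + binVal m l + bif b then 1 else 0) m := by
        simp [binVal, List.foldl_append]
      rw [h1, ih, List.map_cons, Nat.ofDigits_cons]
      cases b <;> simp <;> omega
  rw [h, ← Nat.digits_two_eq_bits, Nat.ofDigits_digits]

theorem getElem?_flatMap_append {ι κ : Type} {f : ι → List κ} {n : ℕ}
    (hf : ∀ b, (f b).length = n) (L : List ι) (l : List κ) {i j : ℕ} (hi : i < L.length) (hj : j < n) :
    (L.flatMap f ++ l)[i * n + j]? = (f L[i])[j]? := by
  induction L generalizing i with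
  | nil => simp at hi
  | cons b L ih =>
    rw [List.flatMap_cons, List.append_assoc]
    cases i with
    | zero => rw [List.getElem?_append_left (by rw [hf]; omega)]; simp
    | succ i =>
      rw [List.getElem?_append_right (by rw [hf, Nat.succ_mul]; omega), hf,
        Nat.succ_mul, Nat.add_right_comm, Nat.add_sub_cancel]
      exact ih (by simpa using hi)

/-! ### Decoding an instance, and bonds in terms of the decoded edges -/

namespace Instance

variable (I : Instance)

open Classical in
theorem encode_eq : I.encode = unary I.n ++ ((List.finRange I.n).flatMap
      (fun i => (List.finRange I.n).map (fun j => decide (I.graph.Adj i j))) ++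
    (unary I.source ++ (unary I.target ++ Nat.bits I.k))) := by
  simp only [encode, List.append_assoc]

theorem numV_encode : numV I.encode = I.n := by
  rw [encode_eq, numV, lead_unary_append]

theorem afterMatrix_encode :
    afterMatrix I.encode = unary I.source ++ (unary I.target ++ Nat.bits I.k) := by
  rw [afterMatrix, numV_encode, encode_eq, skip_unary_append, List.drop_left']
  simp [List.length_flatMap]

theorem src_encode : src I.encode = I.source := by
  rw [src, afterMatrix_encode, lead_unary_append]

theorem tgt_encode : tgt I.encode = I.target := by
  rw [tgt, afterMatrix_encode, skip_unary_append, lead_unary_append]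

theorem capOf_encode : capOf I.encode = min I.k (I.n * I.n + 1) := by
  rw [capOf, afterMatrix_encode, skip_unary_append, skip_unary_append, numV_encode, binVal_bits]

theorem mem_edgeList_encode {x y : ℕ} :
    (x, y) ∈ edgeList I.encode ↔ ∃ i j : Fin I.n, I.graph.Adj i j ∧ x = i ∧ y = j := by
  classical
  simp only [edgeList, numV_encode, List.mem_filter, mem_prodPairs, List.mem_range]
  have key : ∀ i j : Fin I.n, ((skip I.encode).drop (i * I.n + j)).headD false =
      decide (I.graph.Adj i j) := by
    intro i j
    rw [List.headD_eq_head?_getD, List.head?_drop, encode_eq, skip_unary_append,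
      getElem?_flatMap_append (by simp) _ _ (by simp) j.2]
    simp
  constructor
  · rintro ⟨⟨hx, hy⟩, h⟩
    exact ⟨⟨x, hx⟩, ⟨y, hy⟩, by simpa using (key ⟨x, hx⟩ ⟨y, hy⟩).symm.trans h, rfl, rfl⟩
  · rintro ⟨i, j, h, rfl, rfl⟩
    exact ⟨⟨i.2, j.2⟩, by rw [key]; simpa using h⟩

theorem nodup_edgeList (w : List Bool) : (edgeList w).Nodup :=
  List.Nodup.filter _ (List.Nodup.product List.nodup_range List.nodup_range)

theorem length_edgeList_le : (edgeList I.encode).length ≤ I.n * I.n := by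
  refine (List.length_filter_le _ _).trans ?_
  rw [length_prodPairs, numV_encode, List.length_range]

theorem isGraph_edgeList : IsGraph I.n (edgeList I.encode) := by
  constructor
  · intro x y h
    obtain ⟨i, j, h1, h2, h3⟩ := I.mem_edgeList_encode.1 h
    exact I.mem_edgeList_encode.2 ⟨j, i, h1.symm, h3, h2⟩
  · rintro ⟨x, y⟩ h
    obtain ⟨i, j, h1, h2, h3⟩ := I.mem_edgeList_encode.1 h
    simp only [h3, j.2]

theorem hasSeparations : HasSeparations I.n (edgeList I.encode) (treewidth I.graph) := by
  classical
  intro W hW hcard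
  obtain ⟨ι, -, D, hD⟩ := exists_treeDecomposition I.graph
  obtain ⟨W, rfl⟩ : ∃ W' : Finset (Fin I.n), W'.map Fin.valEmbedding = W := by
    refine ⟨W.attachFin hW, Finset.map_valEmbedding_attachFin hW⟩
  rw [Finset.card_map] at hcard
  obtain ⟨S, X, h1, h2, h3, h4, h5⟩ := D.exists_separation hD hcard
  refine ⟨S.map Fin.valEmbedding, X.map Fin.valEmbedding, by rwa [Finset.card_map], ?_, ?_, ?_, ?_⟩
  · intro y hy
    obtain ⟨y, hyX, rfl⟩ := Finset.mem_map.1 hy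
    rw [Finset.mem_map']
    exact h2 y hyX
  · intro y hy z hz
    obtain ⟨y, hyX, rfl⟩ := Finset.mem_map.1 hy
    obtain ⟨i, j, h6, h7, rfl⟩ := I.mem_edgeList_encode.1 hz
    obtain rfl : y = i := Fin.ext h7
    have h8 := h3 y hyX j h6
    rwa [← Finset.mem_map' Fin.valEmbedding, ← Finset.mem_map' Fin.valEmbedding] at h8
  · rw [← Finset.map_inter, Finset.card_map]
    convert h4
  · rw [← Finset.map_union, ← Finset.map_sdiff, Finset.card_map]
    convert h5

variable {I}

theorem connected_induce {σ : ℕ → Prop} {T : Set (Fin I.n)}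
    (hT : ∀ i j : Fin I.n, (σ i ↔ σ j) → (i ∈ T ↔ j ∈ T)) {r : Fin I.n} (hr : r ∈ T)
    (h : ∀ i ∈ T, ReflTransGen (SameSide (edgeList I.encode) σ) i r) :
    (I.graph.induce T).Connected := by
  have key : ∀ x, ReflTransGen (SameSide (edgeList I.encode) σ) x r → ∀ i (hi : i ∈ T), x = i.val →
      (I.graph.induce T).Reachable ⟨i, hi⟩ ⟨r, hr⟩ := by
    intro x hx
    induction hx using ReflTransGen.head_induction_on with
    | refl =>
      intro i hi hir
      obtain rfl : r = i := Fin.ext hir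
      exact .refl _
    | head h1 _ ih =>
      rintro i hi rfl
      obtain ⟨i', j, h2, h3, rfl⟩ := I.mem_edgeList_encode.1 h1.1
      obtain rfl : i = i' := Fin.ext h3
      have hj := (hT i j h1.2).1 hi
      exact (SimpleGraph.Adj.reachable (G := I.graph.induce T) (u := ⟨i, hi⟩) (v := ⟨j, hj⟩)
        h2).trans (ih j hj rfl)
  have : Nonempty T := ⟨⟨r, hr⟩⟩
  refine ⟨fun x y => ?_⟩
  exact (key _ (h x.1 x.2) x.1 x.2 rfl).trans (key _ (h y.1 y.2) y.1 y.2 rfl).symm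

theorem reflTransGen_of_connected {σ : ℕ → Prop} {T : Set (Fin I.n)}
    (hT : ∀ i j : Fin I.n, i ∈ T → j ∈ T → (σ i ↔ σ j)) (h : (I.graph.induce T).Connected)
    {i j : Fin I.n} (hi : i ∈ T) (hj : j ∈ T) :
    ReflTransGen (SameSide (edgeList I.encode) σ) i j := by
  have h1 := (SimpleGraph.reachable_iff_reflTransGen _ _).1 (h.preconnected ⟨i, hi⟩ ⟨j, hj⟩)
  refine ReflTransGen.lift (fun x : T => x.1.val) (fun x y hxy =>
    ⟨I.mem_edgeList_encode.2 ⟨_, _, hxy, rfl, rfl⟩, hT _ _ x.2 y.2⟩) _ _ h1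

/-- Each unordered cut edge corresponds to the unique listed pair whose smaller end comes first.
Both sides are compared as sets of unordered pairs of natural numbers. -/
theorem ncard_cutSet {σ : ℕ → Prop} {S : Set (Fin I.n)} (hS : ∀ i, i ∈ S ↔ σ i) :
    (cutSet I.graph S).ncard = cutCount (edgeList I.encode) σ := by
  classical
  have hinj : Function.Injective (Sym2.map (Fin.val : Fin I.n → ℕ)) :=
    Sym2.map.injective Fin.val_injective
  rw [cutCount, ← List.toFinset_card_of_nodup ((nodup_edgeList _).filter _),
    ← Set.ncard_image_of_injective _ hinj, ← Set.ncard_coe_finset,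
    ← Set.InjOn.ncard_image (f := fun e : ℕ × ℕ => s(e.1, e.2))]
  · congr 1
    ext e
    simp only [Set.mem_image, List.coe_toFinset, Set.mem_ofPred_eq, List.mem_filter,
      Bool.and_eq_true, decide_eq_true_eq, Nat.ble_eq, Prod.exists]
    constructor
    · rintro ⟨_, ⟨h1, u, v, h2, h3, rfl⟩, rfl⟩
      rw [hS] at h2 h3
      rcases Nat.lt_trichotomy u v with h | h | h
      · exact ⟨u, v, ⟨I.mem_edgeList_encode.2 ⟨u, v, h1, rfl, rfl⟩, h, by tauto⟩, rfl⟩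
      · exact absurd (Fin.ext h ▸ h2) h3
      · exact ⟨v, u, ⟨I.mem_edgeList_encode.2 ⟨v, u, h1.symm, rfl, rfl⟩, h, by tauto⟩, Sym2.eq_swap⟩
    · rintro ⟨x, y, ⟨h1, h2, h3⟩, rfl⟩
      obtain ⟨i, j, h4, rfl, rfl⟩ := I.mem_edgeList_encode.1 h1
      refine ⟨s(i, j), ⟨h4, ?_⟩, rfl⟩
      by_cases hi : σ i
      · exact ⟨i, j, (hS i).2 hi, fun h => h3 (iff_of_true hi ((hS j).1 h)), rfl⟩
      · refine ⟨j, i, (hS j).2 ?_, fun h => hi ((hS i).1 h), Sym2.eq_swap⟩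
        by_contra h
        exact h3 (iff_of_false hi h)
  · rintro ⟨a, b⟩ ha ⟨c, d⟩ hc h
    simp only [List.coe_toFinset, Set.mem_ofPred_eq, List.mem_filter, Bool.and_eq_true,
      Nat.ble_eq] at ha hc
    have h1 := ha.2.1
    have h2 := hc.2.1
    rcases Sym2.eq_iff.1 h with ⟨h3, h4⟩ | ⟨h3, h4⟩
    · exact Prod.ext h3 h4
    · simp only at h3 h4; omega

/-- No cut has more than `n * n` edges, so lowering the demand to at most `n * n + 1` is harmless.
Paths of `SameSide` keep the side, so a vertex on the side of the source can only reach the source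
and one on the other side only the target: this is the connectedness of both parts. -/
theorem isYes_iff : I.IsYes ↔ HasBond I.n (edgeList I.encode) I.source I.target
    (min I.k (I.n * I.n + 1)) := by
  have hcap (σ : ℕ → Prop) : min I.k (I.n * I.n + 1) ≤ cutCount (edgeList I.encode) σ ↔
      I.k ≤ cutCount (edgeList I.encode) σ := by
    have : cutCount (edgeList I.encode) σ ≤ I.n * I.n :=
      (List.length_filter_le _ _).trans I.length_edgeList_le
    omega
  simp only [HasBond, hcap]
  constructor
  · rintro ⟨S, hs, ht, h1, h2, h3⟩
    have hσ : ∀ i : Fin I.n, i ∈ S ↔ ∃ j ∈ S, j.val = i.val := fun i =>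
      ⟨fun h => ⟨i, h, rfl⟩, fun ⟨j, h, hj⟩ => Fin.ext hj ▸ h⟩
    refine ⟨fun x => ∃ j ∈ S, j.val = x, (hσ _).1 hs, fun h => ht ((hσ _).2 h), ?_,
      ncard_cutSet (σ := fun x => ∃ j ∈ S, j.val = x) hσ ▸ h3⟩
    intro u hu
    by_cases h : (⟨u, hu⟩ : Fin I.n) ∈ S
    · refine Or.inl (reflTransGen_of_connected (i := ⟨u, hu⟩) (fun i j hi hj => ?_) h1 h hs)
      exact iff_of_true ((hσ i).1 hi) ((hσ j).1 hj)
    · refine Or.inr (reflTransGen_of_connected (i := ⟨u, hu⟩) (fun i j hi hj => ?_) h2 h ht)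
      exact iff_of_false (fun h => hi ((hσ i).2 h)) (fun h => hj ((hσ j).2 h))
  · rintro ⟨σ, hs, ht, h1, h2⟩
    have hpres : ∀ {x y}, ReflTransGen (SameSide (edgeList I.encode) σ) x y → (σ x ↔ σ y) := by
      intro x y h
      induction h with
      | refl => rfl
      | tail _ h ih => exact ih.trans h.2
    refine ⟨{i | σ i}, hs, ht, ?_, ?_,
      h2.trans_eq (ncard_cutSet (σ := σ) fun i => Iff.rfl).symm⟩
    · refine connected_induce (σ := σ) (fun i j h => h) hs fun i hi => ?_
      exact (h1 i i.2).resolve_right fun h => ht ((hpres h).1 hi)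
    · refine connected_induce (σ := σ) (fun i j h => not_congr h) ht fun i hi => ?_
      exact (h1 i i.2).resolve_left fun h => hi ((hpres h).2 hs)

end Instance

/-! ### The main loop -/

/-- The cost splits into a number of rounds `N`, which need not be polynomial in the input, and a
fixed power of a common bound `S` for the sizes of the input and all states. The continuation flag
is kept in variable `M`, outside the reach of `p₂`. -/
theorem exists_while_prog {init : List Bool → γ} {cont res : γ → Bool} {step : γ → γ}
    (hi : PolyF init) (hc : PolyF cont) (hr : PolyF res) (hs : PolyF step) :
    ∃ (p : Prog) (c : ℕ), ∀ (w : List Bool) (N S : ℕ),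
      (∀ i < N, cont (step^[i] (init w)) = true) → cont (step^[N] (init w)) = false →
      (∀ i ≤ N, sz (step^[i] (init w)) ≤ S) → sz w ≤ S →
      ∃ τ, Reaches p (initStore w) ((N + 2) * (S + 2) ^ c) τ ∧
        (τ 0 ≠ .nil ↔ res (step^[N] (init w)) = true) := by
  have h₁ : PolyF (fun w => (cont (init w), init w)) := by fun_prop
  have h₂ : PolyF (fun x => (cont (step x), step x)) := by fun_prop
  obtain ⟨-, p₁, m₁, T₁, hm₁, ⟨c₁, hT₁⟩, hp₁⟩ := h₁
  obtain ⟨-, p₂, m₂, T₂, hm₂, ⟨c₂, hT₂⟩, hp₂⟩ := h₂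
  obtain ⟨-, p₃, m₃, T₃, hm₃, ⟨c₃, hT₃⟩, hp₃⟩ := hr
  set M := max m₁ m₂
  have hM : 0 < M := lt_max_of_lt_left hm₁
  let load : Prog := .seq (.hd M 0) (.tl 0 0)
  have hload : ∀ (b : Bool) (x : γ) (σ : Store), σ 0 = enc (b, x) →
      ∃ τ, Reaches load σ 2 τ ∧ τ 0 = enc x ∧ τ M = enc b := by
    intro b x σ hσ
    refine ⟨_, (Reaches.hd _ _ _).seq (Reaches.tl _ _ _), ?_, ?_⟩
    · rw [Function.update_self, Function.update_of_ne hM.ne, hσ]; rfl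
    · rw [Function.update_of_ne hM.ne', Function.update_self, hσ]; rfl
  have hloop : ∀ (S N : ℕ) (x : γ) (σ : Store), σ 0 = enc x → σ M = enc (cont x) →
      (∀ i < N, cont (step^[i] x) = true) → cont (step^[N] x) = false →
      (∀ i ≤ N, sz (step^[i] x) ≤ S) → ∃ τ, Reaches (.loop M (.seq p₂ load)) σ
        (N * ((S + 1) ^ c₂ + 3) + 1) τ ∧ τ 0 = enc (step^[N] x) := by
    intro S N
    induction N with
    | zero =>
      intro x σ h0 hσ _ h1 _
      refine ⟨σ, (Reaches.loopDone ?_).mono (by omega), h0⟩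
      rw [hσ, show cont x = false from h1]; rfl
    | succ N ih =>
      intro x σ h0 hσ h1 h2 h3
      obtain ⟨τ, h4, h5, -⟩ := hp₂ x σ h0
      obtain ⟨ρ, h6, h7, h8⟩ := hload _ _ τ h5
      obtain ⟨υ, h9, h10⟩ := ih (step x) ρ h7 h8
        (fun i hi => by rw [← Function.iterate_succ_apply]; exact h1 _ (by omega))
        (by rw [← Function.iterate_succ_apply]; exact h2)
        (fun i hi => by rw [← Function.iterate_succ_apply]; exact h3 _ (by omega))
      have hx : σ M ≠ .nil := by
        rw [hσ, show cont x = true from h1 0 (by omega)]; exact Val.noConfusion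
      refine ⟨υ, (Reaches.loopStep hx (h4.seq h6) h9).mono ?_, h10⟩
      have h11 : T₂ x ≤ (S + 1) ^ c₂ := (hT₂ x).trans (Nat.pow_le_pow_left (Nat.succ_le_succ (h3 0 (by omega))) c₂)
      rw [Nat.succ_mul]; omega
  refine ⟨.seq p₁ (.seq load (.seq (.loop M (.seq p₂ load)) p₃)), c₁ + c₂ + c₃ + 2, ?_⟩
  intro w N S h1 h2 h3 hw
  have hw0 : initStore w 0 = enc w := by rw [enc_ofBits]; rfl
  obtain ⟨τ₁, h4, h5, -⟩ := hp₁ w (initStore w) hw0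
  obtain ⟨τ₂, h6, h7, h8⟩ := hload _ _ τ₁ h5
  obtain ⟨τ₃, h9, h10⟩ := hloop S N (init w) τ₂ h7 h8 h1 h2 h3
  obtain ⟨τ₄, h11, h12, -⟩ := hp₃ _ τ₃ h10
  refine ⟨τ₄, (h4.seq (h6.seq (h9.seq h11))).mono ?_, ?_⟩
  · have key : ∀ c T x, T ≤ (x + 1) ^ c → x ≤ S → c ≤ c₁ + c₂ + c₃ →
        T + 3 ≤ (S + 2) ^ (c₁ + c₂ + c₃ + 2) := by
      intro c T x hT hx hc
      have h13 : T ≤ (S + 2) ^ (c₁ + c₂ + c₃) := hT.trans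
        ((Nat.pow_le_pow_left (by omega) c).trans (Nat.pow_le_pow_right (by omega) hc))
      have h14 : 1 ≤ (S + 2) ^ (c₁ + c₂ + c₃) := Nat.one_le_pow _ _ (by omega)
      have h15 : 4 ≤ (S + 2) ^ 2 := Nat.pow_le_pow_left (show 2 ≤ S + 2 by omega) 2
      have h16 := Nat.mul_le_mul_left ((S + 2) ^ (c₁ + c₂ + c₃)) h15
      rw [pow_add]
      omega
    have k1 := key c₁ _ _ (hT₁ w) hw (by omega)
    have k2 := key c₂ _ S le_rfl le_rfl (by omega)
    have k3 := key c₃ _ _ (hT₃ _) (h3 N le_rfl) (by omega)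
    have k4 := Nat.mul_le_mul_left N k2
    rw [Nat.add_mul]
    omega
  · rw [h12]
    cases res (step^[N] (init w))
    · exact iff_of_false (fun h => h rfl) Bool.noConfusion
    · exact iff_of_true Val.noConfusion rfl

/-! ### The sequence of parameters and the final bound -/

/-- A sufficient number of sublists for treewidth `k`. -/
def padAt (k : ℕ) : ℕ := Nat.rec (2 ^ 64) (fun _ p => p * p * (p * p)) k

theorem padAt_succ (k : ℕ) : padAt (k + 1) = padAt k * padAt k * (padAt k * padAt k) := rfl

theorem computable_padAt : Computable padAt := by
  refine Primrec.to_comp ?_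
  refine Primrec.nat_rec' (f := fun k : ℕ => k) (g := fun _ => 2 ^ 64)
    (h := fun _ q => q.2 * q.2 * (q.2 * q.2)) Primrec.id (Primrec.const _) ?_
  have h : Primrec₂ fun (_ : ℕ) (q : ℕ × ℕ) => q.2 * q.2 := 
    Primrec.nat_mul.comp (Primrec.snd.comp Primrec.snd) (Primrec.snd.comp Primrec.snd)
  exact Primrec.nat_mul.comp h h

theorem padAt_eq (k : ℕ) : padAt k = 2 ^ (64 * 4 ^ k) := by
  induction k with
  | zero => rfl
  | succ k ih => rw [padAt_succ, ih, ← pow_add, ← pow_add]; congr 1; ring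

theorem padAt_mono : Monotone padAt := by
  intro a b h
  rw [padAt_eq, padAt_eq]
  exact Nat.pow_le_pow_right (by norm_num)
    (Nat.mul_le_mul_left _ (Nat.pow_le_pow_right (by norm_num) h))

/-- Here `64 * 4 ^ k` is the square of `8 * 2 ^ k`, which is at least `5k + 8`. This choice makes
the next value the fourth power of the current one, so the loop updates it by multiplications alone.
-/
theorem le_padAt (k : ℕ) : 2 ^ ((5 * k + 8) * (5 * k + 8)) ≤ padAt k := by
  rw [padAt_eq]
  refine Nat.pow_le_pow_right (by norm_num) ?_
  have h : 5 * k + 8 ≤ 8 * 2 ^ k := by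
    induction k with
    | zero => simp
    | succ k ih => rw [pow_succ]; omega
  have h4 : 64 * 4 ^ k = 8 * 2 ^ k * (8 * 2 ^ k) := by
    rw [show 4 = 2 * 2 from rfl, Nat.mul_pow]; ring
  rw [h4]
  exact Nat.mul_le_mul h h

/-- An elimination order for the input, if its treewidth is at most the second component. -/
def placement (x : List Bool × ℕ × ℕ) : Bool × List ℕ :=
  place (numV x.1) (edgeList x.1) x.2.1 x.2.2 (src x.1) (tgt x.1)

/-- The parameter is too small. -/
def tooSmall (x : List Bool × ℕ × ℕ) : Bool := !Nat.beq (src x.1) (tgt x.1) && !(placement x).1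

/-- The answer, provided that the parameter is large enough. -/
def answer (x : List Bool × ℕ × ℕ) : Bool :=
  !Nat.beq (src x.1) (tgt x.1) && solve (numV x.1) (edgeList x.1) x.2.2 (capOf x.1) (src x.1)
    (tgt x.1) (placement x).2

/-- The next parameter. -/
def nextParam (x : List Bool × ℕ × ℕ) : List Bool × ℕ × ℕ :=
  (x.1, x.2.1 + 1, x.2.2 * x.2.2 * (x.2.2 * x.2.2))

theorem iterate_nextParam (w : List Bool) (i : ℕ) :
    nextParam^[i] (w, 0, padAt 0) = (w, i, padAt i) := by
  induction i with
  | zero => rfl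
  | succ i ih => rw [Function.iterate_succ_apply', ih, nextParam, padAt_succ]

/-- No relation between `i` and the treewidth is needed: a successful placement already certifies
the width of its order. Equal terminals form a separate case, answered negatively without a
placement. -/
theorem Instance.answer_spec (I : Instance) {i : ℕ}
    (h : tooSmall (I.encode, i, padAt i) = false) :
    answer (I.encode, i, padAt i) = true ↔ I.IsYes := by
  rw [I.isYes_iff]
  by_cases hst : (I.source : ℕ) = I.target
  · refine iff_of_false ?_ ?_
    · rw [answer, I.src_encode, I.tgt_encode, hst]; simp
    · rintro ⟨σ, h1, h2, -⟩
      exact h2 (hst ▸ h1)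
  · have hst' : Nat.beq I.source I.target = false := by
      rw [← Bool.not_eq_true, Nat.beq_eq]; exact hst
    simp only [tooSmall, answer, placement, I.src_encode, I.tgt_encode, hst', I.numV_encode,
      I.capOf_encode, Bool.not_false, Bool.true_and, Bool.not_eq_false'] at h ⊢
    obtain ⟨h1, h2⟩ := (place_spec I.isGraph_edgeList I.source.2 I.target.2 hst).1 h
    refine solve_spec I.isGraph_edgeList I.source.2 I.target.2 hst ?_ h1 h2 (le_padAt i)
    have := I.k_pos
    omega

theorem Instance.tooSmall_treewidth (I : Instance) :
    tooSmall (I.encode, treewidth I.graph, padAt (treewidth I.graph)) = false := by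
  by_cases hst : (I.source : ℕ) = I.target
  · simp [tooSmall, I.src_encode, I.tgt_encode, hst]
  · simp only [tooSmall, placement, I.src_encode, I.tgt_encode, I.numV_encode]
    rw [(place_spec I.isGraph_edgeList I.source.2 I.target.2 hst).2 I.hasSeparations
      (le_trans (Nat.pow_le_pow_right (by norm_num) (by nlinarith)) (le_padAt _))]
    simp

theorem sz_bits_le (w : List Bool) : sz w ≤ 4 * w.length + 1 := by
  induction w with
  | nil => simp
  | cons b w ih =>
    have := sz_bool_le b
    rw [sz_cons, List.length_cons]; omega

end StBond

theorem mainTheorem7 : StBond.FixedParameterTractable StBond.Instance.encode StBond.Instance.IsYes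
    (fun I : StBond.Instance => StBond.treewidth I.graph) := by
  open StBond in
  obtain ⟨p, c, hp⟩ := exists_while_prog (init := fun w => (w, 0, padAt 0)) (cont := tooSmall)
    (res := answer) (step := nextParam) (by fun_prop) (by unfold tooSmall placement; fun_prop)
    (by unfold answer placement; fun_prop) (by unfold nextParam; fun_prop)
  simp only [iterate_nextParam] at hp
  -- The factor `k + 2` bounds the rounds. The other factor is what remains of the state size after
  -- the input length has been extracted.
  refine ⟨p, fun k => (k + 2) * (2 * k + 2 * padAt k + 11) ^ c, c, ?_, fun I => ?_⟩
  · have h : Computable fun k => 2 * k + 2 * padAt k + 11 :=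
      Primrec.nat_add.to_comp.comp (Primrec.nat_add.to_comp.comp
        (Primrec.nat_mul.to_comp.comp (Computable.const 2) Computable.id)
        (Primrec.nat_mul.to_comp.comp (Computable.const 2) computable_padAt)) (Computable.const 11)
    have h' : Computable fun k => (2 * k + 2 * padAt k + 11) ^ c := by
      clear hp
      induction c with
      | zero => simpa using Computable.const 1
      | succ c ih => simpa only [pow_succ] using Primrec.nat_mul.to_comp.comp ih h
    exact Primrec.nat_mul.to_comp.comp
      (Primrec.nat_add.to_comp.comp Computable.id (Computable.const 2)) h'
  · classical
    set k := treewidth I.graph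
    have hex : ∃ i, tooSmall (I.encode, i, padAt i) = false := ⟨_, I.tooSmall_treewidth⟩
    -- The loop stops at the first parameter that works, possibly before the treewidth is reached.
    have hN : Nat.find hex ≤ k := Nat.find_min' hex I.tooSmall_treewidth
    have hlen : 1 ≤ I.encode.length := by
      rw [I.encode_eq]; simp [unary]; omega
    have hw := sz_bits_le I.encode
    -- The bound is the size of the state: at most `4 * length + 1` for the input, `2k + 1` and `2 *
    -- padAt k + 1` for the unary numbers, and two cells for the pairs.
    obtain ⟨τ, ⟨U, h1, h2⟩, h3⟩ := hp I.encode (Nat.find hex)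
      (4 * I.encode.length + 2 * k + 2 * padAt k + 5)
      (fun i hi => by simpa using Nat.find_min hex hi) (Nat.find_spec hex) (fun i hi => by
        have := padAt_mono (hi.trans hN)
        simp only [sz_mk, sz_nat]; omega) (by omega)
    refine ⟨U, τ, h1.trans ?_, h2, h3.trans (I.answer_spec (Nat.find_spec hex))⟩
    simp only
    rw [Nat.mul_assoc, ← Nat.mul_pow]
    refine Nat.mul_le_mul (by omega) (Nat.pow_le_pow_left ?_ c)
    -- The input is nonempty, so the summands without its length may be multiplied by it, turning
    -- the sum into a product.
    have h4 : 2 * k + 2 * padAt k + 7 ≤ (2 * k + 2 * padAt k + 7) * I.encode.length :=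
      Nat.le_mul_of_pos_right _ hlen
    rw [show 2 * k + 2 * padAt k + 11 = 2 * k + 2 * padAt k + 7 + 4 by omega, Nat.add_mul]
    omega
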